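/- Let $n\ge 3$ and let $\Omega=\bigcap_{m=0}^q\{u_m\le 0\}\subset\mathbb R^n$ be a compact convex polytope with non-empty interior, where $u_0,\dots,u_q$ are affine functions whose Euclidean gradients are unit vectors $N_0,\dots,N_q\in S^{n-1}$. Assume that no inequality is redundant, i.e. for each $k$ the set $\{u_k>0\}\cap\bigcap_{m\ne k}\{u_m\le 0\}$ is non-empty, and that $\langle N_j,N_k\rangle\le 0$ whenever $j<k$ and $\{u_j=u_k=0\}$ meets $\Omega$. Let $g$ be a smooth Riemannian metric on $\mathbb R^n$, let $\nabla$, $|\nabla\cdot|$ be taken with respect to $g$, and put $\nu_k=\nabla u_k/|\nabla u_k|$. Assume that $\langle\nu_j,\nu_k\rangle\le\langle N_j,N_k\rangle$ at every $x\in\Omega$ with $u_j(x)=u_k(x)=0$, $j<k$ (here and below, products of the vectors $\nu$, $\hat\nu$ are taken with respect to $g$, products of the vectors $N$, $\hat N$ are Euclidean), and that the mean curvature of $\{u_k=0\}$ with respect to $g$ and the normal $\nu_k$ is nonnegative on $\Omega\cap\{u_k=0\}$ for each $k$. Fix a smooth even function $\eta:\mathbb R\to\mathbb R$ with $\eta(t)=|t|$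 for $|t|\ge\frac12$ and $\eta''\ge 0$. For $\gamma\in(0,\frac12)$ and $\lambda_0>1$ put $\lambda_k=\gamma^{-k}\lambda_0$, $\hat u_0=u_0$, and $$\hat u_k=\tfrac12\big(\hat u_{k-1}+u_k+\lambda_k^{-1}\eta(\lambda_k(\hat u_{k-1}-u_k))\big)\qquad(1\le k\le q),$$ $\hat\nu_k=\nabla\hat u_k/|\nabla\hat u_k|$, and $\hat\Sigma=\{\hat u_q=0\}$. Let $\hat N_0=N_0$. For $1\le k\le q$, let $\hat N_k=\hat N_{k-1}$ where $\hat u_{k-1}-u_k>\lambda_k^{-1}$, let $\hat N_k=N_k$ where $\hat u_{k-1}-u_k<-\lambda_k^{-1}$, and, where $|\hat u_{k-1}-u_k|\le\lambda_k^{-1}$, $$\hat N_k=\frac{\sin(\theta(\alpha+\varphi))\,\hat N_{k-1}+\sin(\theta(\alpha-\varphi))\,N_k}{\sin(2\theta\alpha)},$$ where $\alpha\in(0,\frac\pi2)$, $\theta\in(0,\frac\pi{2\alpha})$ and $\varphi\in[-\alpha,\alpha]$ are given by $\cos(2\alpha)=\langle\hat\nu_{k-1},\nu_k\rangle$, $\cos(2\theta\alpha)=\langle\hat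 N_{k-1},N_k\rangle$ and, with $s=\eta'(\lambda_k(\hat u_{k-1}-u_k))$, $$\frac{\tan\varphi}{\tan\alpha}=\frac{(1+s)|\nabla\hat u_{k-1}|-(1-s)|\nabla u_k|}{(1+s)|\nabla\hat u_{k-1}|+(1-s)|\nabla u_k|}.$$ (The last case is used only where $d\hat u_{k-1}\wedge du_k\ne0$ and $\hat N_{k-1}\wedge N_k\ne0$.) Let $\hat N$ be the restriction of $\hat N_q$ to $\hat\Sigma$, let $H$ be the mean curvature of $\hat\Sigma$ with respect to $g$ and the normal $\hat\nu_q$, and let $\|d\hat N\|_{\rm tr}$ be the trace norm (sum of the singular values) of $d\hat N$, with respect to $g$ on $T\hat\Sigma$ and the Euclidean inner product on the target. For $0\le i<j<k\le q$ let $G_{i,j,k}$ be the set of all points of $\hat\Sigma$ at which $\hat u_{m-1}-u_m>\lambda_m^{-1}$ for $k+1\le m\le q$ and for $j+1\le m\le k-1$, $\hat u_{k-1},u_k\in[-2\lambda_k^{-1},0]$, $u_j\in[-4\lambda_j^{-1},0]$ and $u_i\in[-6\lambda_i^{-1},0]$. For $0\le j<k\le q$ let $E_{j,k}$ be the set of all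 points of $\hat\Sigma$ at which $\hat u_{m-1}-u_m>\lambda_m^{-1}$ for $k+1\le m\le q$ and for $j+1\le m\le k-1$, $\hat u_{k-1},u_k,u_j\in[-2\lambda_k^{-1},0]$ and, if $j\ge1$, $\hat u_{j-1}-u_j<-\lambda_j^{-1}$. Then there are constants $C>0$ and $L>1$, depending only on $\Omega$ (with its defining functions), $g$ and $\eta$ (in particular independent of $\gamma$ and $\lambda_0$), such that for all $\gamma\in(0,\frac12)$ and all $\lambda_0\ge L$: $d\hat u_q\neq0$ on $\hat\Sigma$ and $\hat N_q$ is smooth near every point of $\hat\Sigma$ (so that $H$ and $d\hat N$ are defined); $$H-\|d\hat N\|_{\rm tr}\ \ge\ -C\lambda_k\max\{\langle\hat\nu_j,\nu_k\rangle-\langle\hat N_j,N_k\rangle,0\}-C\lambda_j\quad\text{on }G_{i,j,k}\text{ for all }0\le i<j<k\le q;$$ and $$H-\|d\hat N\|_{\rm tr}\ \ge\ -C\lambda_k\max\{\langle\nu_j,\nu_k\rangle-\langle N_j,N_k\rangle,0\}-C\quad\text{on }E_{j,k}\text{ for all }0\le j<k\le q.$$ -/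

import Mathlib

open scoped ContDiff RealInnerProductSpace

noncomputable section

namespace PolytopeSmoothing

/-- Euclidean space of dimension `n`. -/
abbrev E (n : ℕ) := EuclideanSpace ℝ (Fin n)

/-! ### Riemannian geometry of a metric on Euclidean space, in the global chart -/

/-- A smooth Riemannian metric on `ℝⁿ`; every tangent space is identified with `ℝⁿ`. -/
structure RiemannianMetric (n : ℕ) where
  /-- the inner product on the tangent space at a point -/
  form : E n → E n →L[ℝ] E n →L[ℝ] ℝ
  symm : ∀ x v w, form x v w = form x w v
  pos : ∀ x v, v ≠ 0 → 0 < form x v v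
  smooth : ContDiff ℝ ∞ form

variable {n : ℕ}

/-- The length `|v|` of a tangent vector at `x` with respect to `g`. -/
def RiemannianMetric.norm (g : RiemannianMetric n) (x v : E n) : ℝ :=
  √(g.form x v v)

/-- The musical isomorphism from covectors at `x` to vectors at `x`, the inverse of the
isomorphism `v ↦ ⟨v, ·⟩`. -/
def RiemannianMetric.sharp (g : RiemannianMetric n) (x : E n) : (E n →L[ℝ] ℝ) →L[ℝ] E n :=
  (g.form x).inverse

/-- The form of a metric is an isomorphism onto the covectors, so that `sharp` is its inverse. -/
theorem RiemannianMetric.form_sharp (g : RiemannianMetric n) (x : E n) (β : E n →L[ℝ] ℝ)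
    (w : E n) : g.form x (g.sharp x β) w = β w := by
  have hinj : Function.Injective (g.form x) := by
    rw [injective_iff_map_eq_zero]
    intro v hv
    by_contra hne
    have h := g.pos x v hne
    rw [hv] at h
    simp at h
  have hfin : Module.finrank ℝ (E n) = Module.finrank ℝ (E n →L[ℝ] ℝ) :=
    (InnerProductSpace.toDual ℝ (E n)).toLinearEquiv.finrank_eq
  have hinj' : Function.Injective (g.form x : E n →ₗ[ℝ] (E n →L[ℝ] ℝ)) := hinj
  let e : E n ≃L[ℝ] (E n →L[ℝ] ℝ) :=
    (LinearEquiv.ofInjectiveOfFinrankEq (g.form x : E n →ₗ[ℝ] (E n →L[ℝ] ℝ))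
      hinj' hfin).toContinuousLinearEquiv
  have he : (e : E n →L[ℝ] (E n →L[ℝ] ℝ)) = g.form x := by
    ext v w
    rfl
  have hs : g.sharp x = (e.symm : (E n →L[ℝ] ℝ) →L[ℝ] E n) := by
    unfold RiemannianMetric.sharp
    rw [← he, ContinuousLinearMap.inverse_equiv]
  rw [hs, ← he]
  simp

/-- The gradient of `f` with respect to `g`. -/
def RiemannianMetric.grad (g : RiemannianMetric n) (f : E n → ℝ) (x : E n) : E n :=
  g.sharp x (fderiv ℝ f x)

/-- The unit normal `∇f / |∇f|` to the level sets of `f`, with respect to `g`. -/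
def RiemannianMetric.unitNormal (g : RiemannianMetric n) (f : E n → ℝ) (x : E n) : E n :=
  (g.norm x (g.grad f x))⁻¹ • g.grad f x

/-- For a tangent vector `v` at `x`, the map sending `ξ` to the covector
`ζ ↦ ½ ((∂_ξ g)(v, ζ) + (∂_v g)(ξ, ζ) - (∂_ζ g)(v, ξ))`
(the Koszul formula for constant vector fields). -/
def RiemannianMetric.koszul (g : RiemannianMetric n) (x v : E n) : E n →L[ℝ] E n →L[ℝ] ℝ :=
  (1 / 2 : ℝ) • ((fderiv ℝ g.form x).flip v + fderiv ℝ g.form x v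
    - ((fderiv ℝ g.form x).flip v).flip)

/-- The Levi-Civita covariant derivative `ξ ↦ D_ξ V` at `x` of a vector field `V`: the sum of the
derivative of the components and of the Christoffel term. -/
def RiemannianMetric.covDeriv (g : RiemannianMetric n) (V : E n → E n) (x : E n) :
    E n →L[ℝ] E n :=
  fderiv ℝ V x + (g.sharp x).comp (g.koszul x (V x))

/-- The `g`-orthogonal projection `ξ ↦ ξ - ⟨ν, ξ⟩ ν` onto the tangent space at `x` of the level set
of `f` through `x`. -/
def RiemannianMetric.tangentProj (g : RiemannianMetric n) (f : E n → ℝ) (x : E n) :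
    E n →L[ℝ] E n :=
  ContinuousLinearMap.id ℝ (E n)
    - (g.form x (g.unitNormal f x)).smulRight (g.unitNormal f x)

/-- The mean curvature at `x` of the level set of `f` through `x`, with respect to `g` and the unit
normal `ν = ∇f / |∇f|`: the trace of `ξ ↦ D_ξ ν` over the tangent space of the level set. -/
def RiemannianMetric.meanCurvature (g : RiemannianMetric n) (f : E n → ℝ) (x : E n) : ℝ :=
  LinearMap.trace ℝ (E n)
    ((g.covDeriv (g.unitNormal f) x).comp (g.tangentProj f x) : E n →ₗ[ℝ] E n)

/-- `A* A`, where `A* ` is the adjoint of `A` viewed as a map from `ℝⁿ` with the inner product `g`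
at `x` to `ℝⁿ` with the Euclidean inner product; that is, `⟨A* A ξ, ζ⟩_g = ⟨A ξ, A ζ⟩`. -/
def RiemannianMetric.adjointMulSelf (g : RiemannianMetric n) (x : E n) (A : E n →L[ℝ] E n) :
    E n →L[ℝ] E n :=
  (g.sharp x).comp ((innerSL ℝ : E n →L[ℝ] E n →L[ℝ] ℝ).bilinearComp A A)

/-- The trace norm at `x` of the differential of the restriction of the map `F` to the level set of
`f` through `x`: the sum of its singular values (square roots of the eigenvalues of `A* A`, with
multiplicities), where the tangent space of the level set carries the inner product `g` and the
target the Euclidean one. Composing with the projection to the tangent space only adds the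
singular value `0`, in the normal direction. -/
def RiemannianMetric.traceNormOnLevelSet (g : RiemannianMetric n) (f : E n → ℝ) (F : E n → E n)
    (x : E n) : ℝ :=
  ((LinearMap.charpoly
    (g.adjointMulSelf x ((fderiv ℝ F x).comp (g.tangentProj f x)) : E n →ₗ[ℝ] E n)).roots.map
      Real.sqrt).sum

/-! ### The polytope and its smoothing -/

/-- Half-spaces `{u_m ≤ 0}`, `0 ≤ m ≤ q`, where `u_m` is the affine function with gradient `N_m`
and value `b_m` at the origin. The entries of `N` and `b` beyond `q` play no role. -/
structure HalfSpaces (n : ℕ) where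
  q : ℕ
  N : ℕ → E n
  b : ℕ → ℝ

/-- The affine function `u_m`. -/
def HalfSpaces.u (P : HalfSpaces n) (m : ℕ) (x : E n) : ℝ :=
  ⟪P.N m, x⟫ + P.b m

/-- The polytope `Ω`, the intersection of the half-spaces. -/
def HalfSpaces.Omega (P : HalfSpaces n) : Set (E n) :=
  {x | ∀ m ≤ P.q, P.u m x ≤ 0}

/-- The admissible smoothings `η` of the absolute value. -/
structure IsSmoothAbs (η : ℝ → ℝ) : Prop where
  smooth : ContDiff ℝ ∞ η
  even : ∀ t, η (-t) = η t
  eq_abs : ∀ t, 1 / 2 ≤ |t| → η t = |t|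
  convex : ∀ t, 0 ≤ deriv (deriv η) t

/-- `λ_k = γ⁻ᵏ λ₀`. -/
def lam (γ lam₀ : ℝ) (k : ℕ) : ℝ := (γ⁻¹) ^ k * lam₀

/-- The functions `û_k`. -/
def HalfSpaces.uhat (P : HalfSpaces n) (η : ℝ → ℝ) (γ lam₀ : ℝ) : ℕ → E n → ℝ
  | 0 => P.u 0
  | k + 1 => fun x =>
      1 / 2 * (P.uhat η γ lam₀ k x + P.u (k + 1) x
        + (lam γ lam₀ (k + 1))⁻¹
          * η (lam γ lam₀ (k + 1) * (P.uhat η γ lam₀ k x - P.u (k + 1) x)))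

/-- The hypersurface `Σ̂ = {û_q = 0}`. -/
def HalfSpaces.SigmaHat (P : HalfSpaces n) (η : ℝ → ℝ) (γ lam₀ : ℝ) : Set (E n) :=
  {x | P.uhat η γ lam₀ P.q x = 0}

/-- The point
`(sin (θ (α + φ)) V + sin (θ (α - φ)) W) / sin (2 θ α)` on the great circle through the unit
vectors `V` and `W`, where `2 α ∈ (0, π)` has cosine `c`, `2 θ α ∈ (0, π)` has cosine `⟨V, W⟩`, and
`φ ∈ [-α, α]` is determined by `tan φ / tan α = r`. -/
def blend (c r : ℝ) (V W : E n) : E n :=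
  let α := Real.arccos c / 2
  let θ := Real.arccos ⟪V, W⟫ / (2 * α)
  let φ := Real.arctan (r * Real.tan α)
  (Real.sin (2 * θ * α))⁻¹ •
    (Real.sin (θ * (α + φ)) • V + Real.sin (θ * (α - φ)) • W)

/-- The ratio
`((1 + s) |∇f| - (1 - s) |∇h|) / ((1 + s) |∇f| + (1 - s) |∇h|)` at `x`, with lengths and gradients
taken with respect to `g`. -/
def RiemannianMetric.gradRatio (g : RiemannianMetric n) (s : ℝ) (f h : E n → ℝ) (x : E n) : ℝ :=
  ((1 + s) * g.norm x (g.grad f x) - (1 - s) * g.norm x (g.grad h x))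
    / ((1 + s) * g.norm x (g.grad f x) + (1 - s) * g.norm x (g.grad h x))

/-- The maps `N̂_k`, by recursion on `k`. The formula is meaningful on the open set `W_k` where the
vectors that are interpolated are linearly independent; for large `λ₀` the set `W_q` contains `Σ̂`.
Values outside `W_k` are irrelevant. -/
def HalfSpaces.Nhat (P : HalfSpaces n) (g : RiemannianMetric n) (η : ℝ → ℝ) (γ lam₀ : ℝ) :
    ℕ → E n → E n
  | 0 => fun _ => P.N 0
  | k + 1 => fun x =>
      if (lam γ lam₀ (k + 1))⁻¹ < P.uhat η γ lam₀ k x - P.u (k + 1) x then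
        P.Nhat g η γ lam₀ k x
      else if P.uhat η γ lam₀ k x - P.u (k + 1) x < -(lam γ lam₀ (k + 1))⁻¹ then
        P.N (k + 1)
      else
        blend
          (g.form x (g.unitNormal (P.uhat η γ lam₀ k) x) (g.unitNormal (P.u (k + 1)) x))
          (g.gradRatio
            (deriv η (lam γ lam₀ (k + 1) * (P.uhat η γ lam₀ k x - P.u (k + 1) x)))
            (P.uhat η γ lam₀ k) (P.u (k + 1)) x)
          (P.Nhat g η γ lam₀ k x) (P.N (k + 1))

/-- The mean curvature `H` of `Σ̂` with respect to `g` and the outward unit normal. -/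
def HalfSpaces.H (P : HalfSpaces n) (g : RiemannianMetric n) (η : ℝ → ℝ) (γ lam₀ : ℝ)
    (x : E n) : ℝ :=
  g.meanCurvature (P.uhat η γ lam₀ P.q) x

/-- The trace norm `‖dN̂‖_tr` at a point of `Σ̂`, where `N̂` is the restriction of `N̂_q`. -/
def HalfSpaces.trNormDNhat (P : HalfSpaces n) (g : RiemannianMetric n) (η : ℝ → ℝ) (γ lam₀ : ℝ)
    (x : E n) : ℝ :=
  g.traceNormOnLevelSet (P.uhat η γ lam₀ P.q) (P.Nhat g η γ lam₀ P.q) x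

/-- The region `E_{j,k}` of `Σ̂`, for `0 ≤ j < k ≤ q`. -/
def HalfSpaces.regionE (P : HalfSpaces n) (η : ℝ → ℝ) (γ lam₀ : ℝ) (j k : ℕ) : Set (E n) :=
  {x | x ∈ P.SigmaHat η γ lam₀
    ∧ (∀ m, k + 1 ≤ m → m ≤ P.q →
        (lam γ lam₀ m)⁻¹ < P.uhat η γ lam₀ (m - 1) x - P.u m x)
    ∧ (∀ m, j + 1 ≤ m → m ≤ k - 1 →
        (lam γ lam₀ m)⁻¹ < P.uhat η γ lam₀ (m - 1) x - P.u m x)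
    ∧ P.uhat η γ lam₀ (k - 1) x ∈ Set.Icc (-2 * (lam γ lam₀ k)⁻¹) 0
    ∧ P.u k x ∈ Set.Icc (-2 * (lam γ lam₀ k)⁻¹) 0
    ∧ P.u j x ∈ Set.Icc (-2 * (lam γ lam₀ k)⁻¹) 0
    ∧ (1 ≤ j → P.uhat η γ lam₀ (j - 1) x - P.u j x < -(lam γ lam₀ j)⁻¹)}

/-- The region `G_{i,j,k}` of `Σ̂`, for `0 ≤ i < j < k ≤ q`. -/
def HalfSpaces.regionG (P : HalfSpaces n) (η : ℝ → ℝ) (γ lam₀ : ℝ) (i j k : ℕ) : Set (E n) :=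
  {x | x ∈ P.SigmaHat η γ lam₀
    ∧ (∀ m, k + 1 ≤ m → m ≤ P.q →
        (lam γ lam₀ m)⁻¹ < P.uhat η γ lam₀ (m - 1) x - P.u m x)
    ∧ (∀ m, j + 1 ≤ m → m ≤ k - 1 →
        (lam γ lam₀ m)⁻¹ < P.uhat η γ lam₀ (m - 1) x - P.u m x)
    ∧ P.uhat η γ lam₀ (k - 1) x ∈ Set.Icc (-2 * (lam γ lam₀ k)⁻¹) 0
    ∧ P.u k x ∈ Set.Icc (-2 * (lam γ lam₀ k)⁻¹) 0
    ∧ P.u j x ∈ Set.Icc (-4 * (lam γ lam₀ j)⁻¹) 0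
    ∧ P.u i x ∈ Set.Icc (-6 * (lam γ lam₀ i)⁻¹) 0}

end PolytopeSmoothing

end

open PolytopeSmoothing

noncomputable section

set_option maxSynthPendingDepth 5

namespace PolytopeSmoothing

/-! ### Traces and trace norms -/

section TraceNorm

variable {V W : Type*}

section InnerProduct

variable [NormedAddCommGroup V] [InnerProductSpace ℝ V] [FiniteDimensional ℝ V]
  [NormedAddCommGroup W] [InnerProductSpace ℝ W]

/-! Everything reduces to one step of the recursion. The strict inequalities û_{m-1} - u_m > 1/λ_m
that define `regionG` and `regionE` are open, so near such a point û_q = û_k and û_{k-1} = û_j, and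
the same holds for N̂. What remains is the passage from (û_j, u_k) to û_k, where ∇û_j and N̂_j vary
at rate at most Λ: a multiple of λ_j on `regionG`, and 0 on `regionE`, where û_j = u_j.

Put X = ∇û_{k-1} - N_k (Euclidean), s = η', h = λ_k η'' and D = |∇û_k|, and let z be the tangent
vector representing ⟨X, ·⟩ on the level set. The Hessian of û_k is a nonnegative form, by convexity
of û_{k-1}, plus h⟨X, ·⟩²/2; hence H ≥ h|z|²/(2D) - C. On the other side, N̂_k is a fixed function
of (x, ∇û_{k-1}, s, N̂_{k-1}, N_k), and its only fast argument is s, with ds = h⟨X, ·⟩. So dN̂_k is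
the rank-one map h⟨z, ·⟩y₀ plus O(Λ), where y₀ is the derivative in s, and its trace norm is at most
h|z||y₀| + O(Λ).

The definition of φ makes it the angle between ∇û_k and the bisector of ∇û_{k-1} and ∇u_k. This
gives |y₀| = θ|z|/(2D) exactly (`RiemannianMetric.norm_fderiv_blendMap`,
`RiemannianMetric.norm_tangentProj_raise_sub`). Therefore H - ‖dN̂‖ ≥ (1 - θ)h|z|²/(2D) - CΛ, and θ
- 1 is controlled by the positive part of the difference of cosines, since arccos is Lipschitz away
from ±1 (`transition_estimate`).

The constants are independent of γ and λ₀ because all angles stay away from 0 and π. For an interior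
point y, the normals N of nearly active faces satisfy ⟨N, x - y⟩ ≥ κ. Nonnegative combinations of
total weight at least 1 inherit this bound and so have norm at least κ/R. Because the normals
enclose obtuse angles, projecting such a combination off the next normal produces another one, which
bounds the Gram determinant below (`InCone.gram_le`). The gradients and the vectors N̂ are
combinations of this kind, so the arguments of `blendMap` stay in a fixed compact set. -/

theorem exists_singular_frame {d : ℕ} (hd : Module.finrank ℝ V = d) (A : V →ₗ[ℝ] W)
    (T : V →ₗ[ℝ] V) (hT : ∀ v w, ⟪T v, w⟫ = ⟪A v, A w⟫) :
    ∃ (e : OrthonormalBasis (Fin d) ℝ V) (f : Fin d → W),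
      (∀ y, ∑ i, ⟪y, f i⟫ ^ 2 ≤ ‖y‖ ^ 2) ∧
      ((LinearMap.charpoly T).roots.map Real.sqrt).sum = ∑ i, ⟪A (e i), f i⟫ := by
  have hsym : T.IsSymmetric := fun v w => by
    rw [hT, real_inner_comm, ← hT, real_inner_comm]
  set e := hsym.eigenvectorBasis hd with he
  set μ := hsym.eigenvalues hd with hμ
  have hA : ∀ i j, ⟪A (e i), A (e j)⟫ = if i = j then μ i else 0 := fun i j => by
    rw [← hT, he, hsym.apply_eigenvectorBasis hd i, inner_smul_left,
      orthonormal_iff_ite.1 (hsym.eigenvectorBasis hd).orthonormal i j]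
    simp [hμ]
  have hμ0 : ∀ i, 0 ≤ μ i := fun i => by
    have := hA i i
    rw [if_pos rfl] at this
    rw [← this]
    exact real_inner_self_nonneg
  have hf : ∀ i j, ⟪(√(μ i))⁻¹ • A (e i), (√(μ j))⁻¹ • A (e j)⟫ =
      if i = j then (√(μ i))⁻¹ * √(μ i) else 0 := fun i j => by
    rw [inner_smul_left, inner_smul_right, hA]
    split_ifs with h
    · subst h
      rcases eq_or_ne (√(μ i)) 0 with h0 | h0
      · simp [h0]
      · have : μ i = √(μ i) * √(μ i) := (Real.mul_self_sqrt (hμ0 i)).symm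
        simp only [conj_trivial]
        field_simp
        rw [pow_two]
        exact this
    · simp
  -- Normalized images of the eigenvectors. Since 0⁻¹ = 0, the vectors with eigenvalue 0 become 0
  -- and the others are orthonormal, so Bessel's inequality survives.
  refine ⟨e, fun i => (√(μ i))⁻¹ • A (e i), fun y => ?_, ?_⟩
  · set f : Fin d → W := fun i => (√(μ i))⁻¹ • A (e i) with hfdef
    set c : Fin d → ℝ := fun i => ⟪y, f i⟫ with hc
    have hci : ∀ i, c i * ((√(μ i))⁻¹ * √(μ i)) = c i := fun i => by
      rcases eq_or_ne (√(μ i)) 0 with h0 | h0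
      · simp [hc, hfdef, h0]
      · rw [inv_mul_cancel₀ h0, mul_one]
    have h1 : ⟪y, ∑ i, c i • f i⟫ = ∑ i, c i ^ 2 := by
      rw [inner_sum]
      refine Finset.sum_congr rfl fun i _ => ?_
      rw [inner_smul_right, pow_two]
    have h2 : ⟪∑ i, c i • f i, ∑ i, c i • f i⟫ = ∑ i, c i ^ 2 := by
      rw [sum_inner]
      refine Finset.sum_congr rfl fun i _ => ?_
      rw [inner_sum, Finset.sum_eq_single i]
      · rw [inner_smul_left, inner_smul_right, hfdef, hf i i, if_pos rfl, hci, pow_two]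
        rfl
      · intro j _ hj
        rw [inner_smul_left, inner_smul_right, hfdef, hf i j, if_neg hj.symm]
        simp
      · simp
    have h3 := real_inner_self_nonneg (x := y - ∑ i, c i • f i)
    rw [inner_sub_left, inner_sub_right, inner_sub_right, h2,
      real_inner_comm y (∑ i, c i • f i), h1, real_inner_self_eq_norm_sq] at h3
    linarith
  · rw [hsym.roots_charpoly_eq_eigenvalues hd, Multiset.map_map]
    change ∑ i, √(μ i) = _
    refine Finset.sum_congr rfl fun i _ => ?_
    rw [inner_smul_right, hA, if_pos rfl]
    rcases eq_or_ne (√(μ i)) 0 with h0 | h0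
    · simp [h0]
    · have : μ i = √(μ i) * √(μ i) := (Real.mul_self_sqrt (hμ0 i)).symm
      field_simp
      rw [pow_two]
      exact this.symm

/-- In a singular frame the trace norm is ∑ ⟨A e_i, f_i⟩. The rank-one part contributes ∑ ⟨z,
e_i⟩⟨y, f_i⟩, which Cauchy–Schwarz and Bessel bound by ‖z‖‖y‖; each remainder term is at most C
because ‖f_i‖ ≤ 1. The constant 1 in front of ‖z‖‖y‖ matters, since this term has to be absorbed by
the mean curvature. -/
theorem sum_sqrt_roots_charpoly_le (A : V →ₗ[ℝ] W) (T : V →ₗ[ℝ] V)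
    (hT : ∀ v w, ⟪T v, w⟫ = ⟪A v, A w⟫) (z : V) (y : W) (R : V → W)
    (hA : ∀ v, A v = ⟪z, v⟫ • y + R v) (C : ℝ) (hR : ∀ v, ‖R v‖ ≤ C * ‖v‖) :
    ((LinearMap.charpoly T).roots.map Real.sqrt).sum
      ≤ ‖z‖ * ‖y‖ + Module.finrank ℝ V * C := by
  obtain ⟨e, f, hf, hsum⟩ := exists_singular_frame rfl A T hT
  rw [hsum]
  have hf1 : ∀ i, ‖f i‖ ≤ 1 := fun i => by
    have h1 := (Finset.single_le_sum (f := fun j => ⟪f i, f j⟫ ^ 2) (fun j _ => sq_nonneg _)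
      (Finset.mem_univ i)).trans (hf (f i))
    simp only [real_inner_self_eq_norm_sq] at h1
    by_contra! h
    nlinarith [mul_pos (show (0 : ℝ) < ‖f i‖ ^ 2 by positivity)
      (show (0 : ℝ) < ‖f i‖ ^ 2 - 1 by nlinarith)]
  have h1 : ∀ i, ⟪A (e i), f i⟫ ≤ ⟪z, e i⟫ * ⟪y, f i⟫ + C := fun i => by
    rw [hA, inner_add_left, inner_smul_left]
    have h2 := (real_inner_le_norm (R (e i)) (f i)).trans
      (mul_le_mul (hR (e i)) (hf1 i) (norm_nonneg _) ((norm_nonneg _).trans (hR _)))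
    rw [e.norm_eq_one] at h2
    simp only [conj_trivial]
    linarith
  refine (Finset.sum_le_sum fun i _ => h1 i).trans ?_
  rw [Finset.sum_add_distrib]
  have hz : ∑ i, ⟪z, e i⟫ ^ 2 = ‖z‖ ^ 2 := by
    rw [← e.sum_sq_norm_inner_left z]
    simp
  have h2 := Real.sum_mul_le_sqrt_mul_sqrt Finset.univ (fun i => ⟪z, e i⟫) (fun i => ⟪y, f i⟫)
  rw [hz, Real.sqrt_sq (norm_nonneg _)] at h2
  have h3 : √(∑ i, ⟪y, f i⟫ ^ 2) ≤ ‖y‖ := Real.sqrt_le_iff.2 ⟨norm_nonneg _, hf y⟩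
  have h4 := mul_le_mul_of_nonneg_left h3 (norm_nonneg z)
  simp only [Finset.sum_const, Finset.card_univ, Fintype.card_fin, nsmul_eq_mul]
  linarith

theorem le_trace_of_quadratic_le (T : V →ₗ[ℝ] V) (z : V) (a C : ℝ)
    (h : ∀ v, a * ⟪z, v⟫ ^ 2 - C * ‖v‖ ^ 2 ≤ ⟪T v, v⟫) :
    a * ‖z‖ ^ 2 - Module.finrank ℝ V * C ≤ LinearMap.trace ℝ V T := by
  have e := stdOrthonormalBasis ℝ V
  rw [T.trace_eq_sum_inner e]
  have h1 : ∑ i, (a * ⟪z, e i⟫ ^ 2 - C) ≤ ∑ i, ⟪e i, T (e i)⟫ := by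
    refine Finset.sum_le_sum fun i _ => ?_
    have := h (e i)
    rw [e.norm_eq_one] at this
    rw [real_inner_comm (T (e i))]
    linarith
  refine le_trans (le_of_eq ?_) h1
  rw [Finset.sum_sub_distrib, ← Finset.mul_sum]
  have hz : ∑ i, ⟪z, e i⟫ ^ 2 = ‖z‖ ^ 2 := by
    rw [← e.sum_sq_norm_inner_left z]
    simp
  rw [hz]
  simp

end InnerProduct

section Core

variable [AddCommGroup V] [Module ℝ V] [FiniteDimensional ℝ V]
  [NormedAddCommGroup W] [InnerProductSpace ℝ W]

/-- `V` carries no norm here, so that the inner product of `g` at a point can be installed locally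
without clashing with the Euclidean one on `E n`. -/
theorem sum_sqrt_roots_charpoly_le_of_core (c : InnerProductSpace.Core ℝ V) (A : V →ₗ[ℝ] W)
    (T : V →ₗ[ℝ] V) (hT : ∀ v w, c.inner (T v) w = ⟪A v, A w⟫) (z : V) (y : W) (R : V → W)
    (hA : ∀ v, A v = c.inner z v • y + R v) (C : ℝ)
    (hR : ∀ v, ‖R v‖ ≤ C * √(c.inner v v)) :
    ((LinearMap.charpoly T).roots.map Real.sqrt).sum
      ≤ √(c.inner z z) * ‖y‖ + Module.finrank ℝ V * C := by
  let _ : NormedAddCommGroup V := c.toNormedAddCommGroup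
  let _ : InnerProductSpace ℝ V := InnerProductSpace.ofCore c.toCore
  have h := sum_sqrt_roots_charpoly_le A T hT z y R hA C (fun v => by
    rw [norm_eq_sqrt_real_inner v]; exact hR v)
  rw [norm_eq_sqrt_real_inner z] at h
  exact h

theorem le_trace_of_quadratic_le_of_core (c : InnerProductSpace.Core ℝ V) (T : V →ₗ[ℝ] V)
    (z : V) (a C : ℝ) (h : ∀ v, a * c.inner z v ^ 2 - C * c.inner v v ≤ c.inner (T v) v) :
    a * c.inner z z - Module.finrank ℝ V * C ≤ LinearMap.trace ℝ V T := by
  let _ : NormedAddCommGroup V := c.toNormedAddCommGroup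
  let _ : InnerProductSpace ℝ V := InnerProductSpace.ofCore c.toCore
  have h := le_trace_of_quadratic_le T z a C (fun v => by
    rw [← real_inner_self_eq_norm_sq v]; exact h v)
  rw [← real_inner_self_eq_norm_sq z] at h
  exact h

end Core

end TraceNorm

/-! ### Tangential projections, and trace bounds with respect to `g` -/

section Metric

variable {n : ℕ} (g : RiemannianMetric n)

/-- The inner product space structure on the tangent space at `x`. -/
@[reducible] def RiemannianMetric.core (x : E n) : InnerProductSpace.Core ℝ (E n) where
  inner v w := g.form x v w
  conj_inner_symm v w := by simpa using g.symm x w v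
  re_inner_nonneg v := by
    rcases eq_or_ne v 0 with h | h
    · simp [h]
    · simpa using (g.pos x v h).le
  add_left := by simp
  smul_left := by simp
  definite v h := by
    by_contra h0
    exact (g.pos x v h0).ne' h

theorem RiemannianMetric.form_self_nonneg (x v : E n) : 0 ≤ g.form x v v := by
  rcases eq_or_ne v 0 with h | h
  · simp [h]
  · exact (g.pos x v h).le

theorem RiemannianMetric.norm_sq (x v : E n) : g.norm x v ^ 2 = g.form x v v :=
  Real.sq_sqrt (g.form_self_nonneg x v)

theorem RiemannianMetric.norm_pos {x v : E n} (h : v ≠ 0) : 0 < g.norm x v :=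
  Real.sqrt_pos.2 (g.pos x v h)

theorem RiemannianMetric.norm_nonneg (x v : E n) : 0 ≤ g.norm x v :=
  Real.sqrt_nonneg _

theorem RiemannianMetric.form_unitNormal_self (f : E n → ℝ) {x : E n} (h : g.grad f x ≠ 0) :
    g.form x (g.unitNormal f x) (g.unitNormal f x) = 1 := by
  have h1 := g.norm_pos (x := x) h
  have h2 := g.norm_sq x (g.grad f x)
  simp only [unitNormal, map_smul, smul_apply, smul_eq_mul, ← h2]
  field_simp

theorem RiemannianMetric.form_tangentProj (f : E n → ℝ) (x v w : E n) :
    g.form x (g.tangentProj f x v) w = g.form x v (g.tangentProj f x w) := by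
  simp only [tangentProj, sub_apply, ContinuousLinearMap.id_apply,
    ContinuousLinearMap.smulRight_apply, map_sub, map_smul, smul_apply,
    smul_eq_mul, g.symm x v (g.unitNormal f x)]
  ring

theorem RiemannianMetric.tangentProj_tangentProj (f : E n → ℝ) {x : E n} (h : g.grad f x ≠ 0)
    (v : E n) : g.tangentProj f x (g.tangentProj f x v) = g.tangentProj f x v := by
  simp only [tangentProj, sub_apply, ContinuousLinearMap.id_apply,
    ContinuousLinearMap.smulRight_apply, map_sub, map_smul,
    g.form_unitNormal_self f h, one_smul, sub_self, smul_zero, sub_zero]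

theorem RiemannianMetric.form_unitNormal_tangentProj (f : E n → ℝ) {x : E n}
    (h : g.grad f x ≠ 0) (v : E n) :
    g.form x (g.unitNormal f x) (g.tangentProj f x v) = 0 := by
  simp only [tangentProj, sub_apply, ContinuousLinearMap.id_apply,
    ContinuousLinearMap.smulRight_apply, map_sub, map_smul,
    g.form_unitNormal_self f h, smul_eq_mul, mul_one, sub_self]

theorem RiemannianMetric.form_tangentProj_self (f : E n → ℝ) {x : E n} (h : g.grad f x ≠ 0)
    (v : E n) : g.form x (g.tangentProj f x v) (g.tangentProj f x v)
      = g.form x v v - g.form x (g.unitNormal f x) v ^ 2 := by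
  rw [← g.form_tangentProj, g.tangentProj_tangentProj f h]
  simp only [tangentProj, sub_apply, ContinuousLinearMap.id_apply,
    ContinuousLinearMap.smulRight_apply, map_sub, map_smul, smul_apply,
    smul_eq_mul]
  ring

theorem RiemannianMetric.form_tangentProj_self_le (f : E n → ℝ) {x : E n} (h : g.grad f x ≠ 0)
    (v : E n) : g.form x (g.tangentProj f x v) (g.tangentProj f x v) ≤ g.form x v v := by
  rw [g.form_tangentProj_self f h]
  linarith [sq_nonneg (g.form x (g.unitNormal f x) v)]

theorem RiemannianMetric.norm_tangentProj_le (f : E n → ℝ) {x : E n} (h : g.grad f x ≠ 0)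
    (v : E n) : g.norm x (g.tangentProj f x v) ≤ g.norm x v :=
  Real.sqrt_le_sqrt (g.form_tangentProj_self_le f h v)

/-- With P the tangential projection and D the covariant derivative of the normal, P² = P gives
tr(DP) = tr(PDP). As P is self-adjoint for `g`, the quadratic form of PDP at v is that of D at Pv,
so only tangent vectors are tested. -/
theorem RiemannianMetric.le_meanCurvature (f : E n → ℝ) {x : E n} (h : g.grad f x ≠ 0)
    (z : E n) (a C : ℝ)
    (hq : ∀ v, a * g.form x z v ^ 2 - C * g.form x v v ≤
      g.form x (g.covDeriv (g.unitNormal f) x (g.tangentProj f x v)) (g.tangentProj f x v)) :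
    a * g.form x z z - n * C ≤ g.meanCurvature f x := by
  set P : E n →ₗ[ℝ] E n := (g.tangentProj f x : E n →ₗ[ℝ] E n)
  set D : E n →ₗ[ℝ] E n := (g.covDeriv (g.unitNormal f) x : E n →ₗ[ℝ] E n)
  have hPP : P * P = P := LinearMap.ext fun v => g.tangentProj_tangentProj f h v
  have h1 : g.meanCurvature f x = LinearMap.trace ℝ (E n) (P * (D * P)) := by
    rw [LinearMap.trace_mul_comm, mul_assoc, hPP]
    rfl
  rw [h1]
  have h2 := le_trace_of_quadratic_le_of_core (g.core x) (P * (D * P)) z a C (fun v => by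
    refine (hq v).trans (le_of_eq ?_)
    change _ = g.form x (P (D (P v))) v
    exact (g.form_tangentProj f x _ _).symm)
  rw [finrank_euclideanSpace_fin] at h2
  exact h2

theorem RiemannianMetric.traceNormOnLevelSet_le (f : E n → ℝ) (F : E n → E n) (x z y : E n)
    (R : E n → E n) (C : ℝ)
    (hA : ∀ v, fderiv ℝ F x (g.tangentProj f x v) = g.form x z v • y + R v)
    (hR : ∀ v, ‖R v‖ ≤ C * g.norm x v) :
    g.traceNormOnLevelSet f F x ≤ g.norm x z * ‖y‖ + n * C := by
  have h := sum_sqrt_roots_charpoly_le_of_core (g.core x)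
    ((fderiv ℝ F x).comp (g.tangentProj f x) : E n →ₗ[ℝ] E n)
    (g.adjointMulSelf x ((fderiv ℝ F x).comp (g.tangentProj f x)) : E n →ₗ[ℝ] E n)
    (fun v w => g.form_sharp x _ _) z y R hA C hR
  rw [finrank_euclideanSpace_fin] at h
  exact h

end Metric

/-! ### The second fundamental form of a level set through the Euclidean Hessian -/

section Hessian

variable {n : ℕ} (g : RiemannianMetric n)

theorem RiemannianMetric.isInvertible_form (x : E n) : (g.form x).IsInvertible := by
  have hinj : Function.Injective (g.form x) := by
    rw [injective_iff_map_eq_zero]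
    intro v hv
    by_contra hne
    have h := g.pos x v hne
    rw [hv] at h
    simp at h
  have hfin : Module.finrank ℝ (E n) = Module.finrank ℝ (E n →L[ℝ] ℝ) :=
    (InnerProductSpace.toDual ℝ (E n)).toLinearEquiv.finrank_eq
  exact ⟨(LinearEquiv.ofInjectiveOfFinrankEq (g.form x : E n →ₗ[ℝ] (E n →L[ℝ] ℝ))
      hinj hfin).toContinuousLinearEquiv, rfl⟩

theorem RiemannianMetric.contDiff_sharp : ContDiff ℝ ∞ g.sharp :=
  contDiff_iff_contDiffAt.2 fun x =>
    ContDiffAt.comp x ((g.isInvertible_form x).contDiffAt_map_inverse) g.smooth.contDiffAt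

theorem RiemannianMetric.sharp_ne_zero (x : E n) {β : E n →L[ℝ] ℝ} (h : β ≠ 0) :
    g.sharp x β ≠ 0 := by
  intro h0
  apply h
  ext w
  rw [← g.form_sharp x β w, h0]
  simp

theorem RiemannianMetric.grad_ne_zero {f : E n → ℝ} {x : E n} (h : fderiv ℝ f x ≠ 0) :
    g.grad f x ≠ 0 :=
  g.sharp_ne_zero x h

theorem RiemannianMetric.contDiff_grad {f : E n → ℝ} (hf : ContDiff ℝ ∞ f) :
    ContDiff ℝ ∞ (g.grad f) :=
  g.contDiff_sharp.clm_apply (hf.fderiv_right (by simp))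

theorem RiemannianMetric.contDiffAt_norm {F : Type*} [NormedAddCommGroup F] [NormedSpace ℝ F]
    {X V : F → E n} {z : F} (hX : ContDiffAt ℝ ∞ X z) (hV : ContDiffAt ℝ ∞ V z)
    (h : V z ≠ 0) : ContDiffAt ℝ ∞ (fun y => g.norm (X y) (V y)) z :=
  ContDiffAt.sqrt (((g.smooth.contDiffAt.comp z hX).clm_apply hV).clm_apply hV)
    (g.pos _ _ h).ne'

theorem RiemannianMetric.form_koszul (x v ξ ζ : E n) :
    g.form x (g.sharp x (g.koszul x v ξ)) ζ =
      1 / 2 * (fderiv ℝ g.form x ξ v ζ + fderiv ℝ g.form x v ξ ζ - fderiv ℝ g.form x ζ v ξ) := by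
  rw [g.form_sharp]
  simp [koszul]

/-- The second fundamental form of a level set in terms of the Euclidean second derivative of the
defining function. -/
theorem RiemannianMetric.form_covDeriv_unitNormal {f : E n → ℝ} (hf : ContDiff ℝ ∞ f) {x : E n}
    (h : fderiv ℝ f x ≠ 0) (ξ ζ : E n) (hζ : g.form x (g.unitNormal f x) ζ = 0) :
    g.form x (g.covDeriv (g.unitNormal f) x ξ) ζ =
      (g.norm x (g.grad f x))⁻¹ * fderiv ℝ (fderiv ℝ f) x ξ ζ
      + 1 / 2 * (fderiv ℝ g.form x (g.unitNormal f x) ξ ζ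
          - fderiv ℝ g.form x ξ (g.unitNormal f x) ζ
          - fderiv ℝ g.form x ζ (g.unitNormal f x) ξ) := by
  have hg := g.grad_ne_zero h
  have hd : HasFDerivAt (g.grad f) (fderiv ℝ (g.grad f) x) x :=
    ((g.contDiff_grad hf).differentiable (by simp)).differentiableAt.hasFDerivAt
  have hφ : DifferentiableAt ℝ (fun y => (g.norm y (g.grad f y))⁻¹) x :=
    ((g.contDiffAt_norm contDiffAt_id (g.contDiff_grad hf).contDiffAt hg).differentiableAt
      (by simp)).inv (g.norm_pos hg).ne'
  have hν : fderiv ℝ (g.unitNormal f) x = _ := (hφ.hasFDerivAt.smul hd).fderiv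
  have hform : HasFDerivAt g.form (fderiv ℝ g.form x) x :=
    (g.smooth.differentiable (by simp)).differentiableAt.hasFDerivAt
  have h1 : HasFDerivAt (fun y => g.form y (g.grad f y) ζ) _ x :=
    (hform.clm_apply hd).clm_apply (hasFDerivAt_const ζ x)
  have h2 : (fun y => g.form y (g.grad f y) ζ) = fun y => fderiv ℝ f y ζ := by
    funext y
    exact g.form_sharp y _ ζ
  have h3 : HasFDerivAt (fun y => fderiv ℝ f y ζ) _ x :=
    (((hf.fderiv_right (m := ∞) (by simp)).differentiable
      (by simp)).differentiableAt.hasFDerivAt (x := x)).clm_apply (hasFDerivAt_const ζ x)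
  rw [h2] at h1
  have h4 := DFunLike.congr_fun (h1.unique h3) ξ
  simp at h4
  -- Tangency of ζ removes the term in which the factor 1/|∇f| is differentiated.
  have hζ' : g.form x (g.grad f x) ζ = 0 := by
    have : (g.norm x (g.grad f x))⁻¹ * g.form x (g.grad f x) ζ = 0 := by
      simpa [unitNormal] using hζ
    exact (mul_eq_zero.1 this).resolve_left (inv_ne_zero (g.norm_pos hg).ne')
  have h5 : g.form x (g.covDeriv (g.unitNormal f) x ξ) ζ =
      g.form x (fderiv ℝ (g.unitNormal f) x ξ) ζ
        + g.form x (g.sharp x (g.koszul x (g.unitNormal f x) ξ)) ζ := by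
    simp [covDeriv]
  rw [h5, g.form_koszul, hν]
  simp only [add_apply, smul_apply, ContinuousLinearMap.smulRight_apply, map_add, map_smul,
    smul_eq_mul, hζ', unitNormal, ← h4]
  ring

theorem RiemannianMetric.le_form_covDeriv_unitNormal {f : E n → ℝ} (hf : ContDiff ℝ ∞ f)
    {x : E n} (h : fderiv ℝ f x ≠ 0) (ξ : E n) (hξ : g.form x (g.unitNormal f x) ξ = 0) :
    (g.norm x (g.grad f x))⁻¹ * fderiv ℝ (fderiv ℝ f) x ξ ξ
      - 3 / 2 * (‖fderiv ℝ g.form x‖ * ‖g.unitNormal f x‖ * ‖ξ‖ ^ 2)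
      ≤ g.form x (g.covDeriv (g.unitNormal f) x ξ) ξ := by
  rw [g.form_covDeriv_unitNormal hf h ξ ξ hξ]
  set ν := g.unitNormal f x
  have hb : ∀ a b c, |fderiv ℝ g.form x a b c| ≤ ‖fderiv ℝ g.form x‖ * ‖a‖ * ‖b‖ * ‖c‖ :=
    fun a b c => by
      refine ((fderiv ℝ g.form x a b).le_opNorm c).trans ?_
      gcongr
      refine ((fderiv ℝ g.form x a).le_opNorm b).trans ?_
      gcongr
      exact (fderiv ℝ g.form x).le_opNorm a
  have h1 := abs_le.1 (hb ν ξ ξ)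
  have h2 := abs_le.1 (hb ξ ν ξ)
  nlinarith

end Hessian

/-! ### The smoothed absolute value -/


section SmoothAbs

variable {η : ℝ → ℝ}

theorem IsSmoothAbs.contDiff_deriv (hη : IsSmoothAbs η) : ContDiff ℝ ∞ (deriv η) :=
  (contDiff_infty_iff_deriv.1 hη.smooth).2

theorem IsSmoothAbs.contDiff_deriv_deriv (hη : IsSmoothAbs η) : ContDiff ℝ ∞ (deriv (deriv η)) :=
  (contDiff_infty_iff_deriv.1 hη.contDiff_deriv).2

theorem IsSmoothAbs.hasDerivAt (hη : IsSmoothAbs η) (t : ℝ) : HasDerivAt η (deriv η t) t :=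
  (hη.smooth.differentiable (by simp)).differentiableAt.hasDerivAt

theorem IsSmoothAbs.hasDerivAt_deriv (hη : IsSmoothAbs η) (t : ℝ) :
    HasDerivAt (deriv η) (deriv (deriv η) t) t :=
  (hη.contDiff_deriv.differentiable (by simp)).differentiableAt.hasDerivAt

theorem IsSmoothAbs.deriv_eq_one (hη : IsSmoothAbs η) {t : ℝ} (ht : 1 / 2 < t) :
    deriv η t = 1 := by
  have h : η =ᶠ[nhds t] id := by
    filter_upwards [lt_mem_nhds ht] with y hy
    rw [hη.eq_abs y (hy.le.trans (le_abs_self y)), abs_of_pos (by linarith)]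
    rfl
  rw [h.deriv_eq, deriv_id]

theorem IsSmoothAbs.deriv_eq_neg_one (hη : IsSmoothAbs η) {t : ℝ} (ht : t < -(1 / 2)) :
    deriv η t = -1 := by
  have h : η =ᶠ[nhds t] fun y => -y := by
    filter_upwards [gt_mem_nhds ht] with y hy
    rw [hη.eq_abs y (by rw [abs_of_neg (by linarith)]; linarith), abs_of_neg (by linarith)]
  rw [h.deriv_eq, deriv_neg]

/-- Convexity makes η' monotone, and η' = ±1 far out on either side. -/
theorem IsSmoothAbs.abs_deriv_le_one (hη : IsSmoothAbs η) (t : ℝ) : |deriv η t| ≤ 1 := by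
  have hmono : Monotone (deriv η) :=
    monotone_of_deriv_nonneg (hη.contDiff_deriv.differentiable (by simp)) hη.convex
  rw [abs_le]
  constructor
  · rcases le_or_gt (-1) t with h | h
    · rw [← hη.deriv_eq_neg_one (t := -1) (by norm_num)]
      exact hmono h
    · rw [hη.deriv_eq_neg_one (by linarith)]
  · rcases le_or_gt t 1 with h | h
    · rw [← hη.deriv_eq_one (t := 1) (by norm_num)]
      exact hmono h
    · rw [hη.deriv_eq_one (by linarith)]

theorem IsSmoothAbs.abs_sub_le (hη : IsSmoothAbs η) (s t : ℝ) : |η s - η t| ≤ |s - t| := by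
  have h := Convex.norm_image_sub_le_of_norm_deriv_le (f := η) (C := 1) (s := Set.univ)
    (x := t) (y := s) (fun x _ => (hη.hasDerivAt x).differentiableAt)
    (fun x _ => hη.abs_deriv_le_one x) convex_univ trivial trivial
  simpa using h

theorem IsSmoothAbs.abs_le (hη : IsSmoothAbs η) (t : ℝ) : |t| ≤ η t := by
  have key : ∀ t, 0 ≤ t → t ≤ η t := fun t ht => by
    rcases le_or_gt (1 / 2) t with h | h
    · rw [hη.eq_abs t (by rwa [abs_of_nonneg ht]), abs_of_nonneg ht]
    · have h1 := (_root_.abs_le.1 (hη.abs_sub_le (1 / 2) t)).2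
      rw [hη.eq_abs (1 / 2) (by norm_num), abs_of_pos (by linarith : 0 < 1 / 2 - t)] at h1
      norm_num [abs_of_pos] at h1
      linarith
  rcases le_total 0 t with h | h
  · rw [abs_of_nonneg h]
    exact key t h
  · rw [abs_of_nonpos h, ← hη.even]
    exact key (-t) (by linarith)

theorem IsSmoothAbs.le_three (hη : IsSmoothAbs η) {t : ℝ} (ht : |t| ≤ 1) : η t ≤ 3 := by
  have h1 := (_root_.abs_le.1 (hη.abs_sub_le t 1)).2
  rw [hη.eq_abs 1 (by norm_num)] at h1
  have h2 : |t - 1| ≤ 2 := _root_.abs_le.2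
    ⟨by linarith [(_root_.abs_le.1 ht).1], by linarith [(_root_.abs_le.1 ht).2]⟩
  rw [abs_one] at h1
  linarith

theorem IsSmoothAbs.exists_abs_deriv_deriv_le (hη : IsSmoothAbs η) :
    ∃ M, 0 ≤ M ∧ ∀ t, deriv (deriv η) t ≤ M := by
  obtain ⟨M, hM⟩ := (isCompact_Icc (a := (-1 : ℝ)) (b := 1)).exists_bound_of_continuousOn
    hη.contDiff_deriv_deriv.continuous.continuousOn
  have hM0 : 0 ≤ M := (norm_nonneg _).trans (hM 0 (by simp))
  refine ⟨M, hM0, fun t => ?_⟩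
  by_cases h : t ∈ Set.Icc (-1 : ℝ) 1
  · exact (le_abs_self _).trans (hM t h)
  · refine le_trans (le_of_eq ?_) hM0
    rw [Set.mem_Icc, not_and_or, not_le, not_le] at h
    rcases h with h | h
    · have : deriv η =ᶠ[nhds t] fun _ => -1 := by
        filter_upwards [gt_mem_nhds h] with y hy
        exact hη.deriv_eq_neg_one (by linarith)
      rw [this.deriv_eq, deriv_const]
    · have : deriv η =ᶠ[nhds t] fun _ => 1 := by
        filter_upwards [lt_mem_nhds h] with y hy
        exact hη.deriv_eq_one (by linarith)
      rw [this.deriv_eq, deriv_const]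

end SmoothAbs

/-! ### The parameters -/

section Parameters

variable {γ lam₀ : ℝ}

theorem lam_pos (hγ : γ ∈ Set.Ioo (0 : ℝ) (1 / 2)) (hl : 1 ≤ lam₀) (k : ℕ) :
    0 < lam γ lam₀ k :=
  mul_pos (pow_pos (inv_pos.2 hγ.1) k) (by linarith)

theorem lam_le_lam_succ (hγ : γ ∈ Set.Ioo (0 : ℝ) (1 / 2)) (hl : 1 ≤ lam₀) (k : ℕ) :
    lam γ lam₀ k ≤ lam γ lam₀ (k + 1) := by
  have h1 : 1 ≤ γ⁻¹ := (one_le_inv₀ hγ.1).2 (by linarith [hγ.2])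
  unfold lam
  gcongr
  omega

theorem le_lam (hγ : γ ∈ Set.Ioo (0 : ℝ) (1 / 2)) (hl : 1 ≤ lam₀) (k : ℕ) :
    lam₀ ≤ lam γ lam₀ k := by
  induction k with
  | zero => simp [lam]
  | succ k ih => exact ih.trans (lam_le_lam_succ hγ hl k)

end Parameters

/-! ### The smoothed defining functions -/

namespace HalfSpaces

variable {n : ℕ} (P : HalfSpaces n) {η : ℝ → ℝ} {γ lam₀ : ℝ}

/-- The Euclidean gradient of `û_k`. -/
def gradHat (η : ℝ → ℝ) (γ lam₀ : ℝ) : ℕ → E n → E n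
  | 0 => fun _ => P.N 0
  | k + 1 => fun x =>
      let s := deriv η (lam γ lam₀ (k + 1) * (P.uhat η γ lam₀ k x - P.u (k + 1) x))
      (1 / 2 * (1 + s)) • gradHat η γ lam₀ k x + (1 / 2 * (1 - s)) • P.N (k + 1)

theorem contDiff_u (k : ℕ) : ContDiff ℝ ∞ (P.u k) :=
  (contDiff_const.inner ℝ contDiff_id).add contDiff_const

theorem hasFDerivAt_u (k : ℕ) (x : E n) : HasFDerivAt (P.u k) (innerSL ℝ (P.N k)) x :=
  (innerSL ℝ (P.N k)).hasFDerivAt.add_const _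

theorem fderiv_u (k : ℕ) : fderiv ℝ (P.u k) = fun _ => innerSL ℝ (P.N k) :=
  funext fun x => (P.hasFDerivAt_u k x).fderiv

theorem contDiff_uhat (hη : IsSmoothAbs η) (k : ℕ) : ContDiff ℝ ∞ (P.uhat η γ lam₀ k) := by
  induction k with
  | zero => exact P.contDiff_u 0
  | succ k ih =>
    exact contDiff_const.mul ((ih.add (P.contDiff_u _)).add (contDiff_const.mul
      (hη.smooth.comp (contDiff_const.mul (ih.sub (P.contDiff_u _))))))

theorem hasFDerivAt_uhat (hη : IsSmoothAbs η) (hγ : γ ∈ Set.Ioo (0 : ℝ) (1 / 2))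
    (hl : 1 ≤ lam₀) (k : ℕ) (x : E n) :
    HasFDerivAt (P.uhat η γ lam₀ k) (innerSL ℝ (P.gradHat η γ lam₀ k x)) x := by
  induction k with
  | zero => exact P.hasFDerivAt_u 0 x
  | succ k ih =>
    have hl' := (lam_pos hγ hl (k + 1)).ne'
    have h1 := ih.sub (P.hasFDerivAt_u (k + 1) x)
    have h2 := (hη.hasDerivAt _).comp_hasFDerivAt x (h1.const_mul (lam γ lam₀ (k + 1)))
    have h3 := ((ih.add (P.hasFDerivAt_u (k + 1) x)).add
      (h2.const_mul (lam γ lam₀ (k + 1))⁻¹)).const_mul (1 / 2 : ℝ)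
    refine h3.congr_fderiv ?_
    ext v
    simp [gradHat]
    field_simp
    ring

theorem fderiv_uhat (hη : IsSmoothAbs η) (hγ : γ ∈ Set.Ioo (0 : ℝ) (1 / 2))
    (hl : 1 ≤ lam₀) (k : ℕ) :
    fderiv ℝ (P.uhat η γ lam₀ k) = fun x => innerSL ℝ (P.gradHat η γ lam₀ k x) :=
  funext fun x => (P.hasFDerivAt_uhat hη hγ hl k x).fderiv

theorem contDiff_gradHat (hη : IsSmoothAbs η) (k : ℕ) : ContDiff ℝ ∞ (P.gradHat η γ lam₀ k) := by
  induction k with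
  | zero => exact contDiff_const
  | succ k ih =>
    have hs : ContDiff ℝ ∞ fun x => deriv η
        (lam γ lam₀ (k + 1) * (P.uhat η γ lam₀ k x - P.u (k + 1) x)) :=
      hη.contDiff_deriv.comp (contDiff_const.mul ((P.contDiff_uhat hη k).sub (P.contDiff_u _)))
    exact ((contDiff_const.mul (contDiff_const.add hs)).smul ih).add
      ((contDiff_const.mul (contDiff_const.sub hs)).smul contDiff_const)

theorem hasFDerivAt_gradHat (hη : IsSmoothAbs η) (k : ℕ) (x : E n) :
    HasFDerivAt (P.gradHat η γ lam₀ k) (fderiv ℝ (P.gradHat η γ lam₀ k) x) x :=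
  ((P.contDiff_gradHat hη k).differentiable (by simp)).differentiableAt.hasFDerivAt

theorem hasFDerivAt_deriv_eta (hη : IsSmoothAbs η) (hγ : γ ∈ Set.Ioo (0 : ℝ) (1 / 2))
    (hl : 1 ≤ lam₀) (k : ℕ) (x : E n) :
    HasFDerivAt (fun x => deriv η (lam γ lam₀ (k + 1) * (P.uhat η γ lam₀ k x - P.u (k + 1) x)))
      ((lam γ lam₀ (k + 1) *
        deriv (deriv η) (lam γ lam₀ (k + 1) * (P.uhat η γ lam₀ k x - P.u (k + 1) x))) •
        innerSL ℝ (P.gradHat η γ lam₀ k x - P.N (k + 1))) x := by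
  have h1 := (P.hasFDerivAt_uhat hη hγ hl k x).sub (P.hasFDerivAt_u (k + 1) x)
  refine ((hη.hasDerivAt_deriv _).comp_hasFDerivAt x
    (h1.const_mul (lam γ lam₀ (k + 1)))).congr_fderiv ?_
  ext v
  simp
  ring

/-- The two terms in which η' is differentiated combine into a rank-one form along ∇û_k - N_{k+1}.
This is the only contribution of size λ_{k+1}; the other is inherited from step k. -/
theorem fderiv_gradHat_succ (hη : IsSmoothAbs η) (hγ : γ ∈ Set.Ioo (0 : ℝ) (1 / 2))
    (hl : 1 ≤ lam₀) (k : ℕ) (x ξ : E n) :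
    fderiv ℝ (P.gradHat η γ lam₀ (k + 1)) x ξ =
      (1 / 2 * (1 + deriv η (lam γ lam₀ (k + 1) * (P.uhat η γ lam₀ k x - P.u (k + 1) x)))) •
        fderiv ℝ (P.gradHat η γ lam₀ k) x ξ
      + (1 / 2 * (lam γ lam₀ (k + 1) *
          deriv (deriv η) (lam γ lam₀ (k + 1) * (P.uhat η γ lam₀ k x - P.u (k + 1) x))) *
          ⟪P.gradHat η γ lam₀ k x - P.N (k + 1), ξ⟫) •
        (P.gradHat η γ lam₀ k x - P.N (k + 1)) := by
  have hs := P.hasFDerivAt_deriv_eta hη hγ hl k x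
  have h1 := (((hs.const_add 1).const_mul (1 / 2 : ℝ)).smul
    (P.hasFDerivAt_gradHat hη (γ := γ) (lam₀ := lam₀) k x)).add
    (((hs.const_sub 1).const_mul (1 / 2 : ℝ)).smul (hasFDerivAt_const (P.N (k + 1)) x))
  have h2 : HasFDerivAt (P.gradHat η γ lam₀ (k + 1)) _ x := h1
  rw [h2.fderiv]
  simp [inner_sub_left]
  module

theorem fderiv_fderiv_uhat (hη : IsSmoothAbs η) (hγ : γ ∈ Set.Ioo (0 : ℝ) (1 / 2))
    (hl : 1 ≤ lam₀) (k : ℕ) (x ξ ζ : E n) :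
    fderiv ℝ (fderiv ℝ (P.uhat η γ lam₀ k)) x ξ ζ =
      ⟪fderiv ℝ (P.gradHat η γ lam₀ k) x ξ, ζ⟫ := by
  rw [P.fderiv_uhat hη hγ hl]
  have h := (innerSL ℝ : E n →L[ℝ] E n →L[ℝ] ℝ).hasFDerivAt.comp x
    (P.hasFDerivAt_gradHat hη (γ := γ) (lam₀ := lam₀) k x)
  have h' : HasFDerivAt (fun x => innerSL ℝ (P.gradHat η γ lam₀ k x)) _ x := h
  rw [h'.fderiv]
  rfl

/-- The functions `û_k` are convex. -/
theorem inner_fderiv_gradHat_nonneg (hη : IsSmoothAbs η) (hγ : γ ∈ Set.Ioo (0 : ℝ) (1 / 2))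
    (hl : 1 ≤ lam₀) (k : ℕ) (x ξ : E n) :
    0 ≤ ⟪fderiv ℝ (P.gradHat η γ lam₀ k) x ξ, ξ⟫ := by
  induction k with
  | zero =>
    have : P.gradHat η γ lam₀ 0 = fun _ => P.N 0 := rfl
    simp [this]
  | succ k ih =>
    rw [P.fderiv_gradHat_succ hη hγ hl, inner_add_left, inner_smul_left, inner_smul_left]
    set t := lam γ lam₀ (k + 1) * (P.uhat η γ lam₀ k x - P.u (k + 1) x)
    have h1 := abs_le.1 (hη.abs_deriv_le_one t)
    have h2 := hη.convex t
    have h3 := (lam_pos hγ hl (k + 1)).le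
    simp only [conj_trivial]
    have h4 : 0 ≤ 1 / 2 * (1 + deriv η t) := by linarith
    have h5 : 0 ≤ 1 / 2 * (lam γ lam₀ (k + 1) * deriv (deriv η) t) *
        (⟪P.gradHat η γ lam₀ k x - P.N (k + 1), ξ⟫ *
          ⟪P.gradHat η γ lam₀ k x - P.N (k + 1), ξ⟫) :=
      mul_nonneg (by positivity) (mul_self_nonneg _)
    nlinarith [mul_nonneg h4 ih]

theorem norm_gradHat_le (hη : IsSmoothAbs η) (hunit : ∀ k ≤ P.q, ‖P.N k‖ = 1) {k : ℕ}
    (hk : k ≤ P.q) (x : E n) : ‖P.gradHat η γ lam₀ k x‖ ≤ 1 := by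
  induction k with
  | zero => exact (hunit 0 hk).le
  | succ k ih =>
    refine (norm_add_le _ _).trans ?_
    set t := lam γ lam₀ (k + 1) * (P.uhat η γ lam₀ k x - P.u (k + 1) x)
    have h1 := abs_le.1 (hη.abs_deriv_le_one t)
    rw [norm_smul, norm_smul, hunit (k + 1) hk, Real.norm_of_nonneg (by linarith),
      Real.norm_of_nonneg (by linarith)]
    nlinarith [ih (by omega)]

theorem exists_norm_fderiv_gradHat_le (hη : IsSmoothAbs η) (hunit : ∀ k ≤ P.q, ‖P.N k‖ = 1)
    {k : ℕ} (hk : k ≤ P.q) :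
    ∃ C, 0 ≤ C ∧ ∀ γ ∈ Set.Ioo (0 : ℝ) (1 / 2), ∀ lam₀, 1 ≤ lam₀ → ∀ x,
      ‖fderiv ℝ (P.gradHat η γ lam₀ k) x‖ ≤ C * lam γ lam₀ k := by
  induction k with
  | zero =>
    refine ⟨0, le_rfl, fun γ _ lam₀ _ x => ?_⟩
    have : P.gradHat η γ lam₀ 0 = fun _ => P.N 0 := rfl
    simp [this]
  | succ k ih =>
    obtain ⟨C, hC, ih⟩ := ih (by omega)
    obtain ⟨M, hM, hM'⟩ := hη.exists_abs_deriv_deriv_le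
    -- The rank-one term contributes 1/2 · M · 2 · 2, as ‖∇û_k - N_{k+1}‖ ≤ 2; the old bound carries
    -- over because λ_k ≤ λ_{k+1}.
    refine ⟨C + 2 * M, by positivity, fun γ hγ lam₀ hl x => ?_⟩
    have hlam := lam_pos hγ hl (k + 1)
    refine ContinuousLinearMap.opNorm_le_bound _ (by positivity) fun ξ => ?_
    rw [P.fderiv_gradHat_succ hη hγ hl]
    set t := lam γ lam₀ (k + 1) * (P.uhat η γ lam₀ k x - P.u (k + 1) x)
    set X := P.gradHat η γ lam₀ k x - P.N (k + 1)
    have hX : ‖X‖ ≤ 2 := by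
      refine (norm_sub_le _ _).trans ?_
      linarith [P.norm_gradHat_le hη hunit (γ := γ) (lam₀ := lam₀) (by omega : k ≤ P.q) x,
        hunit (k + 1) hk]
    have h1 := abs_le.1 (hη.abs_deriv_le_one t)
    have h2 := hη.convex t
    have h3 : ‖fderiv ℝ (P.gradHat η γ lam₀ k) x ξ‖ ≤ C * lam γ lam₀ (k + 1) * ‖ξ‖ := by
      refine (ContinuousLinearMap.le_opNorm _ _).trans ?_
      gcongr
      exact (ih γ hγ lam₀ hl x).trans
        (mul_le_mul_of_nonneg_left (lam_le_lam_succ hγ hl k) hC)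
    have h4 : ‖⟪X, ξ⟫‖ ≤ 2 * ‖ξ‖ := (norm_inner_le_norm X ξ).trans (by gcongr)
    refine (norm_add_le _ _).trans ?_
    rw [norm_smul, norm_smul, norm_mul _ ⟪X, ξ⟫, Real.norm_of_nonneg (by linarith),
      Real.norm_of_nonneg (by positivity)]
    have h5 : 1 / 2 * (1 + deriv η t) * ‖fderiv ℝ (P.gradHat η γ lam₀ k) x ξ‖
        ≤ 1 * (C * lam γ lam₀ (k + 1) * ‖ξ‖) :=
      mul_le_mul (by linarith) h3 (norm_nonneg _) zero_le_one
    have h6 : 1 / 2 * (lam γ lam₀ (k + 1) * deriv (deriv η) t) * ‖⟪X, ξ⟫‖ * ‖X‖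
        ≤ 1 / 2 * (lam γ lam₀ (k + 1) * M) * (2 * ‖ξ‖) * 2 := by
      gcongr
      exact hM' t
    linarith

/-- With |·| in place of η the recursion would give exactly max(û_k, u_{k+1}), and η ≥ |·| can only
increase it. -/
theorem uhat_le_uhat_succ (hη : IsSmoothAbs η) (hγ : γ ∈ Set.Ioo (0 : ℝ) (1 / 2))
    (hl : 1 ≤ lam₀) (k : ℕ) (x : E n) :
    P.uhat η γ lam₀ k x ≤ P.uhat η γ lam₀ (k + 1) x ∧
      P.u (k + 1) x ≤ P.uhat η γ lam₀ (k + 1) x := by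
  have hlam := lam_pos hγ hl (k + 1)
  have h1 := hη.abs_le (lam γ lam₀ (k + 1) * (P.uhat η γ lam₀ k x - P.u (k + 1) x))
  rw [abs_mul, abs_of_pos hlam] at h1
  have h2 := mul_le_mul_of_nonneg_left h1 (inv_pos.2 hlam).le
  rw [inv_mul_cancel_left₀ hlam.ne'] at h2
  have h3 := le_abs_self (P.uhat η γ lam₀ k x - P.u (k + 1) x)
  have h4 := neg_abs_le (P.uhat η γ lam₀ k x - P.u (k + 1) x)
  simp only [uhat]
  constructor <;> linarith

theorem u_le_uhat (hη : IsSmoothAbs η) (hγ : γ ∈ Set.Ioo (0 : ℝ) (1 / 2))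
    (hl : 1 ≤ lam₀) {m k : ℕ} (h : m ≤ k) (x : E n) : P.u m x ≤ P.uhat η γ lam₀ k x := by
  induction k with
  | zero =>
    obtain rfl : m = 0 := by omega
    exact le_rfl
  | succ k ih =>
    rcases Nat.lt_or_ge k m with h' | h'
    · obtain rfl : m = k + 1 := by omega
      exact (P.uhat_le_uhat_succ hη hγ hl k x).2
    · exact (ih h').trans (P.uhat_le_uhat_succ hη hγ hl k x).1

theorem SigmaHat_subset_Omega (hη : IsSmoothAbs η) (hγ : γ ∈ Set.Ioo (0 : ℝ) (1 / 2))
    (hl : 1 ≤ lam₀) : P.SigmaHat η γ lam₀ ⊆ P.Omega := fun x hx m hm => by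
  have := P.u_le_uhat hη hγ hl hm x
  rwa [show P.uhat η γ lam₀ P.q x = 0 from hx] at this

/-- Where `û_k` and `u_{k+1}` are close, both are close to `û_{k+1}`. -/
theorem uhat_succ_sub_le (hη : IsSmoothAbs η) (hγ : γ ∈ Set.Ioo (0 : ℝ) (1 / 2))
    (hl : 1 ≤ lam₀) {k : ℕ} {x : E n}
    (h : |P.uhat η γ lam₀ k x - P.u (k + 1) x| ≤ (lam γ lam₀ (k + 1))⁻¹) :
    P.uhat η γ lam₀ (k + 1) x - 2 * lam₀⁻¹ ≤ P.uhat η γ lam₀ k x ∧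
      P.uhat η γ lam₀ (k + 1) x - 2 * lam₀⁻¹ ≤ P.u (k + 1) x := by
  have hlam := lam_pos hγ hl (k + 1)
  have h1 : |lam γ lam₀ (k + 1) * (P.uhat η γ lam₀ k x - P.u (k + 1) x)| ≤ 1 := by
    rw [abs_mul, abs_of_pos hlam]
    calc _ ≤ lam γ lam₀ (k + 1) * (lam γ lam₀ (k + 1))⁻¹ := by gcongr
      _ = 1 := mul_inv_cancel₀ hlam.ne'
  -- Since η ≤ 3 here, û_{k+1} ≤ (û_k + u_{k+1} + 3/λ_{k+1})/2. Replacing one of the two functions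
  -- by the other costs another 1/(2λ_{k+1}), for a total of 2/λ_{k+1} ≤ 2/λ₀.
  have h2 := mul_le_mul_of_nonneg_left (hη.le_three h1) (inv_pos.2 hlam).le
  have h3 : (lam γ lam₀ (k + 1))⁻¹ ≤ lam₀⁻¹ :=
    inv_anti₀ (by linarith) (le_lam hγ hl (k + 1))
  have h4 := abs_le.1 h
  simp only [uhat]
  constructor <;> linarith

/-- The inequality is strict, hence holds nearby, and there the argument of η exceeds 1, where η is
|·|. Equality of germs transfers all derivatives, so curvature and trace norm as well. -/
theorem uhat_succ_eventuallyEq_uhat (hη : IsSmoothAbs η) (hγ : γ ∈ Set.Ioo (0 : ℝ) (1 / 2))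
    (hl : 1 ≤ lam₀) (g : RiemannianMetric n) {k : ℕ} {x : E n}
    (h : (lam γ lam₀ (k + 1))⁻¹ < P.uhat η γ lam₀ k x - P.u (k + 1) x) :
    P.uhat η γ lam₀ (k + 1) =ᶠ[nhds x] P.uhat η γ lam₀ k ∧
      P.Nhat g η γ lam₀ (k + 1) =ᶠ[nhds x] P.Nhat g η γ lam₀ k := by
  have hlam := lam_pos hγ hl (k + 1)
  have hc : Continuous fun x => P.uhat η γ lam₀ k x - P.u (k + 1) x :=
    ((P.contDiff_uhat hη k).sub (P.contDiff_u _)).continuous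
  have hev := hc.continuousAt.eventually (lt_mem_nhds h)
  constructor
  · filter_upwards [hev] with y hy
    have h1 := mul_lt_mul_of_pos_left hy hlam
    rw [mul_inv_cancel₀ hlam.ne'] at h1
    simp only [uhat]
    rw [hη.eq_abs _ (by rw [abs_of_pos (by linarith)]; linarith), abs_of_pos (by linarith),
      inv_mul_cancel_left₀ hlam.ne']
    ring
  · filter_upwards [hev] with y hy
    simp only [Nhat]
    rw [if_pos hy]

theorem uhat_succ_eventuallyEq_u (hη : IsSmoothAbs η) (hγ : γ ∈ Set.Ioo (0 : ℝ) (1 / 2))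
    (hl : 1 ≤ lam₀) (g : RiemannianMetric n) {k : ℕ} {x : E n}
    (h : P.uhat η γ lam₀ k x - P.u (k + 1) x < -(lam γ lam₀ (k + 1))⁻¹) :
    P.uhat η γ lam₀ (k + 1) =ᶠ[nhds x] P.u (k + 1) ∧
      P.Nhat g η γ lam₀ (k + 1) =ᶠ[nhds x] fun _ => P.N (k + 1) := by
  have hlam := lam_pos hγ hl (k + 1)
  have hc : Continuous fun x => P.uhat η γ lam₀ k x - P.u (k + 1) x :=
    ((P.contDiff_uhat hη k).sub (P.contDiff_u _)).continuous
  have hev := hc.continuousAt.eventually (gt_mem_nhds h)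
  have hinv := inv_pos.2 hlam
  constructor
  · filter_upwards [hev] with y hy
    have h1 := mul_lt_mul_of_pos_left hy hlam
    rw [mul_neg, mul_inv_cancel₀ hlam.ne'] at h1
    simp only [uhat]
    rw [hη.eq_abs _ (by rw [abs_of_neg (by linarith)]; linarith), abs_of_neg (by linarith),
      mul_neg, inv_mul_cancel_left₀ hlam.ne']
    ring
  · filter_upwards [hev] with y hy
    simp only [Nhat]
    rw [if_neg (by linarith), if_pos hy]

end HalfSpaces

/-! ### Interpolation along great circles -/

section Blend

variable {n : ℕ}

/-- After squaring: sin²a + sin²b + 2 sin a sin b cos(a + b) = sin²(a + b). The companion for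
cosines below gives the length of the velocity. -/
theorem norm_sin_smul_add_sin_smul {V W : E n} (hV : ‖V‖ = 1) (hW : ‖W‖ = 1) {a b : ℝ}
    (h : ⟪V, W⟫ = Real.cos (a + b)) :
    ‖Real.sin a • V + Real.sin b • W‖ = |Real.sin (a + b)| := by
  rw [← Real.sqrt_sq (norm_nonneg _), ← Real.sqrt_sq_eq_abs, norm_add_sq_real, norm_smul,
    norm_smul, hV, hW, inner_smul_left, inner_smul_right, h]
  congr 1
  simp only [conj_trivial, Real.norm_eq_abs, mul_one, sq_abs, Real.cos_add, Real.sin_add]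
  have h1 := Real.sin_sq_add_cos_sq a
  have h2 := Real.sin_sq_add_cos_sq b
  have h3 : Real.cos a ^ 2 = 1 - Real.sin a ^ 2 := by linarith
  have h4 : Real.cos b ^ 2 = 1 - Real.sin b ^ 2 := by linarith
  ring_nf
  rw [h3, h4]
  ring

theorem norm_cos_smul_sub_cos_smul {V W : E n} (hV : ‖V‖ = 1) (hW : ‖W‖ = 1) {a b : ℝ}
    (h : ⟪V, W⟫ = Real.cos (a + b)) :
    ‖Real.cos a • V - Real.cos b • W‖ = |Real.sin (a + b)| := by
  rw [← Real.sqrt_sq (norm_nonneg _), ← Real.sqrt_sq_eq_abs, norm_sub_sq_real, norm_smul,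
    norm_smul, hV, hW, inner_smul_left, inner_smul_right, h]
  congr 1
  simp only [conj_trivial, Real.norm_eq_abs, mul_one, sq_abs, Real.cos_add, Real.sin_add]
  have h1 := Real.sin_sq_add_cos_sq a
  have h2 := Real.sin_sq_add_cos_sq b
  have h3 : Real.sin a ^ 2 = 1 - Real.cos a ^ 2 := by linarith
  have h4 : Real.sin b ^ 2 = 1 - Real.cos b ^ 2 := by linarith
  ring_nf
  rw [h3, h4]
  ring

variable {c : ℝ} (hc : c ^ 2 < 1)
include hc

theorem arccos_pos_of_sq_lt_one : 0 < Real.arccos c :=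
  Real.arccos_pos.2 (abs_lt.1 ((sq_lt_one_iff_abs_lt_one c).1 hc)).2

theorem arccos_lt_pi_of_sq_lt_one : Real.arccos c < Real.pi := by
  refine lt_of_le_of_ne (Real.arccos_le_pi c) fun h => ?_
  have := Real.arccos_eq_pi.1 h
  linarith [(abs_lt.1 ((sq_lt_one_iff_abs_lt_one c).1 hc)).1]

theorem sin_arccos_pos_of_sq_lt_one : 0 < Real.sin (Real.arccos c) :=
  Real.sin_pos_of_pos_of_lt_pi (arccos_pos_of_sq_lt_one hc) (arccos_lt_pi_of_sq_lt_one hc)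

theorem cos_arccos_of_sq_lt_one : Real.cos (Real.arccos c) = c := by
  have := abs_lt.1 ((sq_lt_one_iff_abs_lt_one c).1 hc)
  exact Real.cos_arccos this.1.le this.2.le

theorem cos_half_arccos_pos : 0 < Real.cos (Real.arccos c / 2) :=
  Real.cos_pos_of_mem_Ioo ⟨by linarith [arccos_pos_of_sq_lt_one hc, Real.pi_pos],
    by linarith [arccos_lt_pi_of_sq_lt_one hc]⟩

theorem tan_half_arccos_pos : 0 < Real.tan (Real.arccos c / 2) :=
  Real.tan_pos_of_pos_of_lt_pi_div_two (by linarith [arccos_pos_of_sq_lt_one hc])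
    (by linarith [arccos_lt_pi_of_sq_lt_one hc])

theorem arctan_tan_half_arccos : Real.arctan (Real.tan (Real.arccos c / 2)) = Real.arccos c / 2 :=
  Real.arctan_tan (by linarith [arccos_pos_of_sq_lt_one hc, Real.pi_pos])
    (by linarith [arccos_lt_pi_of_sq_lt_one hc])

variable {V W : E n}

theorem blend_eq (r : ℝ) : blend c r V W = (Real.sin (Real.arccos ⟪V, W⟫))⁻¹ •
    (Real.sin (Real.arccos ⟪V, W⟫ / Real.arccos c *
        (Real.arccos c / 2 + Real.arctan (r * Real.tan (Real.arccos c / 2)))) • V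
      + Real.sin (Real.arccos ⟪V, W⟫ / Real.arccos c *
        (Real.arccos c / 2 - Real.arctan (r * Real.tan (Real.arccos c / 2)))) • W) := by
  have h := (arccos_pos_of_sq_lt_one hc).ne'
  have h1 : 2 * (Real.arccos ⟪V, W⟫ / (2 * (Real.arccos c / 2))) * (Real.arccos c / 2) =
      Real.arccos ⟪V, W⟫ := by field_simp
  have h2 : 2 * (Real.arccos c / 2) = Real.arccos c := by ring
  simp only [blend]
  rw [h1, h2]

theorem blend_angles (r : ℝ) : Real.arccos ⟪V, W⟫ / Real.arccos c *
        (Real.arccos c / 2 + Real.arctan (r * Real.tan (Real.arccos c / 2)))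
      + Real.arccos ⟪V, W⟫ / Real.arccos c *
        (Real.arccos c / 2 - Real.arctan (r * Real.tan (Real.arccos c / 2)))
      = Real.arccos ⟪V, W⟫ := by
  have h := (arccos_pos_of_sq_lt_one hc).ne'
  field_simp
  ring

theorem arctan_mul_tan_half_arccos_mem {r : ℝ} (hr : |r| ≤ 1) :
    |Real.arctan (r * Real.tan (Real.arccos c / 2))| ≤ Real.arccos c / 2 := by
  have h := tan_half_arccos_pos hc
  have h1 := abs_le.1 hr
  have h2 := Real.arctan_mono (show r * Real.tan (Real.arccos c / 2) ≤
    Real.tan (Real.arccos c / 2) by nlinarith)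
  have h3 := Real.arctan_mono (show -Real.tan (Real.arccos c / 2) ≤
    r * Real.tan (Real.arccos c / 2) by nlinarith)
  rw [arctan_tan_half_arccos hc] at h2
  rw [Real.arctan_neg, arctan_tan_half_arccos hc] at h3
  exact abs_le.2 ⟨h3, h2⟩

variable (hVW : ⟪V, W⟫ ^ 2 < 1)
include hVW

/-- Ratio 1 means φ = α, the endpoint V of the arc; ratio -1 is the endpoint W. Hence the
interpolation formula continues the two other cases in the definition of N̂ past the thresholds. -/
theorem blend_one : blend c 1 V W = V := by
  have h := (arccos_pos_of_sq_lt_one hc).ne'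
  have h1 := (sin_arccos_pos_of_sq_lt_one hVW).ne'
  rw [blend_eq hc, one_mul, arctan_tan_half_arccos hc, sub_self, add_halves, div_mul_cancel₀ _ h]
  simp [smul_smul, inv_mul_cancel₀ h1]

theorem blend_neg_one : blend c (-1) V W = W := by
  have h := (arccos_pos_of_sq_lt_one hc).ne'
  have h1 := (sin_arccos_pos_of_sq_lt_one hVW).ne'
  rw [blend_eq hc, neg_one_mul, Real.arctan_neg, arctan_tan_half_arccos hc, sub_neg_eq_add,
    add_halves, div_mul_cancel₀ _ h, add_neg_cancel]
  simp [smul_smul, inv_mul_cancel₀ h1]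

theorem norm_blend (hV : ‖V‖ = 1) (hW : ‖W‖ = 1) (r : ℝ) : ‖blend c r V W‖ = 1 := by
  have h1 := sin_arccos_pos_of_sq_lt_one hVW
  rw [blend_eq hc, norm_smul, norm_sin_smul_add_sin_smul hV hW, blend_angles hc, norm_inv,
    Real.norm_eq_abs, inv_mul_cancel₀ (abs_pos.2 h1.ne').ne']
  rw [blend_angles hc, cos_arccos_of_sq_lt_one hVW]

/-- The coefficients are sines of angles in [0, π], hence nonnegative. Their sum is at least 1 by
the triangle inequality, because the blend of two unit vectors is again a unit vector. -/
theorem exists_blend_eq (hV : ‖V‖ = 1) (hW : ‖W‖ = 1) {r : ℝ} (hr : |r| ≤ 1) :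
    ∃ a b : ℝ, 0 ≤ a ∧ 0 ≤ b ∧ 1 ≤ a + b ∧ blend c r V W = a • V + b • W := by
  have hα := arccos_pos_of_sq_lt_one hc
  have hβ := arccos_pos_of_sq_lt_one hVW
  have h1 := abs_le.1 (arctan_mul_tan_half_arccos_mem hc hr)
  have hpi := (arccos_lt_pi_of_sq_lt_one hVW).le
  have hang := blend_angles (V := V) (W := W) hc r
  have hA : 0 ≤ Real.arccos ⟪V, W⟫ / Real.arccos c *
        (Real.arccos c / 2 + Real.arctan (r * Real.tan (Real.arccos c / 2))) :=
    mul_nonneg (by positivity) (by linarith)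
  have hB : 0 ≤ Real.arccos ⟪V, W⟫ / Real.arccos c *
        (Real.arccos c / 2 - Real.arctan (r * Real.tan (Real.arccos c / 2))) :=
    mul_nonneg (by positivity) (by linarith)
  have hnorm := norm_blend hc hVW hV hW r
  rw [blend_eq hc] at hnorm ⊢
  have hs := (inv_pos.2 (sin_arccos_pos_of_sq_lt_one hVW)).le
  have hSA := mul_nonneg hs (Real.sin_nonneg_of_nonneg_of_le_pi hA (by linarith))
  have hSB := mul_nonneg hs (Real.sin_nonneg_of_nonneg_of_le_pi hB (by linarith))
  refine ⟨_, _, hSA, hSB, ?_, ?_⟩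
  rotate_left
  · rw [smul_add, smul_smul, smul_smul]
  · rw [← hnorm, smul_add, smul_smul, smul_smul]
    refine (norm_add_le _ _).trans (le_of_eq ?_)
    rw [norm_smul, norm_smul, hV, hW, Real.norm_of_nonneg hSA, Real.norm_of_nonneg hSB]
    ring

/-- Moving the parameter moves the blend with speed `θ dφ`. -/
theorem exists_hasDerivAt_blend (hV : ‖V‖ = 1) (hW : ‖W‖ = 1) (r : ℝ) :
    ∃ y : E n, HasDerivAt (fun r => blend c r V W) y r ∧
      ‖y‖ = Real.arccos ⟪V, W⟫ / Real.arccos c *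
        (Real.tan (Real.arccos c / 2) / (1 + (r * Real.tan (Real.arccos c / 2)) ^ 2)) := by
  have h1 := sin_arccos_pos_of_sq_lt_one hVW
  have hα := arccos_pos_of_sq_lt_one hc
  have hβ := arccos_pos_of_sq_lt_one hVW
  have ht := tan_half_arccos_pos hc
  set θ := Real.arccos ⟪V, W⟫ / Real.arccos c with hθ
  set τ := Real.tan (Real.arccos c / 2)
  set α := Real.arccos c / 2 with hαdef
  have hφ : HasDerivAt (fun r => Real.arctan (r * τ)) (1 / (1 + (r * τ) ^ 2) * τ) r := by
    simpa using ((hasDerivAt_id r).mul_const τ).arctan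
  have hA := ((hφ.const_add α).const_mul θ).sin.smul_const V
  have hB := ((hφ.const_sub α).const_mul θ).sin.smul_const W
  have hE := (hA.add hB).const_smul (Real.sin (Real.arccos ⟪V, W⟫))⁻¹
  have hfun : (fun r => blend c r V W) = fun r => (Real.sin (Real.arccos ⟪V, W⟫))⁻¹ •
      (Real.sin (θ * (α + Real.arctan (r * τ))) • V
        + Real.sin (θ * (α - Real.arctan (r * τ))) • W) := funext fun r => blend_eq hc r
  rw [hfun]
  refine ⟨_, hE, ?_⟩
  set A := θ * (α + Real.arctan (r * τ))
  set B := θ * (α - Real.arctan (r * τ))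
  have hAB : A + B = Real.arccos ⟪V, W⟫ := blend_angles hc r
  set δ := θ * (τ / (1 + (r * τ) ^ 2)) with hδ
  have hδ0 : 0 ≤ δ := by positivity
  -- The angles A and B move at opposite speeds ±δ, so the velocity is a multiple of cos A · V - cos
  -- B · W, whose length is sin(A + B). This cancels the normalizing sine.
  have hrw : ((Real.cos A * (θ * (1 / (1 + (r * τ) ^ 2) * τ))) • V +
      (Real.cos B * (θ * -(1 / (1 + (r * τ) ^ 2) * τ))) • W)
      = δ • (Real.cos A • V - Real.cos B • W) := by
    rw [hδ]
    module
  rw [hrw, norm_smul, norm_smul, norm_cos_smul_sub_cos_smul hV hW, hAB, norm_inv,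
    Real.norm_eq_abs, Real.norm_of_nonneg hδ0, mul_comm, mul_assoc,
    mul_inv_cancel₀ (abs_pos.2 h1.ne').ne', mul_one]
  rw [hAB, cos_arccos_of_sq_lt_one hVW]

omit hc hVW in
theorem contDiffAt_blend {F : Type*} [NormedAddCommGroup F] [NormedSpace ℝ F] {c r : F → ℝ}
    {V W : F → E n} {z : F} (hc : ContDiffAt ℝ ∞ c z) (hr : ContDiffAt ℝ ∞ r z)
    (hV : ContDiffAt ℝ ∞ V z) (hW : ContDiffAt ℝ ∞ W z) (hc1 : c z ^ 2 < 1)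
    (hVW : ⟪V z, W z⟫ ^ 2 < 1) :
    ContDiffAt ℝ ∞ (fun y => blend (c y) (r y) (V y) (W y)) z := by
  have harccos : ∀ {f : F → ℝ}, ContDiffAt ℝ ∞ f z → f z ^ 2 < 1 →
      ContDiffAt ℝ ∞ (fun y => Real.arccos (f y)) z := fun {f} hf h => by
    have h' := abs_lt.1 ((sq_lt_one_iff_abs_lt_one _).1 h)
    exact (Real.contDiffAt_arccos h'.1.ne' h'.2.ne).comp z hf
  have hα : ContDiffAt ℝ ∞ (fun y => Real.arccos (c y) / 2) z := (harccos hc hc1).div_const 2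
  have hβ := harccos (hV.inner ℝ hW) hVW
  have hα0 : Real.arccos (c z) / 2 ≠ 0 := (half_pos (arccos_pos_of_sq_lt_one hc1)).ne'
  have hθ : ContDiffAt ℝ ∞ (fun y => Real.arccos ⟪V y, W y⟫ / (2 * (Real.arccos (c y) / 2))) z :=
    hβ.div (contDiffAt_const.mul hα) (mul_ne_zero two_ne_zero hα0)
  have htan : ContDiffAt ℝ ∞ (fun y => Real.tan (Real.arccos (c y) / 2)) z :=
    ContDiffAt.comp z (g := Real.tan) (Real.contDiffAt_tan.2 (cos_half_arccos_pos hc1).ne') hα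
  have hφ := (hr.mul htan).arctan
  have hsin : ContDiffAt ℝ ∞ (fun y => Real.sin (2 * (Real.arccos ⟪V y, W y⟫ /
      (2 * (Real.arccos (c y) / 2))) * (Real.arccos (c y) / 2))) z :=
    ((contDiffAt_const.mul hθ).mul hα).sin
  refine (hsin.inv ?_).smul
    (((hθ.mul (hα.add hφ)).sin.smul hV).add ((hθ.mul (hα.sub hφ)).sin.smul hW))
  have : 2 * (Real.arccos ⟪V z, W z⟫ / (2 * (Real.arccos (c z) / 2))) * (Real.arccos (c z) / 2) =
      Real.arccos ⟪V z, W z⟫ := by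
    have h := (arccos_pos_of_sq_lt_one hc1).ne'
    field_simp
  rw [this]
  exact (sin_arccos_pos_of_sq_lt_one hVW).ne'

end Blend

/-! ### The speed of the angle φ as a function of s = η' -/

section Ratio

/-- The ratio `((1 + s) A - (1 - s) B) / ((1 + s) A + (1 - s) B)`. -/
def ratio (s A B : ℝ) : ℝ :=
  ((1 + s) * A - (1 - s) * B) / ((1 + s) * A + (1 - s) * B)

variable {s A B : ℝ} (hs : |s| ≤ 1) (hA : 0 < A) (hB : 0 < B)
include hs hA hB

theorem ratio_den_pos : 0 < (1 + s) * A + (1 - s) * B := by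
  have h := abs_le.1 hs
  rcases le_total 0 s with h' | h'
  · have := mul_pos (show 0 < 1 + s by linarith) hA
    have := mul_nonneg (show 0 ≤ 1 - s by linarith) hB.le
    linarith
  · have := mul_pos (show 0 < 1 - s by linarith) hB
    have := mul_nonneg (show 0 ≤ 1 + s by linarith) hA.le
    linarith

theorem abs_ratio_le_one : |ratio s A B| ≤ 1 := by
  have h := abs_le.1 hs
  have h1 := ratio_den_pos hs hA hB
  have h2 := mul_nonneg (show 0 ≤ 1 - s by linarith) hB.le
  have h3 := mul_nonneg (show 0 ≤ 1 + s by linarith) hA.le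
  rw [ratio, abs_div, abs_of_pos h1, div_le_one h1, abs_le]
  constructor <;> linarith

theorem hasDerivAt_ratio : HasDerivAt (fun s => ratio s A B)
    (4 * A * B / ((1 + s) * A + (1 - s) * B) ^ 2) s := by
  have h1 := ratio_den_pos hs hA hB
  have h2 := (((hasDerivAt_id s).const_add 1).mul_const A).sub
    (((hasDerivAt_id s).const_sub 1).mul_const B)
  have h3 := (((hasDerivAt_id s).const_add 1).mul_const A).add
    (((hasDerivAt_id s).const_sub 1).mul_const B)
  refine (h2.div h3 h1.ne').congr_deriv ?_
  simp
  ring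

/-- With cos 2α = c, the left side is dφ/ds for tan φ = `ratio` · tan α. Take vectors P, W of
lengths A, B at angle 2α, and U = ((1+s)P + (1-s)W)/2. Then φ is the angle of U from the bisector,
and the right side is the area of the parallelogram on P, W divided by 2|U|²: the angular speed |U ∧
U'|/|U|², since U' = (P - W)/2. -/
theorem tan_mul_deriv_ratio {c : ℝ} (hc : c ^ 2 < 1) :
    Real.tan (Real.arccos c / 2) / (1 + (ratio s A B * Real.tan (Real.arccos c / 2)) ^ 2) *
      (4 * A * B / ((1 + s) * A + (1 - s) * B) ^ 2) =
    A * B * √(1 - c ^ 2) / (2 * (1 / 4 * (((1 + s) * A) ^ 2 + ((1 - s) * B) ^ 2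
      + 2 * ((1 + s) * A) * ((1 - s) * B) * c))) := by
  have hden := ratio_den_pos hs hA hB
  have hK := cos_half_arccos_pos hc
  have hS : 0 < Real.sin (Real.arccos c / 2) :=
    Real.sin_pos_of_pos_of_lt_pi (by linarith [arccos_pos_of_sq_lt_one hc])
      (by linarith [arccos_lt_pi_of_sq_lt_one hc, arccos_pos_of_sq_lt_one hc])
  have h1 : √(1 - c ^ 2) =
      2 * Real.sin (Real.arccos c / 2) * Real.cos (Real.arccos c / 2) := by
    rw [← Real.sin_two_mul, mul_div_cancel₀ _ two_ne_zero, Real.sin_arccos]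
  have h2 : c = 2 * Real.cos (Real.arccos c / 2) ^ 2 - 1 := by
    rw [← Real.cos_two_mul, mul_div_cancel₀ _ two_ne_zero, cos_arccos_of_sq_lt_one hc]
  rw [h1, Real.tan_eq_sin_div_cos, ratio]
  have h3 := Real.sin_sq_add_cos_sq (Real.arccos c / 2)
  set K := Real.cos (Real.arccos c / 2)
  set S := Real.sin (Real.arccos c / 2)
  set p := (1 + s) * A
  set m := (1 - s) * B
  -- Pythagoras for the components along the bisector and orthogonal to it.
  have hQ : p ^ 2 + m ^ 2 + 2 * p * m * c = K ^ 2 * (p + m) ^ 2 + (p - m) ^ 2 * S ^ 2 := by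
    rw [show S ^ 2 = 1 - K ^ 2 by linarith, h2]
    ring
  have hQ0 : 0 < K ^ 2 * (p + m) ^ 2 + (p - m) ^ 2 * S ^ 2 :=
    add_pos_of_pos_of_nonneg (by positivity) (by positivity)
  rw [hQ]
  have h4 : 1 + ((p - m) / (p + m) * (S / K)) ^ 2 =
      (K ^ 2 * (p + m) ^ 2 + (p - m) ^ 2 * S ^ 2) / (K ^ 2 * (p + m) ^ 2) := by
    field_simp
  rw [h4]
  field_simp

end Ratio

/-! ### Vectors dual to Euclidean gradients -/

section Raise

variable {n : ℕ} (g : RiemannianMetric n)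

theorem RiemannianMetric.norm_const_smul (x : E n) (a : ℝ) (v : E n) :
    g.norm x (a • v) = |a| * g.norm x v := by
  simp only [norm, map_smul, smul_apply, smul_eq_mul]
  rw [← mul_assoc, Real.sqrt_mul (mul_self_nonneg a), Real.sqrt_mul_self_eq_abs]

/-- The vector whose `g`-product with `v` is the Euclidean product of `p` and `v`. -/
def RiemannianMetric.raise (x p : E n) : E n :=
  g.sharp x (innerSL ℝ p)

/-- The `g`-unit vector in the direction of `raise x p`. -/
def RiemannianMetric.dirNormal (x p : E n) : E n :=
  (g.norm x (g.raise x p))⁻¹ • g.raise x p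

/-- The cosine of the `g`-angle of the vectors dual to `p` and `w`. -/
def RiemannianMetric.cosAngle (x p w : E n) : ℝ :=
  g.form x (g.dirNormal x p) (g.dirNormal x w)

theorem RiemannianMetric.form_raise (x p v : E n) : g.form x (g.raise x p) v = ⟪p, v⟫ := by
  rw [raise, g.form_sharp]
  rfl

theorem RiemannianMetric.raise_add (x p w : E n) :
    g.raise x (p + w) = g.raise x p + g.raise x w := by
  simp [raise]

theorem RiemannianMetric.raise_sub (x p w : E n) :
    g.raise x (p - w) = g.raise x p - g.raise x w := by
  simp [raise]

theorem RiemannianMetric.raise_smul (x : E n) (a : ℝ) (p : E n) :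
    g.raise x (a • p) = a • g.raise x p := by
  simp [raise]

theorem RiemannianMetric.raise_ne_zero (x : E n) {p : E n} (hp : p ≠ 0) : g.raise x p ≠ 0 := by
  intro h
  have := g.form_raise x p p
  rw [h] at this
  simp only [map_zero, zero_apply] at this
  exact hp (inner_self_eq_zero.1 this.symm)

theorem RiemannianMetric.norm_raise_pos (x : E n) {p : E n} (hp : p ≠ 0) :
    0 < g.norm x (g.raise x p) :=
  g.norm_pos (g.raise_ne_zero x hp)

theorem RiemannianMetric.form_raise_raise (x : E n) {p w : E n} (hp : p ≠ 0) (hw : w ≠ 0) :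
    g.form x (g.raise x p) (g.raise x w) =
      g.norm x (g.raise x p) * g.norm x (g.raise x w) * g.cosAngle x p w := by
  have h1 := (g.norm_raise_pos x hp).ne'
  have h2 := (g.norm_raise_pos x hw).ne'
  simp only [cosAngle, dirNormal, map_smul, smul_apply, smul_eq_mul]
  field_simp

/-- Independence does not depend on the inner product. The combination B²p - ABc·w is nonzero by the
strict Euclidean Cauchy–Schwarz inequality, and the `g`-square of its dual vector is A²B⁴(1 - c²).
-/
theorem RiemannianMetric.cosAngle_sq_lt_one (x : E n) {p w : E n}
    (h : ⟪p, w⟫ ^ 2 < ‖p‖ ^ 2 * ‖w‖ ^ 2) : g.cosAngle x p w ^ 2 < 1 := by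
  have hp : p ≠ 0 := by
    rintro rfl
    simp at h
  have hw : w ≠ 0 := by
    rintro rfl
    simp at h
  have hA := g.norm_raise_pos x hp
  have hB := g.norm_raise_pos x hw
  have hA2 := g.norm_sq x (g.raise x p)
  have hB2 := g.norm_sq x (g.raise x w)
  have hAB := g.form_raise_raise x hp hw
  set A := g.norm x (g.raise x p)
  set B := g.norm x (g.raise x w)
  set c := g.cosAngle x p w
  have hv : B ^ 2 • p - (A * B * c) • w ≠ 0 := by
    intro h0
    have h1 : B ^ 2 * ⟪p, p⟫ = A * B * c * ⟪p, w⟫ := by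
      have := congrArg (fun v => ⟪p, v⟫) h0
      simp only [inner_sub_right, inner_smul_right, inner_zero_right] at this
      linarith
    have h2 : B ^ 2 * ⟪p, w⟫ = A * B * c * ⟪w, w⟫ := by
      have := congrArg (fun v => ⟪w, v⟫) h0
      simp only [inner_sub_right, inner_smul_right, inner_zero_right] at this
      rw [real_inner_comm p w] at this
      linarith
    rw [real_inner_self_eq_norm_sq] at h1 h2
    have hpos : 0 < B ^ 2 := by positivity
    have h3 : B ^ 2 * ⟪p, w⟫ ^ 2 = B ^ 2 * (‖p‖ ^ 2 * ‖w‖ ^ 2) := by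
      linear_combination ⟪p, w⟫ * h2 - ‖w‖ ^ 2 * h1
    exact h.ne (mul_left_cancel₀ hpos.ne' h3)
  have h1 := g.pos x _ (g.raise_ne_zero x hv)
  rw [g.raise_sub, g.raise_smul, g.raise_smul] at h1
  simp only [map_sub, map_smul, sub_apply, smul_apply, smul_eq_mul,
    g.symm x (g.raise x w) (g.raise x p), hAB, ← hA2, ← hB2] at h1
  have h2 : 0 < A ^ 2 * B ^ 4 * (1 - c ^ 2) := by linarith
  have h3 := pos_of_mul_pos_right h2 (by positivity)
  linarith

section Smooth

variable {F : Type*} [NormedAddCommGroup F] [NormedSpace ℝ F] {X p w : F → E n} {z : F}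

theorem RiemannianMetric.contDiffAt_raise (hX : ContDiffAt ℝ ∞ X z) (hp : ContDiffAt ℝ ∞ p z) :
    ContDiffAt ℝ ∞ (fun y => g.raise (X y) (p y)) z :=
  (g.contDiff_sharp.contDiffAt.comp z hX).clm_apply
    ((innerSL ℝ : E n →L[ℝ] E n →L[ℝ] ℝ).contDiff.contDiffAt.comp z hp)

theorem RiemannianMetric.contDiffAt_norm_raise (hX : ContDiffAt ℝ ∞ X z)
    (hp : ContDiffAt ℝ ∞ p z) (h : p z ≠ 0) :
    ContDiffAt ℝ ∞ (fun y => g.norm (X y) (g.raise (X y) (p y))) z :=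
  g.contDiffAt_norm hX (g.contDiffAt_raise hX hp) (g.raise_ne_zero _ h)

theorem RiemannianMetric.contDiffAt_cosAngle (hX : ContDiffAt ℝ ∞ X z) (hp : ContDiffAt ℝ ∞ p z)
    (hw : ContDiffAt ℝ ∞ w z) (h : p z ≠ 0) (h' : w z ≠ 0) :
    ContDiffAt ℝ ∞ (fun y => g.cosAngle (X y) (p y) (w y)) z := by
  have hν : ∀ {p : F → E n}, ContDiffAt ℝ ∞ p z → p z ≠ 0 →
      ContDiffAt ℝ ∞ (fun y => g.dirNormal (X y) (p y)) z := fun {p} hp h =>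
    ((g.contDiffAt_norm_raise hX hp h).inv (g.norm_raise_pos _ h).ne').smul
      (g.contDiffAt_raise hX hp)
  exact ((g.smooth.contDiffAt.comp z hX).clm_apply (hν hp h)).clm_apply (hν hw h')

end Smooth

/-- The map through which `N̂_{k+1}` depends on the point, the gradient of `û_k`, the derivative of
`η`, the vector `N̂_k` and the vector `N_{k+1}`. -/
def RiemannianMetric.blendMap (z : E n × E n × ℝ × E n × E n) : E n :=
  blend (g.cosAngle z.1 z.2.1 z.2.2.2.2)
    (ratio z.2.2.1 (g.norm z.1 (g.raise z.1 z.2.1)) (g.norm z.1 (g.raise z.1 z.2.2.2.2)))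
    z.2.2.2.1 z.2.2.2.2

/-- The arguments at which `blendMap` is controlled. -/
def blendDomain (Ω : Set (E n)) (c : ℝ) : Set (E n × E n × ℝ × E n × E n) :=
  {z | z.1 ∈ Ω ∧ ‖z.2.1‖ ≤ 1 ∧ |z.2.2.1| ≤ 1 ∧ ‖z.2.2.2.1‖ = 1 ∧ ‖z.2.2.2.2‖ = 1 ∧
    c ≤ ‖z.2.1‖ ^ 2 - ⟪z.2.1, z.2.2.2.2⟫ ^ 2 ∧ c ≤ 1 - ⟪z.2.2.2.1, z.2.2.2.2⟫ ^ 2}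

/-- The source of uniformity: `blendMap` involves neither γ nor λ₀ nor the index, so continuity on
this compact set bounds it once and for all. -/
theorem isCompact_blendDomain {Ω : Set (E n)} (hΩ : IsCompact Ω) (c : ℝ) :
    IsCompact (blendDomain Ω c) := by
  have hK : IsCompact (Ω ×ˢ Metric.closedBall (0 : E n) 1 ×ˢ Set.Icc (-1 : ℝ) 1 ×ˢ
      Metric.closedBall (0 : E n) 1 ×ˢ Metric.closedBall (0 : E n) 1) :=
    hΩ.prod ((isCompact_closedBall _ _).prod (isCompact_Icc.prod
      ((isCompact_closedBall _ _).prod (isCompact_closedBall _ _))))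
  refine hK.of_isClosed_subset ?_ ?_
  · simp only [blendDomain, Set.ofPred_and]
    refine (hΩ.isClosed.preimage continuous_fst).inter ?_
    refine (isClosed_le (by fun_prop) (by fun_prop)).inter ?_
    refine (isClosed_le (by fun_prop) (by fun_prop)).inter ?_
    refine (isClosed_eq (by fun_prop) (by fun_prop)).inter ?_
    refine (isClosed_eq (by fun_prop) (by fun_prop)).inter ?_
    exact (isClosed_le (by fun_prop) (by fun_prop)).inter
      (isClosed_le (by fun_prop) (by fun_prop))
  · rintro ⟨x, p, s, V, w⟩ ⟨h1, h2, h3, h4, h5, -, -⟩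
    simp only [Set.mem_prod, Metric.mem_closedBall, dist_zero_right, Set.mem_Icc]
    exact ⟨h1, h2, abs_le.1 h3, h4.le, h5.le⟩

variable {g} {Ω : Set (E n)} {c : ℝ} {z : E n × E n × ℝ × E n × E n}

theorem blendDomain.inner_sq_lt (hc : 0 < c) (hz : z ∈ blendDomain Ω c) :
    ⟪z.2.1, z.2.2.2.2⟫ ^ 2 < ‖z.2.1‖ ^ 2 * ‖z.2.2.2.2‖ ^ 2 := by
  obtain ⟨-, -, -, -, h5, h6, -⟩ := hz
  rw [h5]
  linarith

theorem blendDomain.left_ne_zero (hc : 0 < c) (hz : z ∈ blendDomain Ω c) : z.2.1 ≠ 0 := by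
  intro h
  have := blendDomain.inner_sq_lt hc hz
  simp [h] at this

theorem blendDomain.right_ne_zero (hc : 0 < c) (hz : z ∈ blendDomain Ω c) : z.2.2.2.2 ≠ 0 := by
  intro h
  have := blendDomain.inner_sq_lt hc hz
  simp [h] at this

theorem blendDomain.inner_sq_lt_one (hc : 0 < c) (hz : z ∈ blendDomain Ω c) :
    ⟪z.2.2.2.1, z.2.2.2.2⟫ ^ 2 < 1 := by
  obtain ⟨-, -, -, -, -, -, h7⟩ := hz
  linarith

variable (g)

theorem RiemannianMetric.contDiffAt_cosAngle_blendDomain (hc : 0 < c)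
    (hz : z ∈ blendDomain Ω c) : ContDiffAt ℝ ∞
      (fun z : E n × E n × ℝ × E n × E n => g.cosAngle z.1 z.2.1 z.2.2.2.2) z :=
  g.contDiffAt_cosAngle (by fun_prop) (by fun_prop) (by fun_prop)
    (blendDomain.left_ne_zero hc hz) (blendDomain.right_ne_zero hc hz)

theorem RiemannianMetric.contDiffAt_blendMap (hc : 0 < c) (hz : z ∈ blendDomain Ω c) :
    ContDiffAt ℝ ∞ g.blendMap z := by
  have hA := blendDomain.left_ne_zero hc hz
  have hB := blendDomain.right_ne_zero hc hz
  have hA' : ContDiffAt ℝ ∞ (fun z : E n × E n × ℝ × E n × E n =>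
      g.norm z.1 (g.raise z.1 z.2.1)) z :=
    g.contDiffAt_norm_raise (by fun_prop) (by fun_prop) hA
  have hB' : ContDiffAt ℝ ∞ (fun z : E n × E n × ℝ × E n × E n =>
      g.norm z.1 (g.raise z.1 z.2.2.2.2)) z :=
    g.contDiffAt_norm_raise (by fun_prop) (by fun_prop) hB
  have hs : ContDiffAt ℝ ∞ (fun z : E n × E n × ℝ × E n × E n => z.2.2.1) z := by fun_prop
  refine contDiffAt_blend (g.contDiffAt_cosAngle_blendDomain hc hz) ?_ (by fun_prop)
    (by fun_prop) (g.cosAngle_sq_lt_one _ (blendDomain.inner_sq_lt hc hz))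
    (blendDomain.inner_sq_lt_one hc hz)
  exact ((((contDiffAt_const.add hs).mul hA').sub ((contDiffAt_const.sub hs).mul hB'))).div
    (((contDiffAt_const.add hs).mul hA').add ((contDiffAt_const.sub hs).mul hB'))
    (ratio_den_pos hz.2.2.1 (g.norm_raise_pos _ hA) (g.norm_raise_pos _ hB)).ne'

theorem norm_half_add_smul_raise_sq (x : E n) {p w : E n} (hp : p ≠ 0) (hw : w ≠ 0) (s : ℝ) :
    g.form x (g.raise x ((1 / 2 * (1 + s)) • p + (1 / 2 * (1 - s)) • w))
      (g.raise x ((1 / 2 * (1 + s)) • p + (1 / 2 * (1 - s)) • w)) =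
    1 / 4 * (((1 + s) * g.norm x (g.raise x p)) ^ 2 + ((1 - s) * g.norm x (g.raise x w)) ^ 2
      + 2 * ((1 + s) * g.norm x (g.raise x p)) * ((1 - s) * g.norm x (g.raise x w))
        * g.cosAngle x p w) := by
  rw [g.raise_add, g.raise_smul, g.raise_smul]
  simp only [map_add, map_smul, add_apply, smul_apply, smul_eq_mul,
    g.symm x (g.raise x w) (g.raise x p), g.form_raise_raise x hp hw, ← g.norm_sq]
  ring

/-- The derivative of `blendMap` in the direction in which only the derivative of `η` moves. -/
theorem RiemannianMetric.norm_fderiv_blendMap (hc : 0 < c) (hz : z ∈ blendDomain Ω c) :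
    ‖fderiv ℝ g.blendMap z (0, 0, 1, 0, 0)‖ =
      Real.arccos ⟪z.2.2.2.1, z.2.2.2.2⟫ / Real.arccos (g.cosAngle z.1 z.2.1 z.2.2.2.2) *
      (g.norm z.1 (g.raise z.1 z.2.1) * g.norm z.1 (g.raise z.1 z.2.2.2.2) *
        √(1 - g.cosAngle z.1 z.2.1 z.2.2.2.2 ^ 2) /
      (2 * g.form z.1
        (g.raise z.1 ((1 / 2 * (1 + z.2.2.1)) • z.2.1 + (1 / 2 * (1 - z.2.2.1)) • z.2.2.2.2))
        (g.raise z.1 ((1 / 2 * (1 + z.2.2.1)) • z.2.1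
          + (1 / 2 * (1 - z.2.2.1)) • z.2.2.2.2)))) := by
  have hA := blendDomain.left_ne_zero hc hz
  have hB := blendDomain.right_ne_zero hc hz
  have hcos := g.cosAngle_sq_lt_one z.1 (blendDomain.inner_sq_lt hc hz)
  have hVW := blendDomain.inner_sq_lt_one hc hz
  have hF := ((g.contDiffAt_blendMap hc hz).differentiableAt (by simp)).hasFDerivAt
  obtain ⟨x, p, s, V, w⟩ := z
  obtain ⟨-, -, hs, hV, hw, -, -⟩ := hz
  dsimp only at hA hB hcos hVW hs hV hw ⊢
  -- Along this line only the ratio varies, so the derivative is the speed of the blend times the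
  -- derivative of the ratio.
  have hline : HasDerivAt (fun t : ℝ => (x, p, t, V, w))
      ((0, 0, 1, 0, 0) : E n × E n × ℝ × E n × E n) s :=
    (hasDerivAt_const s x).prodMk ((hasDerivAt_const s p).prodMk
      ((hasDerivAt_id s).prodMk ((hasDerivAt_const s V).prodMk (hasDerivAt_const s w))))
  have h1 := hF.comp_hasDerivAt s hline
  obtain ⟨y, hy, hynorm⟩ := exists_hasDerivAt_blend hcos hVW hV hw
    (ratio s (g.norm x (g.raise x p)) (g.norm x (g.raise x w)))
  have hr := hasDerivAt_ratio hs (g.norm_raise_pos x hA) (g.norm_raise_pos x hB)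
  have h2 := hy.scomp s hr
  have h3 : fderiv ℝ g.blendMap (x, p, s, V, w) (0, 0, 1, 0, 0) = _ := h1.unique h2
  have hden := ratio_den_pos hs (g.norm_raise_pos x hA) (g.norm_raise_pos x hB)
  have hpA := g.norm_raise_pos x hA
  have hpB := g.norm_raise_pos x hB
  rw [h3, norm_smul, hynorm, norm_half_add_smul_raise_sq g x hA hB,
    ← tan_mul_deriv_ratio hs hpA hpB hcos, Real.norm_of_nonneg (by positivity)]
  ring

/-- Bounds for the metric and for `blendMap`, uniform over `Ω`. -/
structure UniformBounds (Ω : Set (E n)) (c C : ℝ) : Prop where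
  one_le : 1 ≤ C
  norm_le : ∀ x ∈ Ω, ∀ v, ‖v‖ ≤ C * g.norm x v
  norm_fderiv_form_le : ∀ x ∈ Ω, ‖fderiv ℝ g.form x‖ ≤ C
  inv_norm_raise_le : ∀ x ∈ Ω, ∀ p, c ≤ ‖p‖ → ‖p‖ ≤ 1 → (g.norm x (g.raise x p))⁻¹ ≤ C
  norm_raise_le : ∀ x ∈ Ω, ∀ p, c ≤ ‖p‖ → ‖p‖ ≤ 1 → g.norm x (g.raise x p) ≤ C
  inv_one_sub_cosAngle_le : ∀ z ∈ blendDomain Ω c, (1 - g.cosAngle z.1 z.2.1 z.2.2.2.2 ^ 2)⁻¹ ≤ C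
  norm_fderiv_blendMap_le : ∀ z ∈ blendDomain Ω c, ‖fderiv ℝ g.blendMap z‖ ≤ C

theorem exists_uniformBounds (hΩ : IsCompact Ω) (hc : 0 < c) : ∃ C, UniformBounds g Ω c C := by
  have hp0 : ∀ {p : E n}, c ≤ ‖p‖ → p ≠ 0 := fun h => norm_pos_iff.1 (hc.trans_le h)
  obtain ⟨C1, h1⟩ := (hΩ.prod (isCompact_sphere (0 : E n) 1)).exists_bound_of_continuousOn
    (f := fun z => (g.norm z.1 z.2)⁻¹) (by
      intro z hz
      have hz2 : z.2 ≠ 0 := by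
        intro h
        have := hz.2
        simp [h] at this
      exact ((g.contDiffAt_norm contDiffAt_fst contDiffAt_snd hz2).continuousAt.inv₀
        (g.norm_pos hz2).ne').continuousWithinAt)
  obtain ⟨C2, h2⟩ := hΩ.exists_bound_of_continuousOn (f := fderiv ℝ g.form)
    (g.smooth.continuous_fderiv (by simp)).continuousOn
  have hK : IsCompact (Ω ×ˢ (Metric.closedBall (0 : E n) 1 ∩ {p | c ≤ ‖p‖})) :=
    hΩ.prod ((isCompact_closedBall _ _).inter_right (isClosed_le (by fun_prop) (by fun_prop)))
  have hraise : ∀ z ∈ Ω ×ˢ (Metric.closedBall (0 : E n) 1 ∩ {p | c ≤ ‖p‖}),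
      ContinuousAt (fun z : E n × E n => g.norm z.1 (g.raise z.1 z.2)) z := fun z hz =>
    (g.contDiffAt_norm_raise contDiffAt_fst contDiffAt_snd (hp0 hz.2.2)).continuousAt
  obtain ⟨C3, h3⟩ := hK.exists_bound_of_continuousOn
    (f := fun z => g.norm z.1 (g.raise z.1 z.2)) fun z hz => (hraise z hz).continuousWithinAt
  obtain ⟨C4, h4⟩ := hK.exists_bound_of_continuousOn
    (f := fun z => (g.norm z.1 (g.raise z.1 z.2))⁻¹) fun z hz =>
      ((hraise z hz).inv₀ (g.norm_raise_pos _ (hp0 hz.2.2)).ne').continuousWithinAt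
  obtain ⟨C5, h5⟩ := (isCompact_blendDomain hΩ c).exists_bound_of_continuousOn
    (f := fun z => (1 - g.cosAngle z.1 z.2.1 z.2.2.2.2 ^ 2)⁻¹) fun z hz =>
      ((continuousAt_const.sub
        ((g.contDiffAt_cosAngle_blendDomain hc hz).continuousAt.pow 2)).inv₀
        (sub_pos.2 (g.cosAngle_sq_lt_one _ (blendDomain.inner_sq_lt hc hz))).ne').continuousWithinAt
  obtain ⟨C6, h6⟩ := (isCompact_blendDomain hΩ c).exists_bound_of_continuousOn
    (f := fderiv ℝ g.blendMap) fun z hz =>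
      ((g.contDiffAt_blendMap hc hz).fderiv_right (m := ∞)
        (by simp)).continuousAt.continuousWithinAt
  set C := 1 + |C1| + |C2| + |C3| + |C4| + |C5| + |C6|
  have e1 := le_abs_self C1
  have e2 := le_abs_self C2
  have e3 := le_abs_self C3
  have e4 := le_abs_self C4
  have e5 := le_abs_self C5
  have e6 := le_abs_self C6
  have f1 := abs_nonneg C1
  have f2 := abs_nonneg C2
  have f3 := abs_nonneg C3
  have f4 := abs_nonneg C4
  have f5 := abs_nonneg C5
  have f6 := abs_nonneg C6
  have hmem : ∀ {x p : E n}, x ∈ Ω → c ≤ ‖p‖ → ‖p‖ ≤ 1 →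
      (x, p) ∈ Ω ×ˢ (Metric.closedBall (0 : E n) 1 ∩ {p | c ≤ ‖p‖}) := fun hx h h' =>
    ⟨hx, by simpa using h', h⟩
  refine ⟨C, ⟨by linarith, fun x hx v => ?_, fun x hx => (h2 x hx).trans (by linarith),
    fun x hx p h h' => ?_, fun x hx p h h' => ?_, fun z hz => ?_,
    fun z hz => (h6 z hz).trans (by linarith)⟩⟩
  · rcases eq_or_ne v 0 with rfl | hv
    · simp [RiemannianMetric.norm]
    · have hv' := norm_pos_iff.2 hv
      -- By homogeneity the comparison of norms follows from the bound on the unit sphere.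
      have h := h1 (x, ‖v‖⁻¹ • v) ⟨hx, by simp [norm_smul, hv'.ne']⟩
      have hs : g.norm x (‖v‖⁻¹ • v) = ‖v‖⁻¹ * g.norm x v := by
        rw [g.norm_const_smul, abs_of_pos (inv_pos.2 hv')]
      have hpos := g.norm_pos (x := x) hv
      simp only [hs] at h
      rw [Real.norm_of_nonneg (by positivity), mul_inv, inv_inv, ← div_eq_mul_inv,
        div_le_iff₀ hpos] at h
      exact h.trans (by gcongr; linarith)
  · exact (le_abs_self _).trans ((h4 (x, p) (hmem hx h h')).trans (by linarith))
  · exact (le_abs_self _).trans ((h3 (x, p) (hmem hx h h')).trans (by linarith))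
  · exact (le_abs_self _).trans ((h5 z hz).trans (by linarith))

end Raise

/-- If c ≤ t the quotient is at most 1 by monotonicity. Otherwise |arccos'| = 1/√(1 - y²) ≤ √D on
[t, c], the worst case being an endpoint, and arccos c ≥ sin(arccos c) = √(1 - c²) ≥ 1/√D; the two
factors √D multiply to D. -/
theorem arccos_div_arccos_sub_one_le {t c D : ℝ} (ht : t ^ 2 < 1) (hc : c ^ 2 < 1)
    (htD : (1 - t ^ 2)⁻¹ ≤ D) (hcD : (1 - c ^ 2)⁻¹ ≤ D) :
    Real.arccos t / Real.arccos c - 1 ≤ D * max (c - t) 0 := by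
  have hα := arccos_pos_of_sq_lt_one hc
  have hD : 0 < D := (inv_pos.2 (sub_pos.2 hc)).trans_le hcD
  rcases le_or_gt c t with h | h
  · have h1 : Real.arccos t ≤ Real.arccos c := Real.antitone_arccos h
    have h2 : Real.arccos t / Real.arccos c ≤ 1 := (div_le_one hα).2 h1
    have h3 : 0 ≤ D * max (c - t) 0 := mul_nonneg hD.le (le_max_right _ _)
    linarith
  · rw [max_eq_left (by linarith)]
    have hlow : ∀ y : ℝ, y ^ 2 < 1 → (1 - y ^ 2)⁻¹ ≤ D → (√D)⁻¹ ≤ √(1 - y ^ 2) :=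
      fun y hy hyD => by
        rw [← Real.sqrt_inv]
        exact Real.sqrt_le_sqrt (inv_le_of_inv_le₀ (by linarith) hyD)
    have hmem : ∀ y ∈ Set.Icc t c, y ^ 2 < 1 ∧ (1 - y ^ 2)⁻¹ ≤ D := fun y hy => by
      have h1 := abs_lt.1 ((sq_lt_one_iff_abs_lt_one _).1 ht)
      have h2 := abs_lt.1 ((sq_lt_one_iff_abs_lt_one _).1 hc)
      have h3 : y ^ 2 < 1 := (sq_lt_one_iff_abs_lt_one _).2
        (abs_lt.2 ⟨by linarith [hy.1], by linarith [hy.2]⟩)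
      refine ⟨h3, ?_⟩
      rcases le_total 0 y with h | h
      · refine (inv_anti₀ (by linarith) ?_).trans hcD
        nlinarith [hy.2]
      · refine (inv_anti₀ (by linarith) ?_).trans htD
        nlinarith [hy.1]
    have hne : ∀ y ∈ Set.Icc t c, y ≠ -1 ∧ y ≠ 1 := fun y hy => by
      have := (hmem y hy).1
      constructor <;> rintro rfl <;> norm_num at this
    have hmvt := Convex.mul_sub_le_image_sub_of_le_deriv (f := Real.arccos) (C := -√D)
      (convex_Icc t c) Real.continuous_arccos.continuousOn
      (fun y hy => (Real.differentiableAt_arccos.2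
        (hne y (interior_subset hy))).differentiableWithinAt)
      (fun y hy => by
        rw [Real.deriv_arccos]
        have h1 := hmem y (interior_subset hy)
        have h2 := inv_anti₀ (by positivity) (hlow y h1.1 h1.2)
        rw [inv_inv] at h2
        simp only [one_div]
        linarith) t (Set.left_mem_Icc.2 h.le) c (Set.right_mem_Icc.2 h.le) h.le
    have hαlow : (√D)⁻¹ ≤ Real.arccos c := by
      refine (hlow c hc hcD).trans ?_
      rw [← Real.sin_arccos]
      exact Real.sin_le hα.le
    have h4 : (Real.arccos c)⁻¹ ≤ √D := inv_le_of_inv_le₀ (by positivity) hαlow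
    have h5 : Real.arccos t / Real.arccos c - 1 =
        (Real.arccos t - Real.arccos c) * (Real.arccos c)⁻¹ := by
      field_simp
    rw [h5]
    calc _ ≤ (√D * (c - t)) * √D :=
          mul_le_mul (by linarith) h4 (inv_pos.2 hα).le
            (mul_nonneg (Real.sqrt_nonneg _) (by linarith))
      _ = D * (c - t) := by
          rw [mul_right_comm, Real.mul_self_sqrt hD.le]

theorem eq_of_innerSL_eq {n : ℕ} {a b : E n}
    (h : (innerSL ℝ a : E n →L[ℝ] ℝ) = innerSL ℝ b) : a = b :=
  ext_inner_right ℝ fun v => DFunLike.congr_fun h v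

theorem norm_prod_five_le {n : ℕ} {a b d e : E n} {s K : ℝ} (ha : ‖a‖ ≤ K) (hb : ‖b‖ ≤ K)
    (hs : ‖s‖ ≤ K) (hd : ‖d‖ ≤ K) (he : ‖e‖ ≤ K) : ‖(a, b, s, d, e)‖ ≤ K :=
  norm_prod_le_iff.2 ⟨ha, norm_prod_le_iff.2 ⟨hb, norm_prod_le_iff.2 ⟨hs,
    norm_prod_le_iff.2 ⟨hd, he⟩⟩⟩⟩

namespace HalfSpaces

variable {n : ℕ} (P : HalfSpaces n) {η : ℝ → ℝ} {γ lam₀ : ℝ} (g : RiemannianMetric n)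

/-! ### The transition regions -/

/-- The derivative of `η` that enters `û_{k+1}`. -/
def slope (η : ℝ → ℝ) (γ lam₀ : ℝ) (k : ℕ) (x : E n) : ℝ :=
  deriv η (lam γ lam₀ (k + 1) * (P.uhat η γ lam₀ k x - P.u (k + 1) x))

/-- The argument at which `blendMap` gives `N̂_{k+1}`. -/
def blendArg (η : ℝ → ℝ) (γ lam₀ : ℝ) (k : ℕ) (x : E n) : E n × E n × ℝ × E n × E n :=
  (x, P.gradHat η γ lam₀ k x, P.slope η γ lam₀ k x, P.Nhat g η γ lam₀ k x, P.N (k + 1))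

theorem form_unitNormal_uhat (hη : IsSmoothAbs η) (hγ : γ ∈ Set.Ioo (0 : ℝ) (1 / 2))
    (hl : 1 ≤ lam₀) (k m : ℕ) (x : E n) :
    g.form x (g.unitNormal (P.uhat η γ lam₀ k) x) (g.unitNormal (P.u m) x) =
      g.cosAngle x (P.gradHat η γ lam₀ k x) (P.N m) := by
  simp only [RiemannianMetric.unitNormal, RiemannianMetric.grad, P.fderiv_uhat hη hγ hl,
    P.fderiv_u]
  rfl

theorem gradRatio_uhat (hη : IsSmoothAbs η) (hγ : γ ∈ Set.Ioo (0 : ℝ) (1 / 2))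
    (hl : 1 ≤ lam₀) (k : ℕ) (x : E n) :
    g.gradRatio (P.slope η γ lam₀ k x) (P.uhat η γ lam₀ k) (P.u (k + 1)) x =
      ratio (P.slope η γ lam₀ k x) (g.norm x (g.raise x (P.gradHat η γ lam₀ k x)))
        (g.norm x (g.raise x (P.N (k + 1)))) := by
  simp only [RiemannianMetric.gradRatio, RiemannianMetric.grad, P.fderiv_uhat hη hγ hl,
    P.fderiv_u]
  rfl

theorem Nhat_succ_apply (k : ℕ) (x : E n) :
    P.Nhat g η γ lam₀ (k + 1) x =
      if (lam γ lam₀ (k + 1))⁻¹ < P.uhat η γ lam₀ k x - P.u (k + 1) x then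
        P.Nhat g η γ lam₀ k x
      else if P.uhat η γ lam₀ k x - P.u (k + 1) x < -(lam γ lam₀ (k + 1))⁻¹ then
        P.N (k + 1)
      else
        blend
          (g.form x (g.unitNormal (P.uhat η γ lam₀ k) x) (g.unitNormal (P.u (k + 1)) x))
          (g.gradRatio (P.slope η γ lam₀ k x) (P.uhat η γ lam₀ k) (P.u (k + 1)) x)
          (P.Nhat g η γ lam₀ k x) (P.N (k + 1)) :=
  rfl

/-- The three cases in the definition of N̂_{k+1} are one smooth expression wherever the
interpolated vectors are independent: beyond the thresholds the slope is ±1, so the ratio is ±1 and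
the blend returns an endpoint. Smoothness and the chain rule then also hold at the thresholds
themselves. -/
theorem Nhat_succ_eventuallyEq (hη : IsSmoothAbs η) (hγ : γ ∈ Set.Ioo (0 : ℝ) (1 / 2))
    (hl : 1 ≤ lam₀) {k : ℕ} {x : E n} {Ω : Set (E n)} {c : ℝ} (hc : 0 < c)
    (hz : P.blendArg g η γ lam₀ k x ∈ blendDomain Ω c)
    (hN : ContinuousAt (P.Nhat g η γ lam₀ k) x) :
    P.Nhat g η γ lam₀ (k + 1) =ᶠ[nhds x] fun y => g.blendMap (P.blendArg g η γ lam₀ k y) := by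
  have hlam := lam_pos hγ hl (k + 1)
  have hG : ContinuousAt (P.gradHat η γ lam₀ k) x :=
    (P.contDiff_gradHat hη k).continuous.continuousAt
  have c1 : ContinuousAt (fun y => ⟪P.gradHat η γ lam₀ k y, P.N (k + 1)⟫ ^ 2) x :=
    (hG.inner (𝕜 := ℝ) continuousAt_const).pow 2
  have c2 : ContinuousAt (fun y => ‖P.gradHat η γ lam₀ k y‖ ^ 2 * ‖P.N (k + 1)‖ ^ 2) x :=
    (hG.norm.pow 2).mul continuousAt_const
  have c3 : ContinuousAt (fun y => ⟪P.Nhat g η γ lam₀ k y, P.N (k + 1)⟫ ^ 2) x :=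
    (hN.inner (𝕜 := ℝ) continuousAt_const).pow 2
  have h0 := blendDomain.inner_sq_lt hc hz
  have h0' := blendDomain.inner_sq_lt_one hc hz
  simp only [blendArg] at h0 h0'
  have h1 : ∀ᶠ y in nhds x, 0 < ‖P.gradHat η γ lam₀ k y‖ ^ 2 * ‖P.N (k + 1)‖ ^ 2 -
      ⟪P.gradHat η γ lam₀ k y, P.N (k + 1)⟫ ^ 2 :=
    (c2.sub c1).eventually (lt_mem_nhds (sub_pos.2 h0))
  have h2 : ∀ᶠ y in nhds x, ⟪P.Nhat g η γ lam₀ k y, P.N (k + 1)⟫ ^ 2 < 1 :=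
    c3.eventually (gt_mem_nhds h0')
  have hw : P.N (k + 1) ≠ 0 := blendDomain.right_ne_zero hc hz
  filter_upwards [h1, h2] with y hy1 hy2
  rw [sub_pos] at hy1
  have hp : P.gradHat η γ lam₀ k y ≠ 0 := by
    intro h
    simp [h] at hy1
  have hA := (g.norm_raise_pos y hp).ne'
  have hB := (g.norm_raise_pos y hw).ne'
  have hcos := g.cosAngle_sq_lt_one y hy1
  have hmap : g.blendMap (P.blendArg g η γ lam₀ k y) =
      blend (g.cosAngle y (P.gradHat η γ lam₀ k y) (P.N (k + 1)))
        (ratio (P.slope η γ lam₀ k y) (g.norm y (g.raise y (P.gradHat η γ lam₀ k y)))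
          (g.norm y (g.raise y (P.N (k + 1))))) (P.Nhat g η γ lam₀ k y) (P.N (k + 1)) := rfl
  rw [hmap, P.Nhat_succ_apply]
  split_ifs with h h'
  · have ht := mul_lt_mul_of_pos_left h hlam
    rw [mul_inv_cancel₀ hlam.ne'] at ht
    have hr : ratio (P.slope η γ lam₀ k y) (g.norm y (g.raise y (P.gradHat η γ lam₀ k y)))
        (g.norm y (g.raise y (P.N (k + 1)))) = 1 := by
      -- The argument of η exceeds 1, well inside the range t > 1/2 where η' = 1.
      rw [slope, hη.deriv_eq_one (by linarith), ratio, sub_self, zero_mul, sub_zero, add_zero,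
        div_self (mul_ne_zero (by norm_num) hA)]
    rw [hr, blend_one hcos hy2]
  · have ht := mul_lt_mul_of_pos_left h' hlam
    rw [mul_neg, mul_inv_cancel₀ hlam.ne'] at ht
    have hr : ratio (P.slope η γ lam₀ k y) (g.norm y (g.raise y (P.gradHat η γ lam₀ k y)))
        (g.norm y (g.raise y (P.N (k + 1)))) = -1 := by
      rw [slope, hη.deriv_eq_neg_one (by linarith), ratio, add_neg_cancel, zero_mul, zero_sub,
        zero_add, neg_div, div_self (mul_ne_zero (by norm_num) hB)]
    rw [hr, blend_neg_one hcos hy2]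
  · rw [P.form_unitNormal_uhat g hη hγ hl, P.gradRatio_uhat g hη hγ hl]

theorem hasFDerivAt_slope (hη : IsSmoothAbs η) (hγ : γ ∈ Set.Ioo (0 : ℝ) (1 / 2))
    (hl : 1 ≤ lam₀) (k : ℕ) (x : E n) :
    HasFDerivAt (P.slope η γ lam₀ k)
      ((lam γ lam₀ (k + 1) *
        deriv (deriv η) (lam γ lam₀ (k + 1) * (P.uhat η γ lam₀ k x - P.u (k + 1) x))) •
        innerSL ℝ (P.gradHat η γ lam₀ k x - P.N (k + 1))) x :=
  P.hasFDerivAt_deriv_eta hη hγ hl k x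

theorem contDiffAt_Nhat_succ (hη : IsSmoothAbs η) (hγ : γ ∈ Set.Ioo (0 : ℝ) (1 / 2))
    (hl : 1 ≤ lam₀) {k : ℕ} {x : E n} {Ω : Set (E n)} {c : ℝ} (hc : 0 < c)
    (hz : P.blendArg g η γ lam₀ k x ∈ blendDomain Ω c)
    (hN : ContDiffAt ℝ ∞ (P.Nhat g η γ lam₀ k) x) :
    ContDiffAt ℝ ∞ (P.Nhat g η γ lam₀ (k + 1)) x := by
  refine ContDiffAt.congr_of_eventuallyEq ?_
    (P.Nhat_succ_eventuallyEq g hη hγ hl hc hz hN.continuousAt)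
  have hs : ContDiffAt ℝ ∞ (P.slope η γ lam₀ k) x :=
    (hη.contDiff_deriv.comp (contDiff_const.mul
      ((P.contDiff_uhat hη k).sub (P.contDiff_u _)))).contDiffAt
  exact (g.contDiffAt_blendMap hc hz).comp x (contDiffAt_id.prodMk
    ((P.contDiff_gradHat hη k).contDiffAt.prodMk (hs.prodMk (hN.prodMk contDiffAt_const))))

theorem fderiv_Nhat_succ (hη : IsSmoothAbs η) (hγ : γ ∈ Set.Ioo (0 : ℝ) (1 / 2))
    (hl : 1 ≤ lam₀) {k : ℕ} {x : E n} {Ω : Set (E n)} {c : ℝ} (hc : 0 < c)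
    (hz : P.blendArg g η γ lam₀ k x ∈ blendDomain Ω c)
    (hN : ContDiffAt ℝ ∞ (P.Nhat g η γ lam₀ k) x) (ξ : E n) :
    fderiv ℝ (P.Nhat g η γ lam₀ (k + 1)) x ξ =
      fderiv ℝ g.blendMap (P.blendArg g η γ lam₀ k x)
        (ξ, fderiv ℝ (P.gradHat η γ lam₀ k) x ξ,
          lam γ lam₀ (k + 1) *
            deriv (deriv η) (lam γ lam₀ (k + 1) * (P.uhat η γ lam₀ k x - P.u (k + 1) x)) *
            ⟪P.gradHat η γ lam₀ k x - P.N (k + 1), ξ⟫,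
          fderiv ℝ (P.Nhat g η γ lam₀ k) x ξ, 0) := by
  have harg := (hasFDerivAt_id x).prodMk ((P.hasFDerivAt_gradHat hη (γ := γ) (lam₀ := lam₀)
    k x).prodMk ((P.hasFDerivAt_slope hη hγ hl k x).prodMk
      ((hN.differentiableAt (by simp)).hasFDerivAt.prodMk (hasFDerivAt_const (P.N (k + 1)) x))))
  have hF := ((g.contDiffAt_blendMap hc hz).differentiableAt (by simp)).hasFDerivAt.comp x harg
  rw [(P.Nhat_succ_eventuallyEq g hη hγ hl hc hz hN.continuousAt).fderiv_eq]
  have hF' : HasFDerivAt (fun y => g.blendMap (P.blendArg g η γ lam₀ k y)) _ x := hF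
  rw [hF'.fderiv]
  simp [inner_sub_left]

/-! ### The cones spanned by the active normals -/

/-- Uniform transversality of the faces of `Ω` that come within `ε` of a common point. -/
structure ConeBounds (y : E n) (κ R ε : ℝ) : Prop where
  pos : 0 < κ
  le : κ ≤ R
  eps_pos : 0 < ε
  dist_le : ∀ x ∈ P.Omega, ‖x - y‖ ≤ R
  le_inner : ∀ x ∈ P.Omega, ∀ m ≤ P.q, -ε ≤ P.u m x → κ ≤ ⟪P.N m, x - y⟫
  inner_nonpos : ∀ x ∈ P.Omega, ∀ j k, j < k → k ≤ P.q → -ε ≤ P.u j x → -ε ≤ P.u k x →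
    ⟪P.N j, P.N k⟫ ≤ 0

/-- The vector `p` points out of `Ω`, and away from the later faces near `x`. -/
def InCone (y : E n) (κ ε : ℝ) (k : ℕ) (x p : E n) : Prop :=
  κ ≤ ⟪p, x - y⟫ ∧ ∀ l, k < l → l ≤ P.q → -ε ≤ P.u l x → ⟪p, P.N l⟫ ≤ 0

variable {P}

theorem InCone.mono {y : E n} {κ ε : ℝ} {k l : ℕ} {x p : E n} (h : P.InCone y κ ε k x p)
    (hkl : k ≤ l) : P.InCone y κ ε l x p :=
  ⟨h.1, fun m hm => h.2 m (by omega)⟩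

theorem ConeBounds.inCone_N {y : E n} {κ R ε : ℝ} (hB : P.ConeBounds y κ R ε) {k : ℕ} {x : E n}
    (hx : x ∈ P.Omega) (hk : k ≤ P.q) (hu : -ε ≤ P.u k x) : P.InCone y κ ε k x (P.N k) :=
  ⟨hB.le_inner x hx k hk hu, fun l hl hlq hul => hB.inner_nonpos x hx k l hl hlq hu hul⟩

/-- Total weight at least 1 preserves the bound κ. Gradients are combined with weights (1 ± s)/2 of
sum 1, and blends with weights from `exists_blend_eq`. -/
theorem InCone.combine {y : E n} {κ ε : ℝ} {k : ℕ} {x p w : E n} (hκ : 0 < κ)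
    (hp : P.InCone y κ ε k x p) (hw : P.InCone y κ ε k x w) {a b : ℝ} (ha : 0 ≤ a) (hb : 0 ≤ b)
    (hab : 1 ≤ a + b) : P.InCone y κ ε k x (a • p + b • w) := by
  refine ⟨?_, fun l hl hlq hul => ?_⟩
  · rw [inner_add_left, inner_smul_left, inner_smul_left]
    have h1 := mul_le_mul_of_nonneg_left hp.1 ha
    have h2 := mul_le_mul_of_nonneg_left hw.1 hb
    have h3 := mul_le_mul_of_nonneg_right hab hκ.le
    simp only [conj_trivial]
    linarith
  · rw [inner_add_left, inner_smul_left, inner_smul_left]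
    have h1 := mul_nonpos_of_nonneg_of_nonpos ha (hp.2 l hl hlq hul)
    have h2 := mul_nonpos_of_nonneg_of_nonpos hb (hw.2 l hl hlq hul)
    simp only [conj_trivial]
    linarith

theorem InCone.le_norm {y : E n} {κ R ε : ℝ} (hB : P.ConeBounds y κ R ε) {k : ℕ} {x p : E n}
    (hx : x ∈ P.Omega) (hp : P.InCone y κ ε k x p) : κ / R ≤ ‖p‖ := by
  rw [div_le_iff₀ (hB.pos.trans_le hB.le)]
  exact hp.1.trans ((real_inner_le_norm _ _).trans
    (mul_le_mul_of_nonneg_left (hB.dist_le x hx) (norm_nonneg _)))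

/-- Two vectors that point out of `Ω` and enclose an obtuse angle are uniformly independent. -/
theorem InCone.gram_le {y : E n} {κ R ε : ℝ} (hB : P.ConeBounds y κ R ε)
    (hunit : ∀ k ≤ P.q, ‖P.N k‖ = 1) {k : ℕ} {x p : E n} (hx : x ∈ P.Omega)
    (hp : P.InCone y κ ε k x p) (hk : k + 1 ≤ P.q) (hu : -ε ≤ P.u (k + 1) x) :
    (κ / R) ^ 2 ≤ ‖p‖ ^ 2 - ⟪p, P.N (k + 1)⟫ ^ 2 := by
  have h0 := hp.2 (k + 1) (by omega) hk hu
  -- Projecting p off N_{k+1} adds a nonnegative multiple of N_{k+1}, because ⟨p, N_{k+1}⟩ ≤ 0. The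
  -- projection thus has norm at least κ/R, and its square is the Gram determinant.
  have h1 : P.InCone y κ ε (k + 1) x (1 • p + (-⟪p, P.N (k + 1)⟫) • P.N (k + 1)) := by
    have := (hp.mono (Nat.le_succ k)).combine (a := 1) hB.pos (hB.inCone_N hx hk hu) zero_le_one
      (neg_nonneg.2 h0) (by linarith)
    simpa using this
  have hκR : 0 ≤ κ / R := div_nonneg hB.pos.le (hB.pos.le.trans hB.le)
  refine (pow_le_pow_left₀ hκR (h1.le_norm hB hx) 2).trans (le_of_eq ?_)
  rw [one_smul, norm_add_sq_real, norm_smul, inner_smul_right, hunit (k + 1) hk, mul_one,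
    Real.norm_eq_abs, sq_abs]
  ring

theorem abs_slope_le_one (hη : IsSmoothAbs η) (k : ℕ) (x : E n) :
    |P.slope η γ lam₀ k x| ≤ 1 :=
  hη.abs_deriv_le_one _

theorem blendArg_mem {y : E n} {κ R ε : ℝ} (hη : IsSmoothAbs η)
    (hunit : ∀ k ≤ P.q, ‖P.N k‖ = 1) (hB : P.ConeBounds y κ R ε) {k : ℕ} {x : E n}
    (hx : x ∈ P.Omega) (hk : k + 1 ≤ P.q) (hu : -ε ≤ P.u (k + 1) x)
    (hG : P.InCone y κ ε k x (P.gradHat η γ lam₀ k x))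
    (hN : P.InCone y κ ε k x (P.Nhat g η γ lam₀ k x)) (hN1 : ‖P.Nhat g η γ lam₀ k x‖ = 1) :
    P.blendArg g η γ lam₀ k x ∈ blendDomain P.Omega ((κ / R) ^ 2) := by
  refine ⟨hx, P.norm_gradHat_le hη hunit (by omega) x, abs_slope_le_one hη k x, hN1,
    hunit (k + 1) hk, hG.gram_le hB hunit hx hk hu, ?_⟩
  have := hN.gram_le hB hunit hx hk hu
  rwa [hN1, one_pow] at this

/-- The vector field `N̂_k` and the gradient of `û_k` at the points where `û_k` is nearly `0`. -/
structure Controlled (y : E n) (κ ε C : ℝ) (η : ℝ → ℝ) (γ lam₀ : ℝ) (k : ℕ) (x : E n) : Prop where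
  grad_mem : P.InCone y κ ε k x (P.gradHat η γ lam₀ k x)
  Nhat_mem : P.InCone y κ ε k x (P.Nhat g η γ lam₀ k x)
  norm_Nhat : ‖P.Nhat g η γ lam₀ k x‖ = 1
  contDiffAt : ContDiffAt ℝ ∞ (P.Nhat g η γ lam₀ k) x
  norm_fderiv_le : ‖fderiv ℝ (P.Nhat g η γ lam₀ k) x‖ ≤ C * lam γ lam₀ k

/-- Induction on k. Where û_{k+1} is locally û_k or u_{k+1}, everything is inherited from that
function. In the transition region the new gradient and N̂_{k+1} are combinations of cone vectors,
and the derivative is estimated by the chain rule through `blendMap`. The threshold rises by 2/λ₀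
per step, the loss in `uhat_succ_sub_le`, so that û_k and u_{k+1} are themselves close enough to 0.
-/
theorem exists_controlled {y : E n} {κ R ε C₀ : ℝ} (hη : IsSmoothAbs η)
    (hunit : ∀ k ≤ P.q, ‖P.N k‖ = 1) (hB : P.ConeBounds y κ R ε)
    (hU : UniformBounds g P.Omega ((κ / R) ^ 2) C₀) {k : ℕ} (hk : k ≤ P.q) :
    ∃ C, 0 ≤ C ∧ ∀ γ ∈ Set.Ioo (0 : ℝ) (1 / 2), ∀ lam₀, 1 ≤ lam₀ → ∀ x ∈ P.Omega,
      -ε + k * (2 * lam₀⁻¹) ≤ P.uhat η γ lam₀ k x →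
      Controlled (P := P) g y κ ε C η γ lam₀ k x := by
  have hc : 0 < (κ / R) ^ 2 := pow_pos (div_pos hB.pos (hB.pos.trans_le hB.le)) 2
  induction k with
  | zero =>
    refine ⟨0, le_rfl, fun γ _ lam₀ _ x hx hu => ?_⟩
    have hu' : -ε ≤ P.u 0 x := by simpa [uhat] using hu
    refine ⟨hB.inCone_N hx hk hu', hB.inCone_N hx hk hu', hunit 0 hk, contDiffAt_const, ?_⟩
    have : P.Nhat g η γ lam₀ 0 = fun _ => P.N 0 := rfl
    simp [this]
  | succ k ih =>
    obtain ⟨C, hC, ih⟩ := ih (by omega)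
    obtain ⟨CG, hCG, hG⟩ := P.exists_norm_fderiv_gradHat_le hη hunit (by omega : k ≤ P.q)
    obtain ⟨M, hM, hM'⟩ := hη.exists_abs_deriv_deriv_le
    have hC₀ : 0 ≤ C₀ := zero_le_one.trans hU.one_le
    refine ⟨C + C₀ * (1 + CG + 2 * M + C), by positivity, fun γ hγ lam₀ hl x hx hu => ?_⟩
    have hlam := lam_pos hγ hl (k + 1)
    have hlam' := lam_le_lam_succ hγ hl k
    have hlamk := lam_pos hγ hl k
    have hl0 : 0 < lam₀⁻¹ := inv_pos.2 (by linarith)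
    have hCC : C ≤ C + C₀ * (1 + CG + 2 * M + C) := by
      have : 0 ≤ C₀ * (1 + CG + 2 * M + C) := by positivity
      linarith
    push_cast at hu
    rcases lt_or_ge (lam γ lam₀ (k + 1))⁻¹ (P.uhat η γ lam₀ k x - P.u (k + 1) x) with h | h
    · have hgerm := P.uhat_succ_eventuallyEq_uhat hη hγ hl g h
      have hI := ih γ hγ lam₀ hl x hx (by rw [← hgerm.1.self_of_nhds]; linarith)
      have hGeq : P.gradHat η γ lam₀ (k + 1) x = P.gradHat η γ lam₀ k x := by
        have h1 := hgerm.1.fderiv_eq (𝕜 := ℝ)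
        rw [P.fderiv_uhat hη hγ hl, P.fderiv_uhat hη hγ hl] at h1
        exact eq_of_innerSL_eq h1
      refine ⟨?_, ?_, ?_, hI.contDiffAt.congr_of_eventuallyEq hgerm.2, ?_⟩
      · rw [hGeq]
        exact hI.grad_mem.mono (Nat.le_succ k)
      · rw [hgerm.2.self_of_nhds]
        exact hI.Nhat_mem.mono (Nat.le_succ k)
      · rw [hgerm.2.self_of_nhds]
        exact hI.norm_Nhat
      · rw [hgerm.2.fderiv_eq]
        exact hI.norm_fderiv_le.trans (mul_le_mul hCC hlam' (lam_pos hγ hl k).le (by positivity))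
    rcases lt_or_ge (P.uhat η γ lam₀ k x - P.u (k + 1) x) (-(lam γ lam₀ (k + 1))⁻¹) with h' | h'
    · have hgerm := P.uhat_succ_eventuallyEq_u hη hγ hl g h'
      have hu' : -ε ≤ P.u (k + 1) x := by
        rw [← hgerm.1.self_of_nhds]
        have : 0 ≤ ((k : ℝ) + 1) * (2 * lam₀⁻¹) := by positivity
        linarith
      have hcone := hB.inCone_N hx hk hu'
      have hGeq : P.gradHat η γ lam₀ (k + 1) x = P.N (k + 1) := by
        have h1 := hgerm.1.fderiv_eq (𝕜 := ℝ)
        rw [P.fderiv_uhat hη hγ hl, P.fderiv_u] at h1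
        exact eq_of_innerSL_eq h1
      refine ⟨?_, ?_, ?_, contDiffAt_const.congr_of_eventuallyEq hgerm.2, ?_⟩
      · rwa [hGeq]
      · rwa [hgerm.2.self_of_nhds]
      · rw [hgerm.2.self_of_nhds]
        exact hunit (k + 1) hk
      · rw [hgerm.2.fderiv_eq]
        simp only [fderiv_fun_const, Pi.zero_apply, _root_.norm_zero]
        positivity
    have hclose := P.uhat_succ_sub_le hη hγ hl (abs_le.2 ⟨h', h⟩)
    have hk0 : (0 : ℝ) ≤ k * (2 * lam₀⁻¹) := by positivity
    have hI := ih γ hγ lam₀ hl x hx (by linarith)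
    have hu' : -ε ≤ P.u (k + 1) x := by linarith
    have hz := blendArg_mem g hη hunit hB hx hk hu' hI.grad_mem hI.Nhat_mem hI.norm_Nhat
    have hcone := hB.inCone_N hx hk hu'
    have hs := abs_le.1 (abs_slope_le_one (P := P) hη (γ := γ) (lam₀ := lam₀) k x)
    have hNeq : P.Nhat g η γ lam₀ (k + 1) x = g.blendMap (P.blendArg g η γ lam₀ k x) := (P.Nhat_succ_eventuallyEq g hη hγ hl hc hz
      hI.contDiffAt.continuousAt).self_of_nhds
    have hcos := g.cosAngle_sq_lt_one x (blendDomain.inner_sq_lt hc hz)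
    have hVW := blendDomain.inner_sq_lt_one hc hz
    have hr := abs_ratio_le_one (abs_slope_le_one (P := P) hη (γ := γ) (lam₀ := lam₀) k x)
      (g.norm_raise_pos x (blendDomain.left_ne_zero hc hz))
      (g.norm_raise_pos x (blendDomain.right_ne_zero hc hz))
    refine ⟨?_, ?_, ?_, P.contDiffAt_Nhat_succ g hη hγ hl hc hz hI.contDiffAt, ?_⟩
    · exact (hI.grad_mem.mono (Nat.le_succ k)).combine hB.pos hcone
        (show 0 ≤ 1 / 2 * (1 + P.slope η γ lam₀ k x) by linarith)
        (show 0 ≤ 1 / 2 * (1 - P.slope η γ lam₀ k x) by linarith) (by linarith)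
    · rw [hNeq]
      obtain ⟨a, b, ha, hb, hab, heq⟩ := exists_blend_eq hcos hVW hI.norm_Nhat
        (hunit (k + 1) hk) hr
      have hmap : g.blendMap (P.blendArg g η γ lam₀ k x) =
          a • P.Nhat g η γ lam₀ k x + b • P.N (k + 1) := heq
      rw [hmap]
      exact (hI.Nhat_mem.mono (Nat.le_succ k)).combine hB.pos hcone ha hb hab
    · rw [hNeq]
      exact norm_blend hcos hVW hI.norm_Nhat (hunit (k + 1) hk) _
    · refine ContinuousLinearMap.opNorm_le_bound _ (by positivity) fun ξ => ?_
      rw [P.fderiv_Nhat_succ g hη hγ hl hc hz hI.contDiffAt]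
      have h1 : (1 : ℝ) ≤ lam γ lam₀ (k + 1) := hl.trans (le_lam hγ hl _)
      have hη0 := hη.convex
        (lam γ lam₀ (k + 1) * (P.uhat η γ lam₀ k x - P.u (k + 1) x))
      have hη1 := hM' (lam γ lam₀ (k + 1) * (P.uhat η γ lam₀ k x - P.u (k + 1) x))
      have hX : ‖P.gradHat η γ lam₀ k x - P.N (k + 1)‖ ≤ 2 := by
        refine (norm_sub_le _ _).trans ?_
        linarith [P.norm_gradHat_le hη hunit (γ := γ) (lam₀ := lam₀) (by omega : k ≤ P.q) x,
          hunit (k + 1) hk]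
      -- The summands 1, CG, 2M and C bound the four moving components in turn, each relative to
      -- λ_{k+1} ≥ 1.
      have harg : ‖((ξ, fderiv ℝ (P.gradHat η γ lam₀ k) x ξ,
          lam γ lam₀ (k + 1) *
            deriv (deriv η) (lam γ lam₀ (k + 1) * (P.uhat η γ lam₀ k x - P.u (k + 1) x)) *
            ⟪P.gradHat η γ lam₀ k x - P.N (k + 1), ξ⟫,
          fderiv ℝ (P.Nhat g η γ lam₀ k) x ξ, 0) : E n × E n × ℝ × E n × E n)‖ ≤
          (1 + CG + 2 * M + C) * lam γ lam₀ (k + 1) * ‖ξ‖ := by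
        refine norm_prod_five_le ?_ ?_ ?_ ?_ ?_
        · calc ‖ξ‖ = 1 * 1 * ‖ξ‖ := by ring
            _ ≤ _ := by gcongr; linarith
        · refine (ContinuousLinearMap.le_opNorm _ _).trans ?_
          gcongr
          refine (hG γ hγ lam₀ hl x).trans ?_
          gcongr
          linarith
        · rw [norm_mul, Real.norm_of_nonneg (by positivity)]
          calc _ ≤ lam γ lam₀ (k + 1) * M * (2 * ‖ξ‖) := by
                gcongr
                exact (norm_inner_le_norm _ _).trans (by gcongr)
            _ = 2 * M * lam γ lam₀ (k + 1) * ‖ξ‖ := by ring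
            _ ≤ _ := by gcongr; linarith
        · refine (ContinuousLinearMap.le_opNorm _ _).trans ?_
          gcongr
          refine hI.norm_fderiv_le.trans ?_
          gcongr
          linarith
        · rw [_root_.norm_zero]
          positivity
      refine (ContinuousLinearMap.le_opNorm _ _).trans ?_
      calc _ ≤ C₀ * ((1 + CG + 2 * M + C) * lam γ lam₀ (k + 1) * ‖ξ‖) := by
            gcongr
            exact hU.norm_fderiv_blendMap_le _ hz
        _ = C₀ * (1 + CG + 2 * M + C) * lam γ lam₀ (k + 1) * ‖ξ‖ := by ring
        _ ≤ _ := by gcongr; linarith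

end HalfSpaces

/-! ### Locality and first bounds for the curvature and the trace norm -/

section Local

variable {n : ℕ} (g : RiemannianMetric n)

theorem RiemannianMetric.unitNormal_eventuallyEq {f h : E n → ℝ} {x : E n}
    (hfh : f =ᶠ[nhds x] h) : g.unitNormal f =ᶠ[nhds x] g.unitNormal h := by
  filter_upwards [hfh.fderiv (𝕜 := ℝ)] with y hy
  simp only [unitNormal, grad, hy]

theorem RiemannianMetric.meanCurvature_congr {f h : E n → ℝ} {x : E n} (hfh : f =ᶠ[nhds x] h) :
    g.meanCurvature f x = g.meanCurvature h x := by
  have h1 := g.unitNormal_eventuallyEq hfh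
  simp only [meanCurvature, covDeriv, tangentProj, h1.self_of_nhds, h1.fderiv_eq]

theorem RiemannianMetric.traceNormOnLevelSet_congr {f h : E n → ℝ} {F G : E n → E n} {x : E n}
    (hfh : f =ᶠ[nhds x] h) (hFG : F =ᶠ[nhds x] G) :
    g.traceNormOnLevelSet f F x = g.traceNormOnLevelSet h G x := by
  simp only [traceNormOnLevelSet, tangentProj, (g.unitNormal_eventuallyEq hfh).self_of_nhds,
    hFG.fderiv_eq]

variable {g} {Ω : Set (E n)} {c C : ℝ}

theorem UniformBounds.norm_tangentProj_le (hU : UniformBounds g Ω c C) {f : E n → ℝ} {x : E n}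
    (hx : x ∈ Ω) (hf : g.grad f x ≠ 0) (v : E n) : ‖g.tangentProj f x v‖ ≤ C * g.norm x v :=
  (hU.norm_le x hx _).trans
    (mul_le_mul_of_nonneg_left (g.norm_tangentProj_le f hf v) (zero_le_one.trans hU.one_le))

theorem UniformBounds.traceNormOnLevelSet_le (hU : UniformBounds g Ω c C) {f : E n → ℝ}
    {F : E n → E n} {x : E n} (hx : x ∈ Ω) (hf : g.grad f x ≠ 0) {Λ : ℝ}
    (hF : ‖fderiv ℝ F x‖ ≤ Λ) : g.traceNormOnLevelSet f F x ≤ n * (Λ * C) := by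
  have hΛ : 0 ≤ Λ := (norm_nonneg _).trans hF
  have h := g.traceNormOnLevelSet_le f F x 0 0 (fun v => fderiv ℝ F x (g.tangentProj f x v))
    (Λ * C) (fun v => by simp) (fun v => by
      refine (ContinuousLinearMap.le_opNorm _ _).trans ?_
      rw [mul_assoc]
      exact mul_le_mul hF (hU.norm_tangentProj_le hx hf v) (norm_nonneg _) hΛ)
  simpa using h

/-- On tangent vectors ⟨X, ·⟩ is represented by the projection of `raise X`, so the rank-one lower
bound for the Hessian passes to the trace. In C⁴ one factor comes from the derivative of the metric,
one from the unit normal and two from the Euclidean length of the tangent vector. -/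
theorem UniformBounds.le_meanCurvature (hU : UniformBounds g Ω c C) {f : E n → ℝ}
    (hf : ContDiff ℝ ∞ f) {x : E n} (hx : x ∈ Ω) (h0 : fderiv ℝ f x ≠ 0) (X : E n) (b : ℝ)
    (hb : ∀ ξ, b * ⟪X, ξ⟫ ^ 2 ≤ fderiv ℝ (fderiv ℝ f) x ξ ξ) :
    (g.norm x (g.grad f x))⁻¹ * b *
        g.form x (g.tangentProj f x (g.raise x X)) (g.tangentProj f x (g.raise x X))
      - n * (3 / 2 * C ^ 4) ≤ g.meanCurvature f x := by
  have hg := g.grad_ne_zero h0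
  have hC : 0 ≤ C := zero_le_one.trans hU.one_le
  refine g.le_meanCurvature f hg _ _ _ fun v => ?_
  set ξ := g.tangentProj f x v with hξ
  refine le_trans ?_ (g.le_form_covDeriv_unitNormal hf h0 ξ
    (g.form_unitNormal_tangentProj f hg v))
  have h1 : g.form x (g.tangentProj f x (g.raise x X)) v = ⟪X, ξ⟫ := by
    rw [g.form_tangentProj, g.form_raise]
  have hν : ‖g.unitNormal f x‖ ≤ C := by
    have h2 := hU.norm_le x hx (g.unitNormal f x)
    rwa [RiemannianMetric.norm, g.form_unitNormal_self f hg, Real.sqrt_one, mul_one] at h2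
  have h3 : ‖ξ‖ ^ 2 ≤ C ^ 2 * g.form x v v := by
    rw [← g.norm_sq, ← mul_pow]
    exact pow_le_pow_left₀ (norm_nonneg _) (hU.norm_tangentProj_le hx hg v) 2
  have h4 : ‖fderiv ℝ g.form x‖ * ‖g.unitNormal f x‖ * ‖ξ‖ ^ 2 ≤
      C * C * (C ^ 2 * g.form x v v) := by
    gcongr
    exact hU.norm_fderiv_form_le x hx
  have h5 := mul_le_mul_of_nonneg_left (hb ξ) (inv_nonneg.2 (g.norm_nonneg x (g.grad f x)))
  rw [h1]
  linarith

/-- The tangential part of the difference of two gradients, on a level set whose normal is a convex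
combination of them. -/
theorem RiemannianMetric.norm_tangentProj_raise_sub (g : RiemannianMetric n) {f : E n → ℝ}
    {x p w : E n} {s : ℝ} (hp : p ≠ 0) (hw : w ≠ 0)
    (hf : g.grad f x = g.raise x ((1 / 2 * (1 + s)) • p + (1 / 2 * (1 - s)) • w))
    (hf0 : g.grad f x ≠ 0) :
    g.norm x (g.tangentProj f x (g.raise x (p - w))) =
      g.norm x (g.raise x p) * g.norm x (g.raise x w) * √(1 - g.cosAngle x p w ^ 2) /
        g.norm x (g.grad f x) := by
  have hA := g.norm_raise_pos x hp
  have hB := g.norm_raise_pos x hw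
  have hD := g.norm_pos (x := x) hf0
  have hUU := g.norm_sq x (g.grad f x)
  have hνX : g.form x (g.unitNormal f x) (g.raise x (p - w)) =
      (g.norm x (g.grad f x))⁻¹ * g.form x (g.grad f x) (g.raise x (p - w)) := by
    simp [unitNormal]
  rw [norm, g.form_tangentProj_self f hf0, hνX]
  set D := g.norm x (g.grad f x)
  have key : g.form x (g.raise x (p - w)) (g.raise x (p - w)) -
      (D⁻¹ * g.form x (g.grad f x) (g.raise x (p - w))) ^ 2 =
      (g.norm x (g.raise x p) * g.norm x (g.raise x w) / D) ^ 2 *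
        (1 - g.cosAngle x p w ^ 2) := by
    -- The Gram determinant of ∇f and p - w equals that of p and w, since the coefficient matrix
    -- with rows ((1+s)/2, (1-s)/2) and (1, -1) has determinant -1.
    have h1 : g.form x (g.raise x (p - w)) (g.raise x (p - w)) * D ^ 2 -
        g.form x (g.grad f x) (g.raise x (p - w)) ^ 2 =
        (g.norm x (g.raise x p) * g.norm x (g.raise x w)) ^ 2 *
          (1 - g.cosAngle x p w ^ 2) := by
      rw [hUU, hf, g.raise_add, g.raise_smul, g.raise_smul, g.raise_sub]
      simp only [map_add, map_smul, map_sub, add_apply, sub_apply, smul_apply, smul_eq_mul,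
        g.symm x (g.raise x w) (g.raise x p), g.form_raise_raise x hp hw, ← g.norm_sq]
      ring
    rw [div_pow, div_mul_eq_mul_div, ← h1]
    field_simp
  rw [key, Real.sqrt_mul (by positivity), Real.sqrt_sq (by positivity)]
  ring

end Local

/-! ### The comparison of mean curvature and trace norm in a transition region -/

namespace HalfSpaces

variable {n : ℕ} {P : HalfSpaces n} {η : ℝ → ℝ} {γ lam₀ : ℝ} {g : RiemannianMetric n}

theorem grad_uhat (hη : IsSmoothAbs η) (hγ : γ ∈ Set.Ioo (0 : ℝ) (1 / 2))
    (hl : 1 ≤ lam₀) (k : ℕ) (x : E n) :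
    g.grad (P.uhat η γ lam₀ k) x = g.raise x (P.gradHat η γ lam₀ k x) := by
  rw [RiemannianMetric.grad, P.fderiv_uhat hη hγ hl]
  rfl

theorem fderiv_uhat_ne_zero (hη : IsSmoothAbs η) (hγ : γ ∈ Set.Ioo (0 : ℝ) (1 / 2))
    (hl : 1 ≤ lam₀) {k : ℕ} {x : E n} (h : P.gradHat η γ lam₀ k x ≠ 0) :
    fderiv ℝ (P.uhat η γ lam₀ k) x ≠ 0 := by
  rw [P.fderiv_uhat hη hγ hl]
  intro h0
  exact h (eq_of_innerSL_eq (h0.trans (map_zero _).symm))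

theorem InCone.ne_zero {y : E n} {κ R ε : ℝ} (hB : P.ConeBounds y κ R ε) {k : ℕ} {x p : E n}
    (hx : x ∈ P.Omega) (hp : P.InCone y κ ε k x p) : p ≠ 0 :=
  norm_pos_iff.1 ((div_pos hB.pos (hB.pos.trans_le hB.le)).trans_le (hp.le_norm hB hx))

theorem ConeBounds.sq_le {y : E n} {κ R ε : ℝ} (hB : P.ConeBounds y κ R ε) :
    (κ / R) ^ 2 ≤ κ / R := by
  have h1 : 0 ≤ κ / R := div_nonneg hB.pos.le (hB.pos.le.trans hB.le)
  have h2 : κ / R ≤ 1 := (div_le_one (hB.pos.trans_le hB.le)).2 hB.le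
  nlinarith

theorem ConeBounds.sq_pos {y : E n} {κ R ε : ℝ} (hB : P.ConeBounds y κ R ε) :
    0 < (κ / R) ^ 2 :=
  pow_pos (div_pos hB.pos (hB.pos.trans_le hB.le)) 2

/-- With e = h|z|²/(2D), the large part of the curvature is e and the large part of the trace norm
is eθ. Only e(θ - 1) is left, where e = O(λ_{k+1}) and θ - 1 is bounded through the difference of
cosines. All other terms are O(Λ). -/
theorem transition_estimate {y : E n} {κ R ε C₀ C M : ℝ} (hη : IsSmoothAbs η)
    (hunit : ∀ k ≤ P.q, ‖P.N k‖ = 1) (hB : P.ConeBounds y κ R ε)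
    (hU : UniformBounds g P.Omega ((κ / R) ^ 2) C₀)
    (hM : ∀ t, deriv (deriv η) t ≤ M) (hγ : γ ∈ Set.Ioo (0 : ℝ) (1 / 2)) (hl : 1 ≤ lam₀)
    {k : ℕ} (hk : k + 1 ≤ P.q) {x : E n} (hx : x ∈ P.Omega) (hu : -ε ≤ P.u (k + 1) x)
    (hI : Controlled (P := P) g y κ ε C η γ lam₀ k x)
    (hI' : P.InCone y κ ε (k + 1) x (P.gradHat η γ lam₀ (k + 1) x)) {Λ : ℝ} (hΛ : 1 ≤ Λ)
    (hΛG : ‖fderiv ℝ (P.gradHat η γ lam₀ k) x‖ ≤ Λ)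
    (hΛN : ‖fderiv ℝ (P.Nhat g η γ lam₀ k) x‖ ≤ Λ) :
    -(M * C₀ ^ 7 * (C₀ + ((κ / R) ^ 2)⁻¹)) * lam γ lam₀ (k + 1) *
        max (g.cosAngle x (P.gradHat η γ lam₀ k x) (P.N (k + 1))
          - ⟪P.Nhat g η γ lam₀ k x, P.N (k + 1)⟫) 0 - (n * (3 / 2 * C₀ ^ 4) + n * (C₀ * C₀)) * Λ
      ≤ g.meanCurvature (P.uhat η γ lam₀ (k + 1)) x
        - g.traceNormOnLevelSet (P.uhat η γ lam₀ (k + 1)) (P.Nhat g η γ lam₀ (k + 1)) x := by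
  have hc := hB.sq_pos
  have hz := blendArg_mem g hη hunit hB hx hk hu hI.grad_mem hI.Nhat_mem hI.norm_Nhat
  have hlam := lam_pos hγ hl (k + 1)
  have hC₀ : 0 ≤ C₀ := zero_le_one.trans hU.one_le
  have hp := hI.grad_mem.ne_zero hB hx
  have hw : P.N (k + 1) ≠ 0 := norm_pos_iff.1 (by rw [hunit (k + 1) hk]; exact one_pos)
  have hG0 := hI'.ne_zero hB hx
  have hf0 := fderiv_uhat_ne_zero hη hγ hl hG0
  have hgrad0 := g.grad_ne_zero hf0
  have hgrad : g.grad (P.uhat η γ lam₀ (k + 1)) x =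
      g.raise x ((1 / 2 * (1 + P.slope η γ lam₀ k x)) • P.gradHat η γ lam₀ k x +
        (1 / 2 * (1 - P.slope η γ lam₀ k x)) • P.N (k + 1)) := grad_uhat hη hγ hl (k + 1) x
  have hcos := g.cosAngle_sq_lt_one x (blendDomain.inner_sq_lt hc hz)
  have hVW := blendDomain.inner_sq_lt_one hc hz
  have hcosinv := hU.inv_one_sub_cosAngle_le _ hz
  have hVWc := hz.2.2.2.2.2.2
  have hy0 := g.norm_fderiv_blendMap hc hz
  simp only [blendArg] at hcos hVW hcosinv hVWc hy0
  have hznorm := g.norm_tangentProj_raise_sub hp hw hgrad hgrad0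
  rw [← hgrad, ← g.norm_sq] at hy0
  have hD := g.norm_pos (x := x) hgrad0
  have hA := g.norm_raise_pos x hp
  have hBw := g.norm_raise_pos x hw
  have hA1 : g.norm x (g.raise x (P.gradHat η γ lam₀ k x)) ≤ C₀ :=
    hU.norm_raise_le x hx _ (hB.sq_le.trans (hI.grad_mem.le_norm hB hx))
      (P.norm_gradHat_le hη hunit (by omega) x)
  have hB1 : g.norm x (g.raise x (P.N (k + 1))) ≤ C₀ :=
    hU.norm_raise_le x hx _ (by
      rw [hunit (k + 1) hk]
      exact hB.sq_le.trans ((div_le_one (hB.pos.trans_le hB.le)).2 hB.le))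
      (hunit (k + 1) hk).le
  have hD1 : (g.norm x (g.grad (P.uhat η γ lam₀ (k + 1)) x))⁻¹ ≤ C₀ := by
    rw [grad_uhat hη hγ hl]
    exact hU.inv_norm_raise_le x hx _ (hB.sq_le.trans (hI'.le_norm hB hx))
      (P.norm_gradHat_le hη hunit hk x)
  set f := P.uhat η γ lam₀ (k + 1) with hf
  set p := P.gradHat η γ lam₀ k x
  set w := P.N (k + 1)
  set V := P.Nhat g η γ lam₀ k x
  set c := g.cosAngle x p w
  set z := g.tangentProj f x (g.raise x (p - w))
  set D := g.norm x (g.grad f x)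
  set h := lam γ lam₀ (k + 1) *
    deriv (deriv η) (lam γ lam₀ (k + 1) * (P.uhat η γ lam₀ k x - P.u (k + 1) x)) with hh
  set y₀ := fderiv ℝ g.blendMap (P.blendArg g η γ lam₀ k x) (0, 0, 1, 0, 0)
  set θ := Real.arccos ⟪V, w⟫ / Real.arccos c with hθ
  have hh0 : 0 ≤ h := mul_nonneg hlam.le (hη.convex _)
  have hh1 : h ≤ lam γ lam₀ (k + 1) * M := mul_le_mul_of_nonneg_left (hM _) hlam.le
  have hz0 := g.norm_nonneg x z
  -- The exact match: the angular speed in s and the tangential length |z| both contain the area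
  -- A·B·√(1 - c²), over 2D² and over D respectively.
  have hy₀ : ‖y₀‖ = θ * (g.norm x z / (2 * D)) := by
    change ‖fderiv ℝ g.blendMap (x, p, P.slope η γ lam₀ k x, V, w) (0, 0, 1, 0, 0)‖ = _
    rw [hy0, hznorm]
    field_simp
  -- the curvature
  have hH : D⁻¹ * (1 / 2 * h) * g.norm x z ^ 2 - n * (3 / 2 * C₀ ^ 4) ≤ g.meanCurvature f x := by
    rw [g.norm_sq]
    refine hU.le_meanCurvature (P.contDiff_uhat hη (k + 1)) hx hf0 (p - w) (1 / 2 * h) fun ξ => ?_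
    rw [P.fderiv_fderiv_uhat hη hγ hl, P.fderiv_gradHat_succ hη hγ hl, inner_add_left,
      inner_smul_left, inner_smul_left]
    have h1 := P.inner_fderiv_gradHat_nonneg hη hγ hl k x ξ
    have h2 := abs_le.1 (hη.abs_deriv_le_one
      (lam γ lam₀ (k + 1) * (P.uhat η γ lam₀ k x - P.u (k + 1) x)))
    have h3 := mul_nonneg (show 0 ≤ 1 / 2 * (1 + deriv η
      (lam γ lam₀ (k + 1) * (P.uhat η γ lam₀ k x - P.u (k + 1) x))) by linarith) h1
    simp only [conj_trivial]
    rw [← hh]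
    linarith
  -- the trace norm
  have hT : g.traceNormOnLevelSet f (P.Nhat g η γ lam₀ (k + 1)) x ≤
      h * g.norm x z * ‖y₀‖ + n * (C₀ * Λ * C₀) := by
    have h1 := g.traceNormOnLevelSet_le f (P.Nhat g η γ lam₀ (k + 1)) x (h • z) y₀
      (fun v => fderiv ℝ g.blendMap (P.blendArg g η γ lam₀ k x)
        (g.tangentProj f x v, fderiv ℝ (P.gradHat η γ lam₀ k) x (g.tangentProj f x v), 0,
          fderiv ℝ (P.Nhat g η γ lam₀ k) x (g.tangentProj f x v), 0)) (C₀ * Λ * C₀)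
      (fun v => by
        have h2 : g.form x z v = ⟪p - w, g.tangentProj f x v⟫ := by
          rw [g.form_tangentProj, g.form_raise]
        rw [P.fderiv_Nhat_succ g hη hγ hl hc hz hI.contDiffAt, map_smul, smul_apply, h2,
          smul_eq_mul, ← map_smul, ← map_add]
        simp [hh, p, w])
      (fun v => by
        refine (ContinuousLinearMap.le_opNorm _ _).trans ?_
        have h2 := hU.norm_tangentProj_le hx hgrad0 v
        have hΛ0 : 0 ≤ Λ := by linarith
        have h3 : ‖((g.tangentProj f x v,
            fderiv ℝ (P.gradHat η γ lam₀ k) x (g.tangentProj f x v), 0,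
            fderiv ℝ (P.Nhat g η γ lam₀ k) x (g.tangentProj f x v), 0) :
            E n × E n × ℝ × E n × E n)‖ ≤ Λ * ‖g.tangentProj f x v‖ := by
          refine norm_prod_five_le ?_ ?_ ?_ ?_ ?_
          · exact le_mul_of_one_le_left (norm_nonneg _) hΛ
          · exact (ContinuousLinearMap.le_opNorm _ _).trans (by gcongr)
          · rw [norm_zero]
            positivity
          · exact (ContinuousLinearMap.le_opNorm _ _).trans (by gcongr)
          · rw [norm_zero]
            positivity
        calc _ ≤ C₀ * (Λ * (C₀ * g.norm x v)) := by
              gcongr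
              · exact hU.norm_fderiv_blendMap_le _ hz
              · exact h3.trans (by gcongr)
          _ = _ := by ring)
    rwa [g.norm_const_smul, abs_of_nonneg hh0] at h1
  -- comparison
  have hθ1 : θ - 1 ≤ (C₀ + ((κ / R) ^ 2)⁻¹) * max (c - ⟪V, w⟫) 0 := by
    have hinv := inv_pos.2 hc
    refine arccos_div_arccos_sub_one_le hVW hcos ?_ (by linarith)
    have := inv_anti₀ hc hVWc
    linarith
  have hz1 : g.norm x z ≤ C₀ * C₀ * C₀ := by
    rw [hznorm, div_eq_mul_inv]
    have hs : √(1 - c ^ 2) ≤ 1 :=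
      Real.sqrt_le_iff.2 ⟨zero_le_one, by linarith [sq_nonneg c]⟩
    have : g.norm x (g.raise x p) * g.norm x (g.raise x w) * √(1 - c ^ 2) ≤ C₀ * C₀ * 1 := by
      gcongr
    rw [mul_one] at this
    exact mul_le_mul this hD1 (inv_pos.2 hD).le (by positivity)
  set e := h * g.norm x z ^ 2 / (2 * D) with he
  have he0 : 0 ≤ e := by positivity
  -- Six factors C₀ come from |z|² with |z| ≤ C₀³, the seventh from 1/D.
  have he1 : e ≤ M * C₀ ^ 7 * lam γ lam₀ (k + 1) := by
    have h1 : e = h * g.norm x z ^ 2 * D⁻¹ * (1 / 2) := by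
      rw [he]
      field_simp
    rw [h1]
    calc _ ≤ (lam γ lam₀ (k + 1) * M) * (C₀ * C₀ * C₀) ^ 2 * C₀ * 1 := by
          have hM0 : 0 ≤ lam γ lam₀ (k + 1) * M := hh0.trans hh1
          gcongr
          norm_num
      _ = _ := by ring
  have hm0 : 0 ≤ max (c - ⟪V, w⟫) 0 := le_max_right _ _
  have hmain : e * (θ - 1) ≤ M * C₀ ^ 7 * lam γ lam₀ (k + 1) *
      ((C₀ + ((κ / R) ^ 2)⁻¹) * max (c - ⟪V, w⟫) 0) := by
    have hinv := inv_pos.2 hc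
    refine (mul_le_mul_of_nonneg_left hθ1 he0).trans ?_
    exact mul_le_mul_of_nonneg_right he1 (by positivity)
  have hHe : D⁻¹ * (1 / 2 * h) * g.norm x z ^ 2 = e := by
    rw [he]
    field_simp
  have hTe : h * g.norm x z * ‖y₀‖ = e * θ := by
    rw [hy₀, he]
    field_simp
  rw [hHe] at hH
  rw [hTe] at hT
  have hn : (n : ℝ) * (3 / 2 * C₀ ^ 4) ≤ n * (3 / 2 * C₀ ^ 4) * Λ :=
    le_mul_of_one_le_right (by positivity) hΛ
  linarith

end HalfSpaces

theorem exists_uniform_const {q : ℕ} {p : ℕ → ℝ → Prop}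
    (hp : ∀ k a b, a ≤ b → p k a → p k b) (h : ∀ k ≤ q, ∃ C, 0 ≤ C ∧ p k C) :
    ∃ C, 0 ≤ C ∧ ∀ k ≤ q, p k C := by
  induction q with
  | zero =>
    obtain ⟨C, hC, h0⟩ := h 0 le_rfl
    exact ⟨C, hC, fun k hk => by obtain rfl : k = 0 := by omega
                                 exact h0⟩
  | succ q ih =>
    obtain ⟨C, hC, h0⟩ := ih fun k hk => h k (by omega)
    obtain ⟨C', hC', h1⟩ := h (q + 1) le_rfl
    refine ⟨max C C', hC.trans (le_max_left _ _), fun k hk => ?_⟩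
    rcases Nat.lt_or_ge q k with hk' | hk'
    · obtain rfl : k = q + 1 := by omega
      exact hp _ _ _ (le_max_right _ _) h1
    · exact hp _ _ _ (le_max_left _ _) (h0 k hk')

theorem exists_uniform_pos {q : ℕ} {p : ℕ → ℝ → Prop}
    (hp : ∀ k a b, b ≤ a → 0 < b → p k a → p k b) (h : ∀ k ≤ q, ∃ C, 0 < C ∧ p k C) :
    ∃ C, 0 < C ∧ ∀ k ≤ q, p k C := by
  induction q with
  | zero =>
    obtain ⟨C, hC, h0⟩ := h 0 le_rfl
    exact ⟨C, hC, fun k hk => by obtain rfl : k = 0 := by omega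
                                 exact h0⟩
  | succ q ih =>
    obtain ⟨C, hC, h0⟩ := ih fun k hk => h k (by omega)
    obtain ⟨C', hC', h1⟩ := h (q + 1) le_rfl
    refine ⟨min C C', lt_min hC hC', fun k hk => ?_⟩
    rcases Nat.lt_or_ge q k with hk' | hk'
    · obtain rfl : k = q + 1 := by omega
      exact hp _ _ _ (min_le_right _ _) (lt_min hC hC') h1
    · exact hp _ _ _ (min_le_left _ _) (lt_min hC hC') (h0 k hk')

/-! ### Transversality of the polytope by compactness, and the estimate for one step -/

namespace HalfSpaces

variable {n : ℕ} {P : HalfSpaces n} {η : ℝ → ℝ} {γ lam₀ : ℝ} {g : RiemannianMetric n}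

theorem u_sub (m : ℕ) (x y : E n) : P.u m x - P.u m y = ⟪P.N m, x - y⟫ := by
  simp only [u, inner_sub_right]
  ring

theorem u_neg_of_mem_interior (hunit : ∀ k ≤ P.q, ‖P.N k‖ = 1) {y : E n}
    (hy : y ∈ interior P.Omega) {m : ℕ} (hm : m ≤ P.q) : P.u m y < 0 := by
  obtain ⟨r, hr, hball⟩ := Metric.mem_nhds_iff.1 (mem_interior_iff_mem_nhds.1 hy)
  -- A step of length r/2 along the unit normal stays in Ω and raises u_m by r/2.
  have hmem : y + (r / 2) • P.N m ∈ P.Omega := hball (by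
    rw [Metric.mem_ball, dist_self_add_left, norm_smul, hunit m hm, mul_one,
      Real.norm_of_nonneg (by positivity)]
    linarith)
  have h1 := hmem m hm
  have h2 := P.u_sub m (y + (r / 2) • P.N m) y
  rw [add_sub_cancel_left, inner_smul_right, real_inner_self_eq_norm_sq, hunit m hm] at h2
  linarith

/-- Choose y interior with u_m(y) ≤ -ρ for all m; then u_m(x) ≥ -ρ/2 forces ⟨N_m, x - y⟩ = u_m(x) -
u_m(y) ≥ ρ/2. For a pair of faces that meet on Ω the obtuse angle is assumed. For any other pair
min(u_j, u_k) has a negative maximum on the compact set Ω, so the two faces are not both nearly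
active at one point. -/
theorem exists_coneBounds (hcompact : IsCompact P.Omega)
    (hinterior : (interior P.Omega).Nonempty) (hunit : ∀ k ≤ P.q, ‖P.N k‖ = 1)
    (hacute : ∀ j k, j < k → k ≤ P.q → (∃ x ∈ P.Omega, P.u j x = 0 ∧ P.u k x = 0) →
      ⟪P.N j, P.N k⟫ ≤ 0) :
    ∃ y κ R ε, P.ConeBounds y κ R ε := by
  obtain ⟨y, hy⟩ := hinterior
  obtain ⟨ρ, hρ, hρ'⟩ := exists_uniform_pos (q := P.q) (p := fun m r => P.u m y ≤ -r)
    (fun _ _ _ h _ h' => h'.trans (neg_le_neg h))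
    (fun m hm => ⟨-P.u m y, neg_pos.2 (u_neg_of_mem_interior hunit hy hm), by simp⟩)
  have hpair : ∀ j k, j < k → k ≤ P.q → ∃ e : ℝ, 0 < e ∧
      ∀ x ∈ P.Omega, -e ≤ P.u j x → -e ≤ P.u k x → ⟪P.N j, P.N k⟫ ≤ 0 := by
    intro j k hjk hk
    by_cases hex : ∃ x ∈ P.Omega, P.u j x = 0 ∧ P.u k x = 0
    · exact ⟨1, one_pos, fun _ _ _ _ => hacute j k hjk hk hex⟩
    · obtain ⟨x₀, hx₀, hmax⟩ := hcompact.exists_isMaxOn ⟨y, interior_subset hy⟩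
        (f := fun x => min (P.u j x) (P.u k x))
        ((P.contDiff_u j).continuous.min (P.contDiff_u k).continuous).continuousOn
      have hneg : min (P.u j x₀) (P.u k x₀) < 0 := by
        by_contra! h
        exact hex ⟨x₀, hx₀, le_antisymm (hx₀ j (by omega)) (h.trans (min_le_left _ _)),
          le_antisymm (hx₀ k hk) (h.trans (min_le_right _ _))⟩
      refine ⟨-(min (P.u j x₀) (P.u k x₀)) / 2, by linarith, fun x hx h1 h2 => ?_⟩
      have h3 : min (P.u j x) (P.u k x) ≤ min (P.u j x₀) (P.u k x₀) := hmax hx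
      have h4 := le_min h1 h2
      linarith
  obtain ⟨e, he, he'⟩ := exists_uniform_pos (q := P.q)
    (p := fun k e => ∀ j ≤ P.q, j < k → ∀ x ∈ P.Omega, -e ≤ P.u j x → -e ≤ P.u k x →
      ⟪P.N j, P.N k⟫ ≤ 0)
    (fun k a b hab _ h j hj hjk x hx h1 h2 => h j hj hjk x hx (by linarith) (by linarith))
    (fun k hk => exists_uniform_pos
      (p := fun j e => j < k → ∀ x ∈ P.Omega, -e ≤ P.u j x → -e ≤ P.u k x →
        ⟪P.N j, P.N k⟫ ≤ 0)
      (fun j a b hab _ h hjk x hx h1 h2 => h hjk x hx (by linarith) (by linarith))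
      (fun j _ => by
        by_cases hjk : j < k
        · obtain ⟨e, he, h⟩ := hpair j k hjk hk
          exact ⟨e, he, fun _ => h⟩
        · exact ⟨1, one_pos, fun h => absurd h hjk⟩))
  obtain ⟨R, hR⟩ := hcompact.exists_bound_of_continuousOn (f := fun x => x - y)
    (continuous_id.sub continuous_const).continuousOn
  refine ⟨y, ρ / 2, max R (ρ / 2), min e (ρ / 2), by positivity, le_max_right _ _,
    lt_min he (by positivity), fun x hx => (hR x hx).trans (le_max_left _ _),
    fun x hx m hm hu => ?_, fun x hx j k hjk hk hj hk' => ?_⟩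
  · have h1 := hρ' m hm
    have h2 := min_le_right e (ρ / 2)
    rw [← P.u_sub]
    linarith
  · have h2 := min_le_left e (ρ / 2)
    exact he' k hk j (by omega) hjk x hx (by linarith) (by linarith)

theorem eventuallyEq_of_forall_lt (hη : IsSmoothAbs η) (hγ : γ ∈ Set.Ioo (0 : ℝ) (1 / 2))
    (hl : 1 ≤ lam₀) {j k : ℕ} (hjk : j ≤ k) {x : E n}
    (h : ∀ m, j + 1 ≤ m → m ≤ k → (lam γ lam₀ m)⁻¹ < P.uhat η γ lam₀ (m - 1) x - P.u m x) :
    P.uhat η γ lam₀ k =ᶠ[nhds x] P.uhat η γ lam₀ j ∧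
      P.Nhat g η γ lam₀ k =ᶠ[nhds x] P.Nhat g η γ lam₀ j := by
  induction k, hjk using Nat.le_induction with
  | base => exact ⟨Filter.EventuallyEq.rfl, Filter.EventuallyEq.rfl⟩
  | succ k hk ih =>
    have h1 := P.uhat_succ_eventuallyEq_uhat hη hγ hl g (h (k + 1) (by omega) le_rfl)
    have h2 := ih fun m hm hmk => h m hm (by omega)
    exact ⟨h1.1.trans h2.1, h1.2.trans h2.2⟩

/-- The estimate at a point of `{û_{k+1} = 0}`, in terms of bounds for the previous step. -/
theorem exists_step_estimate {y : E n} {κ R ε C₀ C₁ : ℝ} (hη : IsSmoothAbs η)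
    (hunit : ∀ k ≤ P.q, ‖P.N k‖ = 1) (hB : P.ConeBounds y κ R ε)
    (hU : UniformBounds g P.Omega ((κ / R) ^ 2) C₀)
    (hC : ∀ k ≤ P.q, ∀ γ ∈ Set.Ioo (0 : ℝ) (1 / 2), ∀ lam₀, 1 ≤ lam₀ → ∀ x ∈ P.Omega,
      -ε + k * (2 * lam₀⁻¹) ≤ P.uhat η γ lam₀ k x →
      Controlled (P := P) g y κ ε C₁ η γ lam₀ k x) :
    ∃ C, 0 < C ∧ ∀ γ ∈ Set.Ioo (0 : ℝ) (1 / 2), ∀ lam₀, 1 ≤ lam₀ → P.q * (2 * lam₀⁻¹) ≤ ε →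
      ∀ k, k + 1 ≤ P.q → ∀ x ∈ P.Omega, P.uhat η γ lam₀ (k + 1) x = 0 → ∀ Λ, 1 ≤ Λ →
      ‖fderiv ℝ (P.gradHat η γ lam₀ k) x‖ ≤ Λ → ‖fderiv ℝ (P.Nhat g η γ lam₀ k) x‖ ≤ Λ →
      -C * lam γ lam₀ (k + 1) *
        max (g.cosAngle x (P.gradHat η γ lam₀ k x) (P.N (k + 1))
          - ⟪P.Nhat g η γ lam₀ k x, P.N (k + 1)⟫) 0 - C * Λ
      ≤ g.meanCurvature (P.uhat η γ lam₀ (k + 1)) x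
        - g.traceNormOnLevelSet (P.uhat η γ lam₀ (k + 1)) (P.Nhat g η γ lam₀ (k + 1)) x := by
  obtain ⟨M, hM, hM'⟩ := hη.exists_abs_deriv_deriv_le
  have hC₀ := hU.one_le
  have hinv := inv_pos.2 hB.sq_pos
  set K₁ := M * C₀ ^ 7 * (C₀ + ((κ / R) ^ 2)⁻¹)
  set K₂ := (n : ℝ) * (3 / 2 * C₀ ^ 4) + n * (C₀ * C₀)
  have hK₁ : 0 ≤ K₁ := by positivity
  have hK₂ : 0 ≤ K₂ := by positivity
  refine ⟨K₁ + K₂ + 1, by positivity, fun γ hγ lam₀ hl hL k hk x hx hu0 Λ hΛ hΛG hΛN => ?_⟩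
  have hlam := lam_pos hγ hl (k + 1)
  have hl0 : 0 < lam₀⁻¹ := inv_pos.2 (by linarith)
  have hkq : ((k : ℝ) + 1) * (2 * lam₀⁻¹) ≤ ε := by
    refine le_trans ?_ hL
    gcongr
    exact_mod_cast hk
  have hk0 : (0 : ℝ) ≤ k * (2 * lam₀⁻¹) := by positivity
  have hI' := hC (k + 1) hk γ hγ lam₀ hl x hx (by rw [hu0]; push_cast; linarith)
  have hf0 := fderiv_uhat_ne_zero hη hγ hl (hI'.grad_mem.ne_zero hB hx)
  set m := max (g.cosAngle x (P.gradHat η γ lam₀ k x) (P.N (k + 1))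
          - ⟪P.Nhat g η γ lam₀ k x, P.N (k + 1)⟫) 0
  have hm : 0 ≤ m := le_max_right _ _
  have hlm : 0 ≤ lam γ lam₀ (k + 1) * m := by positivity
  have hweak : -(K₁ + K₂ + 1) * lam γ lam₀ (k + 1) * m - (K₁ + K₂ + 1) * Λ ≤
      -K₁ * lam γ lam₀ (k + 1) * m - K₂ * Λ := by
    nlinarith [mul_nonneg (by positivity : 0 ≤ K₂ + 1) hlm,
      mul_nonneg (by positivity : 0 ≤ K₁ + 1) (by linarith : 0 ≤ Λ)]
  refine hweak.trans ?_
  -- Outside the transition region dN̂_{k+1} is dN̂_k or 0, hence O(Λ), and convexity of û_{k+1}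
  -- alone bounds the curvature below by a constant.
  have hcrude : ‖fderiv ℝ (P.Nhat g η γ lam₀ (k + 1)) x‖ ≤ Λ →
      -K₁ * lam γ lam₀ (k + 1) * m - K₂ * Λ ≤ g.meanCurvature (P.uhat η γ lam₀ (k + 1)) x
        - g.traceNormOnLevelSet (P.uhat η γ lam₀ (k + 1)) (P.Nhat g η γ lam₀ (k + 1)) x := by
    intro hΛ'
    have h1 := hU.le_meanCurvature (P.contDiff_uhat hη (k + 1)) hx hf0 0 0 fun ξ => by
      rw [P.fderiv_fderiv_uhat hη hγ hl, zero_mul]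
      exact P.inner_fderiv_gradHat_nonneg hη hγ hl (k + 1) x ξ
    have h2 := hU.traceNormOnLevelSet_le hx (g.grad_ne_zero hf0) hΛ'
    have h3 : (n : ℝ) * (3 / 2 * C₀ ^ 4) ≤ n * (3 / 2 * C₀ ^ 4) * Λ :=
      le_mul_of_one_le_right (by positivity) hΛ
    have h4 : (n : ℝ) * (Λ * C₀) ≤ n * (C₀ * C₀) * Λ := by
      have : (n : ℝ) * (Λ * C₀) * 1 ≤ n * (Λ * C₀) * C₀ :=
        mul_le_mul_of_nonneg_left hC₀ (by positivity)
      linarith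
    have h5 := mul_nonneg hK₁ hlm
    rw [mul_zero, zero_mul] at h1
    have h6 : K₂ * Λ = n * (3 / 2 * C₀ ^ 4) * Λ + n * (C₀ * C₀) * Λ := by ring
    linarith
  rcases lt_or_ge (lam γ lam₀ (k + 1))⁻¹ (P.uhat η γ lam₀ k x - P.u (k + 1) x) with h | h
  · refine hcrude ?_
    rwa [(P.uhat_succ_eventuallyEq_uhat hη hγ hl g h).2.fderiv_eq]
  rcases lt_or_ge (P.uhat η γ lam₀ k x - P.u (k + 1) x) (-(lam γ lam₀ (k + 1))⁻¹) with h' | h'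
  · refine hcrude ?_
    rw [(P.uhat_succ_eventuallyEq_u hη hγ hl g h').2.fderiv_eq]
    simp only [fderiv_fun_const, Pi.zero_apply, norm_zero]
    linarith
  have hclose := P.uhat_succ_sub_le hη hγ hl (abs_le.2 ⟨h', h⟩)
  have hI := hC k (by omega) γ hγ lam₀ hl x hx (by linarith)
  exact transition_estimate hη hunit hB hU hM' hγ hl hk hx (by linarith) hI hI'.grad_mem hΛ
    hΛG hΛN

theorem gradHat_eventuallyEq (hη : IsSmoothAbs η) (hγ : γ ∈ Set.Ioo (0 : ℝ) (1 / 2))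
    (hl : 1 ≤ lam₀) {j k : ℕ} {x : E n}
    (h : P.uhat η γ lam₀ k =ᶠ[nhds x] P.uhat η γ lam₀ j) :
    P.gradHat η γ lam₀ k =ᶠ[nhds x] P.gradHat η γ lam₀ j := by
  filter_upwards [h.fderiv (𝕜 := ℝ)] with y hy
  rw [P.fderiv_uhat hη hγ hl, P.fderiv_uhat hη hγ hl] at hy
  exact eq_of_innerSL_eq hy

theorem gradHat_eventuallyEq_const (hη : IsSmoothAbs η) (hγ : γ ∈ Set.Ioo (0 : ℝ) (1 / 2))
    (hl : 1 ≤ lam₀) {j k : ℕ} {x : E n} (h : P.uhat η γ lam₀ k =ᶠ[nhds x] P.u j) :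
    P.gradHat η γ lam₀ k =ᶠ[nhds x] fun _ => P.N j := by
  filter_upwards [h.fderiv (𝕜 := ℝ)] with y hy
  rw [P.fderiv_uhat hη hγ hl, P.fderiv_u] at hy
  exact eq_of_innerSL_eq hy

theorem form_unitNormal_u (j k : ℕ) (x : E n) :
    g.form x (g.unitNormal (P.u j) x) (g.unitNormal (P.u k) x) =
      g.cosAngle x (P.N j) (P.N k) := by
  simp only [RiemannianMetric.unitNormal, RiemannianMetric.grad, P.fderiv_u]
  rfl

end HalfSpaces

end PolytopeSmoothing

end

/-! ### Assembly of the estimates on the two kinds of regions -/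

open PolytopeSmoothing
theorem mainTheorem7 (n : ℕ) (hn : 3 ≤ n) (P : HalfSpaces n)
    (hcompact : IsCompact P.Omega)
    (hinterior : (interior P.Omega).Nonempty)
    (hredundant : ∀ k ≤ P.q, ∃ x, 0 < P.u k x ∧ ∀ m ≤ P.q, m ≠ k → P.u m x ≤ 0)
    (hunit : ∀ k ≤ P.q, ‖P.N k‖ = 1)
    (hacute : ∀ j k, j < k → k ≤ P.q → (∃ x ∈ P.Omega, P.u j x = 0 ∧ P.u k x = 0) →
      ⟪P.N j, P.N k⟫ ≤ 0)
    (g : RiemannianMetric n)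
    (hangle : ∀ j k, j < k → k ≤ P.q → ∀ x ∈ P.Omega, P.u j x = 0 → P.u k x = 0 →
      g.form x (g.unitNormal (P.u j) x) (g.unitNormal (P.u k) x) ≤ ⟪P.N j, P.N k⟫)
    (hmean : ∀ k ≤ P.q, ∀ x ∈ P.Omega, P.u k x = 0 → 0 ≤ g.meanCurvature (P.u k) x)
    (η : ℝ → ℝ) (hη : IsSmoothAbs η) :
    ∃ C > 0, ∃ L > 1, ∀ γ ∈ Set.Ioo (0 : ℝ) (1 / 2), ∀ lam₀ ≥ L,
      (∀ x ∈ P.SigmaHat η γ lam₀,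
        fderiv ℝ (P.uhat η γ lam₀ P.q) x ≠ 0 ∧ ContDiffAt ℝ ∞ (P.Nhat g η γ lam₀ P.q) x) ∧
      (∀ i j k, i < j → j < k → k ≤ P.q → ∀ x ∈ P.regionG η γ lam₀ i j k,
        P.H g η γ lam₀ x - P.trNormDNhat g η γ lam₀ x ≥
          -C * lam γ lam₀ k *
            max (g.form x (g.unitNormal (P.uhat η γ lam₀ j) x) (g.unitNormal (P.u k) x)
              - ⟪P.Nhat g η γ lam₀ j x, P.N k⟫) 0
          - C * lam γ lam₀ j) ∧
      (∀ j k, j < k → k ≤ P.q → ∀ x ∈ P.regionE η γ lam₀ j k,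
        P.H g η γ lam₀ x - P.trNormDNhat g η γ lam₀ x ≥
          -C * lam γ lam₀ k *
            max (g.form x (g.unitNormal (P.u j) x) (g.unitNormal (P.u k) x)
              - ⟪P.N j, P.N k⟫) 0
          - C) := by
  obtain ⟨y, κ, R, ε, hB⟩ := HalfSpaces.exists_coneBounds hcompact hinterior hunit hacute
  obtain ⟨C₀, hU⟩ := exists_uniformBounds g hcompact hB.sq_pos
  obtain ⟨C₁, hC₁, hC⟩ := exists_uniform_const (q := P.q)
    (p := fun k C => ∀ γ ∈ Set.Ioo (0 : ℝ) (1 / 2), ∀ lam₀, 1 ≤ lam₀ → ∀ x ∈ P.Omega,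
      -ε + k * (2 * lam₀⁻¹) ≤ P.uhat η γ lam₀ k x →
      HalfSpaces.Controlled (P := P) g y κ ε C η γ lam₀ k x)
    (fun k a b hab h γ hγ lam₀ hl x hx hu => by
      have h1 := h γ hγ lam₀ hl x hx hu
      exact ⟨h1.grad_mem, h1.Nhat_mem, h1.norm_Nhat, h1.contDiffAt,
        h1.norm_fderiv_le.trans (mul_le_mul_of_nonneg_right hab (lam_pos hγ hl k).le)⟩)
    (fun k hk => HalfSpaces.exists_controlled g hη hunit hB hU hk)
  obtain ⟨C₂, hC₂, hG⟩ := exists_uniform_const (q := P.q)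
    (p := fun k C => ∀ γ ∈ Set.Ioo (0 : ℝ) (1 / 2), ∀ lam₀, 1 ≤ lam₀ → ∀ x,
      ‖fderiv ℝ (P.gradHat η γ lam₀ k) x‖ ≤ C * lam γ lam₀ k)
    (fun k a b hab h γ hγ lam₀ hl x =>
      (h γ hγ lam₀ hl x).trans (mul_le_mul_of_nonneg_right hab (lam_pos hγ hl k).le))
    (fun k hk => P.exists_norm_fderiv_gradHat_le hη hunit hk)
  obtain ⟨C₃, hC₃, hstep⟩ := HalfSpaces.exists_step_estimate hη hunit hB hU hC
  have hε := hB.eps_pos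
  set D := 1 + C₁ + C₂
  have hD : 1 ≤ D := by linarith
  -- The bound λ₀ ≥ 2q/ε leaves room for q losses of 2/λ₀ below the threshold ε; the summand 2
  -- ensures L > 1. The factor D turns Λ = Dλ_j into a multiple of λ_j.
  refine ⟨C₃ * D, by positivity, 2 + P.q * 2 / ε, by
    have : 0 ≤ P.q * 2 / ε := by positivity
    linarith, fun γ hγ lam₀ hL => ?_⟩
  have hq0 : 0 ≤ P.q * 2 / ε := by positivity
  have hl : 1 ≤ lam₀ := by linarith
  have hl0 : 0 < lam₀ := by linarith
  have hLε : P.q * (2 * lam₀⁻¹) ≤ ε := by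
    have h1 : P.q * 2 / ε ≤ lam₀ := by linarith
    rw [div_le_iff₀ hε] at h1
    rw [← mul_assoc, ← div_eq_mul_inv, div_le_iff₀ hl0]
    linarith
  have hΩ := P.SigmaHat_subset_Omega hη hγ hl
  have hgerm : ∀ {k : ℕ} {x : E n}, k ≤ P.q →
      (∀ m, k + 1 ≤ m → m ≤ P.q → (lam γ lam₀ m)⁻¹ < P.uhat η γ lam₀ (m - 1) x - P.u m x) →
      x ∈ P.SigmaHat η γ lam₀ → P.uhat η γ lam₀ k x = 0 ∧
      P.H g η γ lam₀ x - P.trNormDNhat g η γ lam₀ x = g.meanCurvature (P.uhat η γ lam₀ k) x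
        - g.traceNormOnLevelSet (P.uhat η γ lam₀ k) (P.Nhat g η γ lam₀ k) x := by
    intro k x hk hm hx
    have h1 := HalfSpaces.eventuallyEq_of_forall_lt (g := g) hη hγ hl hk hm
    refine ⟨h1.1.self_of_nhds.symm.trans hx, ?_⟩
    rw [HalfSpaces.H, HalfSpaces.trNormDNhat, g.meanCurvature_congr h1.1,
      g.traceNormOnLevelSet_congr h1.1 h1.2]
  have hweak : ∀ {a b t Λ : ℝ}, 0 ≤ a → -C₃ * a * max b 0 - C₃ * (D * Λ) ≤ t →
      t ≥ -(C₃ * D) * a * max b 0 - C₃ * D * Λ := by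
    intro a b t Λ ha h
    have h1 : C₃ * (a * max b 0) * 1 ≤ C₃ * (a * max b 0) * D :=
      mul_le_mul_of_nonneg_left hD (mul_nonneg hC₃.le (mul_nonneg ha (le_max_right _ _)))
    linarith
  refine ⟨fun x hx => ?_, fun i j k hij hjk hk x hx => ?_, fun j k hjk hk x hx => ?_⟩
  · have hI := hC P.q le_rfl γ hγ lam₀ hl x (hΩ hx) (by
      rw [show P.uhat η γ lam₀ P.q x = 0 from hx]
      linarith)
    exact ⟨HalfSpaces.fderiv_uhat_ne_zero hη hγ hl (hI.grad_mem.ne_zero hB (hΩ hx)),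
      hI.contDiffAt⟩
  · obtain ⟨hS, hk1, hk2, hk3, -⟩ := hx
    -- From here on k is the previous index, so the face in question is k + 1.
    obtain ⟨k, rfl⟩ : ∃ k', k = k' + 1 := ⟨k - 1, by omega⟩
    obtain ⟨hu0, heq⟩ := hgerm hk hk1 hS
    have hg := HalfSpaces.eventuallyEq_of_forall_lt (g := g) hη hγ hl (by omega : j ≤ k) hk2
    have hgrad := HalfSpaces.gradHat_eventuallyEq hη hγ hl hg.1
    have hlj' : 1 ≤ lam γ lam₀ j := hl.trans (le_lam hγ hl j)
    have hlk := lam_pos hγ hl (k + 1)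
    have hcast : ((j : ℝ) + 1) * (2 * lam₀⁻¹) ≤ P.q * (2 * lam₀⁻¹) := by
      gcongr
      exact_mod_cast (by omega : j + 1 ≤ P.q)
    have hinv : (lam γ lam₀ (k + 1))⁻¹ ≤ lam₀⁻¹ := inv_anti₀ hl0 (le_lam hγ hl (k + 1))
    -- Here û_j(x) ≥ -2/λ_{k+1} ≥ -2/λ₀, and (j + 1) · 2/λ₀ ≤ ε by the choice of L, so level j is
    -- controlled at x.
    have hIj := hC j (by omega) γ hγ lam₀ hl x (hΩ hS) (by
      have h1 : -2 * (lam γ lam₀ (k + 1))⁻¹ ≤ P.uhat η γ lam₀ k x := hk3.1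
      rw [hg.1.self_of_nhds] at h1
      linarith)
    have hmain := hstep γ hγ lam₀ hl hLε k hk x (hΩ hS) hu0 (D * lam γ lam₀ j)
      (one_le_mul_of_one_le_of_one_le hD hlj')
      (by
        rw [hgrad.fderiv_eq]
        exact (hG j (by omega) γ hγ lam₀ hl x).trans (by gcongr; linarith))
      (by
        rw [hg.2.fderiv_eq]
        exact hIj.norm_fderiv_le.trans (by gcongr; linarith))
    rw [hgrad.self_of_nhds, hg.2.self_of_nhds, ← P.form_unitNormal_uhat g hη hγ hl] at hmain
    rw [heq]
    exact hweak hlk.le hmain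
  · obtain ⟨hS, hk1, hk2, -, -, -, hj⟩ := hx
    obtain ⟨k, rfl⟩ : ∃ k', k = k' + 1 := ⟨k - 1, by omega⟩
    obtain ⟨hu0, heq⟩ := hgerm hk hk1 hS
    have hg := HalfSpaces.eventuallyEq_of_forall_lt (g := g) hη hγ hl (by omega : j ≤ k) hk2
    -- On this region û_j is locally the affine function u_j, by definition if j = 0. Gradient and
    -- N̂_j are then both the constant N_j, so Λ = 1 suffices and no λ_j appears.
    have hgj : P.uhat η γ lam₀ j =ᶠ[nhds x] P.u j ∧
        P.Nhat g η γ lam₀ j =ᶠ[nhds x] fun _ => P.N j := by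
      rcases j with _ | j
      · exact ⟨Filter.EventuallyEq.rfl, Filter.EventuallyEq.rfl⟩
      · exact P.uhat_succ_eventuallyEq_u hη hγ hl g (hj (by omega))
    have hgrad := HalfSpaces.gradHat_eventuallyEq_const hη hγ hl (hg.1.trans hgj.1)
    have hN := hg.2.trans hgj.2
    have hlk := lam_pos hγ hl (k + 1)
    have hmain := hstep γ hγ lam₀ hl hLε k hk x (hΩ hS) hu0 1 le_rfl
      (by
        rw [hgrad.fderiv_eq]
        simp)
      (by
        rw [hN.fderiv_eq]
        simp)
    rw [hgrad.self_of_nhds, hN.self_of_nhds, ← HalfSpaces.form_unitNormal_u] at hmain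
    rw [heq]
    have h1 := hweak (Λ := 1) hlk.le
      (hmain.trans' (by gcongr 1; exact mul_le_mul_of_nonneg_left (by simpa using hD) hC₃.le))
    simpa using h1
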